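/- **Setting.** Let $T>0$, $N\ge 0$. For a function $\Psi(x,t,\varepsilon)$ on $\mathbb R\times[0,T]$ depending on $\varepsilon>0$, write $\Psi=O(\varepsilon^n)$ if for every compact $K\subset\mathbb R\times[0,T]$ there are $C,\varepsilon_0>0$ with $|\Psi(x,t,\varepsilon)|\le C\varepsilon^n$ for all $\varepsilon\in(0,\varepsilon_0)$ and $(x,t)\in K$. Consider the variable-coefficient modified Camassa–Holm equation $$a\,u_t-\varepsilon^2u_{xxt}+b\,u^2u_x-2\varepsilon^2u_xu_{xx}-\varepsilon^2uu_{xxx}=0,\qquad(1)$$ with $a(x,t,\varepsilon)=\sum_{k=0}^N\varepsilon^ka_k(x,t)+O(\varepsilon^{N+1})$ and $b(x,t,\varepsilon)=\sum_{k=0}^N\varepsilon^kb_k(x,t)+O(\varepsilon^{N+1})$. Let $G$ be the space of $C^\infty$ functions $f(x,t,\tau)$ on $\mathbb R\times[0,T]\times\mathbb R$ for which there is a smooth $f^-(x,t)$ such that for all $n,p,q,r\ge0$ one has $\tau^n\partial_x^p\partial_t^q\partial_\tau^rf\to0$ as $\tau\to+\infty$ and $\tau^n\partial_x^p\partial_t^q\partial_\tau^r(f-f^-)\to0$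 as $\tau\to-\infty$, uniformly for $(x,t)$ in compact subsets of $\mathbb R\times[0,T]$; let $G_0=\{f\in G: f\to0\text{ as }\tau\to-\infty\text{ uniformly on compact sets}\}$. Let $\widetilde G\supset\widetilde G_0$ be the analogous spaces of functions $g(t,\tau)$ on $[0,T]\times\mathbb R$, with uniformity in $t\in[0,T]$. **Hypotheses.** 1. $a_j,b_j\in C^\infty(\mathbb R\times[0,T])$ for $0\le j\le N$, and $a_0b_0\ne0$ on $\mathbb R\times[0,T]$. 2. $\varphi$ solves $\varphi'(t)=6\,a_0(\varphi(t),t)/b_0(\varphi(t),t)$ on $[0,T]$, and $a_0(\varphi(t),t)>0$ for all $t\in[0,T]$. **Terms.** Let $C_0\in C^\infty([0,T])$ be arbitrary and, with $a_0,b_0$ evaluated at $(\varphi(t),t)$, put $$v_0(t,\tau)=-6\,\frac{a_0}{b_0}\cosh^{-2}\Big(\sqrt{a_0}\,\frac{\tau}{2}+C_0(t)\Big).$$ For $1\le j\le N$ let $v_j\in\widetilde G$ be a solution of $$(\varphi'-v_0)\partial_\tau^3v_j-a_0\varphi'\partial_\tau v_j+b_0\,\partial_\tau(v_0^2v_j)-2\,\partial_\tau(\partial_\tau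 v_0\,\partial_\tau v_j)-(\partial_\tau^3v_0)\,v_j=\mathcal F_j,\qquad(2_j)$$ where $-\mathcal F_j(t,\tau)$ is the coefficient of $\varepsilon^{j-1}$ obtained by formally substituting $\sum_{l<j}\varepsilon^lv_l\big(t,\frac{x-\varphi(t)}\varepsilon\big)$, $\sum_k\varepsilon^ka_k$, $\sum_k\varepsilon^kb_k$ for $u$, $a$, $b$ in the left-hand side of (1), setting $x=\varphi(t)+\varepsilon\tau$ and expanding $a_k,b_k$ in Taylor series in $x$ at $\varphi(t)$. Put $\Phi_j(t,\tau)=\int_{-\infty}^\tau\mathcal F_j(t,\xi)\,d\xi+E_j(t)$, with $E_j(t)$ such that $\lim_{\tau\to+\infty}\Phi_j(t,\tau)=0$. The remaining hypotheses concern these functions. 3. (Orthogonality.) $\int_{-\infty}^{+\infty}\mathcal F_j(t,\tau)\,v_0(t,\tau)\,d\tau=0$ for all $t\in[0,T]$, $1\le j\le N$. 4. $\lim_{\tau\to-\infty}\Phi_j(t,\tau)=0$ for all $t\in[0,T]$, $1\le j\le N$. **Theorem.** Under hypotheses 1 and 2 the following hold. (i) The terms can be constructed successively: if $0\le n<N$,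 if $v_0,\dots,v_n$ are as above, and if the conditions in 3 and 4 hold for $1\le j\le n+1$, then $(2_{n+1})$ has a solution in $\widetilde G_0$. (ii) For every choice of $v_1,\dots,v_N$ as above satisfying 3 and 4, put $V_j(x,t,\tau)=v_j(t,\tau)$ and $$u_N(x,t,\varepsilon)=\sum_{j=0}^N\varepsilon^jV_j(x,t,\tau),\qquad \tau=\frac{x-\varphi(t)}\varepsilon .$$ Then $u_N(\cdot,\cdot,\varepsilon)$ is $C^\infty$ on $\mathbb R\times[0,T]$ for each $\varepsilon>0$, and: * $u_N$ is an $N$-th one-phase soliton-like approximation with zero background: $\varphi\in C^\infty([0,T])$, $V_0\in G_0$ is nontrivial, $V_j\in G$ (indeed $V_j\in G_0$) for $1\le j\le N$, and $u_N=\sum_{j=0}^n\varepsilon^jV_j\big(x,t,\frac{x-\varphi(t)}\varepsilon\big)+O(\varepsilon^{n+1})$ for every $n\le N$; * $u_N$ satisfies (1) on $\mathbb R\times[0,T]$ with accuracy $O(\varepsilon^N)$, i.e. the left-hand side of (1) at $u=u_N$ is $O(\varepsilon^N)$; * as $\tau\to\pm\infty$, $u_N$ satisfies (1) with accuracy $O(\varepsilon^{N+1})$: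 for every $\kappa>0$ and every compact $K\subset\mathbb R\times[0,T]$ there are $C,\varepsilon_0>0$ such that the left-hand side of (1) at $u=u_N$ is at most $C\varepsilon^{N+1}$ in absolute value for all $\varepsilon\in(0,\varepsilon_0)$ and all $(x,t)\in K$ with $|\tau|\ge\varepsilon^{-\kappa}$. In particular this bound holds, for all sufficiently small $\varepsilon$, uniformly on $\{(x,t)\in K:|x-\varphi(t)|\ge\mu\}$ for each fixed $\mu>0$. -/

import Mathlib

open Set Filter Topology
open scoped ContDiff

noncomputable section

namespace VcmCH

/-- The strip `ℝ × [0,T]`, points written `(x, t)`. -/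
def strip (T : ℝ) : Set (ℝ × ℝ) := univ ×ˢ Icc 0 T

/-- `Ψ(x,t,ε) = O(ε^n)`: for every compact `K ⊆ ℝ × [0,T]` there are `C > 0` and `ε₀ > 0` with
`|Ψ(x,t,ε)| ≤ C ε^n` for all `ε ∈ (0,ε₀)` and `(x,t) ∈ K`. -/
def IsBigOEps (T : ℝ) (n : ℕ) (Ψ : ℝ → ℝ → ℝ → ℝ) : Prop :=
  ∀ K : Set (ℝ × ℝ), IsCompact K → K ⊆ strip T →
    ∃ C > 0, ∃ ε₀ > 0, ∀ ε ∈ Ioo 0 ε₀, ∀ z ∈ K, |Ψ z.1 z.2 ε| ≤ C * ε ^ n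

/-- `Ψ(x,t,ε) = O(ε^n)` as `τ = (x - φ(t)) / ε → ±∞`: for every `κ > 0` and every compact
`K ⊆ ℝ × [0,T]` the bound holds uniformly at the points of `K` where `|τ| ≥ ε^(-κ)`.
Taking `κ < 1`, for small `ε` these points include all points of `K` with `|x - φ(t)| ≥ μ`,
for each fixed `μ > 0`. -/
def IsBigOEpsAtInfinity (T : ℝ) (φ : ℝ → ℝ) (n : ℕ) (Ψ : ℝ → ℝ → ℝ → ℝ) : Prop :=
  ∀ κ : ℝ, 0 < κ → ∀ K : Set (ℝ × ℝ), IsCompact K → K ⊆ strip T →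
    ∃ C > 0, ∃ ε₀ > 0, ∀ ε ∈ Ioo 0 ε₀, ∀ z ∈ K,
      ε ^ (-κ) ≤ |(z.1 - φ z.2) / ε| → |Ψ z.1 z.2 ε| ≤ C * ε ^ n

/-- `∂_x^p ∂_t^q ∂_τ^r f (x,t,τ)` for `f` on `ℝ × [0,T] × ℝ` (one-sided in `t` at `0` and `T`). -/
def partialXTTau (T : ℝ) (p q r : ℕ) (f : ℝ → ℝ → ℝ → ℝ) (x t τ : ℝ) : ℝ :=
  iteratedDeriv p
    (fun y => iteratedDerivWithin q (fun s => iteratedDeriv r (fun σ => f y s σ) τ) (Icc 0 T) t) x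

/-- `∂_t^p ∂_τ^q g (t,τ)` for `g` on `[0,T] × ℝ` (one-sided in `t` at `0` and `T`). -/
def partialTTau (T : ℝ) (p q : ℕ) (g : ℝ → ℝ → ℝ) (t τ : ℝ) : ℝ :=
  iteratedDerivWithin p (fun s => iteratedDeriv q (fun σ => g s σ) τ) (Icc 0 T) t

/-- The space `G`. -/
def InG (T : ℝ) (f : ℝ → ℝ → ℝ → ℝ) : Prop :=
  ContDiffOn ℝ ∞ (fun z : ℝ × ℝ × ℝ => f z.1 z.2.1 z.2.2) (univ ×ˢ Icc 0 T ×ˢ univ) ∧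
  (∀ n p q r : ℕ, ∀ K : Set (ℝ × ℝ), IsCompact K → K ⊆ strip T →
    TendstoUniformlyOn (fun (τ : ℝ) (z : ℝ × ℝ) => τ ^ n * partialXTTau T p q r f z.1 z.2 τ)
      (fun _ => 0) atTop K) ∧
  ∃ fm : ℝ → ℝ → ℝ, ContDiffOn ℝ ∞ (fun z : ℝ × ℝ => fm z.1 z.2) (strip T) ∧
    ∀ n p q r : ℕ, ∀ K : Set (ℝ × ℝ), IsCompact K → K ⊆ strip T →
      TendstoUniformlyOn (fun (τ : ℝ) (z : ℝ × ℝ) =>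
          τ ^ n * partialXTTau T p q r (fun x t σ => f x t σ - fm x t) z.1 z.2 τ)
        (fun _ => 0) atBot K

/-- The subspace `G₀` of `G`. -/
def InG0 (T : ℝ) (f : ℝ → ℝ → ℝ → ℝ) : Prop :=
  InG T f ∧ ∀ K : Set (ℝ × ℝ), IsCompact K → K ⊆ strip T →
    TendstoUniformlyOn (fun (τ : ℝ) (z : ℝ × ℝ) => f z.1 z.2 τ) (fun _ => 0) atBot K

/-- The space `G̃`. -/
def InGt (T : ℝ) (g : ℝ → ℝ → ℝ) : Prop :=
  ContDiffOn ℝ ∞ (fun z : ℝ × ℝ => g z.1 z.2) (Icc 0 T ×ˢ univ) ∧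
  (∀ n p q : ℕ, TendstoUniformlyOn (fun τ t : ℝ => τ ^ n * partialTTau T p q g t τ)
    (fun _ => 0) atTop (Icc 0 T)) ∧
  ∃ gm : ℝ → ℝ, ContDiffOn ℝ ∞ gm (Icc 0 T) ∧
    ∀ n p q : ℕ, TendstoUniformlyOn
      (fun τ t : ℝ => τ ^ n * partialTTau T p q (fun s σ => g s σ - gm s) t τ)
      (fun _ => 0) atBot (Icc 0 T)

/-- The subspace `G̃₀` of `G̃`. -/
def InGt0 (T : ℝ) (g : ℝ → ℝ → ℝ) : Prop :=
  InGt T g ∧ TendstoUniformlyOn (fun τ t : ℝ => g t τ) (fun _ => 0) atBot (Icc 0 T)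

/-- The left-hand side of the variable-coefficient mCH equation
`a u_t - ε² u_xxt + b u² u_x - 2 ε² u_x u_xx - ε² u u_xxx`
with `a = a(x,t,ε)`, `b = b(x,t,ε)`, at `u = u(x,t,ε)`. -/
def residual (T : ℝ) (a b u : ℝ → ℝ → ℝ → ℝ) (x t ε : ℝ) : ℝ :=
  a x t ε * derivWithin (fun s => u x s ε) (Icc 0 T) t
    - ε ^ 2 * derivWithin (fun s => iteratedDeriv 2 (fun y => u y s ε) x) (Icc 0 T) t
    + b x t ε * u x t ε ^ 2 * deriv (fun y => u y t ε) x
    - 2 * ε ^ 2 * deriv (fun y => u y t ε) x * iteratedDeriv 2 (fun y => u y t ε) x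
    - ε ^ 2 * u x t ε * iteratedDeriv 3 (fun y => u y t ε) x

/-- `φ` solves `φ' = 6 a₀(φ,t) / b₀(φ,t)` on `[0,T]`. -/
def IsPhase (T : ℝ) (a₀ b₀ : ℝ → ℝ → ℝ) (φ : ℝ → ℝ) : Prop :=
  ∀ t ∈ Icc 0 T, HasDerivWithinAt φ (6 * a₀ (φ t) t / b₀ (φ t) t) (Icc 0 T) t

/-- The main term `-6 (a₀/b₀) cosh⁻²(√a₀ τ/2 + C₀(t))`, with `a₀, b₀` taken at `(φ(t), t)`. -/
def mainTerm (a₀ b₀ : ℝ → ℝ → ℝ) (φ C₀ : ℝ → ℝ) (t τ : ℝ) : ℝ :=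
  -6 * (a₀ (φ t) t / b₀ (φ t) t) / Real.cosh (Real.sqrt (a₀ (φ t) t) * τ / 2 + C₀ t) ^ 2

/-- The coefficient of `ε^m` in the formal expansion of `∑ ε^k c_k(φ(t) + ε τ, t)`. -/
def coeffExpansion (c : ℕ → ℝ → ℝ → ℝ) (φ : ℝ → ℝ) (m : ℕ) (t τ : ℝ) : ℝ :=
  ∑ p ∈ Finset.HasAntidiagonal.antidiagonal m,
    τ ^ p.2 / (p.2.factorial : ℝ) * iteratedDeriv p.2 (fun x => c p.1 x t) (φ t)

/-- The coefficient of `ε^n` (`n ≥ 0`) obtained by formally substituting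
`u = ∑ ε^l v_l(t,τ)`, `τ = (x - φ(t)) / ε`, `a = ∑ ε^k a_k(x,t)`, `b = ∑ ε^k b_k(x,t)` into the
left-hand side of the equation, with `x = φ(t) + ε τ` and `a_k`, `b_k` expanded in Taylor series
in `x` at `φ(t)`. -/
def orderCoeff (T : ℝ) (a b : ℕ → ℝ → ℝ → ℝ) (φ : ℝ → ℝ) (v : ℕ → ℝ → ℝ → ℝ)
    (n : ℕ) (t τ : ℝ) : ℝ :=
  (∑ p ∈ Finset.HasAntidiagonal.antidiagonal n,
        coeffExpansion a φ p.1 t τ * partialTTau T 1 0 (v p.2) t τ)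
    - derivWithin φ (Icc 0 T) t * (∑ p ∈ Finset.HasAntidiagonal.antidiagonal (n + 1),
        coeffExpansion a φ p.1 t τ * partialTTau T 0 1 (v p.2) t τ)
    - partialTTau T 1 2 (v n) t τ
    + derivWithin φ (Icc 0 T) t * partialTTau T 0 3 (v (n + 1)) t τ
    + (∑ p ∈ Finset.HasAntidiagonal.antidiagonal (n + 1), ∑ q ∈ Finset.HasAntidiagonal.antidiagonal p.2,
        ∑ r ∈ Finset.HasAntidiagonal.antidiagonal q.2,
          coeffExpansion b φ p.1 t τ * v q.1 t τ * v r.1 t τ * partialTTau T 0 1 (v r.2) t τ)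
    - 2 * (∑ p ∈ Finset.HasAntidiagonal.antidiagonal (n + 1),
        partialTTau T 0 1 (v p.1) t τ * partialTTau T 0 2 (v p.2) t τ)
    - ∑ p ∈ Finset.HasAntidiagonal.antidiagonal (n + 1), v p.1 t τ * partialTTau T 0 3 (v p.2) t τ

/-- The right-hand side `𝓕_j(t,τ)`, `j ≥ 1`, of the equation for `v_j`: minus the coefficient of
`ε^(j-1)` produced by `v_0, …, v_{j-1}` alone. -/
def forcing (T : ℝ) (a b : ℕ → ℝ → ℝ → ℝ) (φ : ℝ → ℝ) (v : ℕ → ℝ → ℝ → ℝ)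
    (j : ℕ) (t τ : ℝ) : ℝ :=
  -orderCoeff T a b φ (fun l => if l < j then v l else fun _ _ => 0) (j - 1) t τ

/-- `w` solves on `[0,T] × ℝ` the equation for the `j`-th term:
`(φ' - v₀) w_τττ - a₀ φ' w_τ + b₀ ∂_τ(v₀² w) - 2 ∂_τ(v₀_τ w_τ) - v₀_τττ w = 𝓕_j`. -/
def SolvesTermEq (T : ℝ) (a b : ℕ → ℝ → ℝ → ℝ) (φ : ℝ → ℝ) (v : ℕ → ℝ → ℝ → ℝ)
    (j : ℕ) (w : ℝ → ℝ → ℝ) : Prop :=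
  ∀ t ∈ Icc 0 T, ∀ τ : ℝ,
    (derivWithin φ (Icc 0 T) t - v 0 t τ) * iteratedDeriv 3 (w t) τ
      - a 0 (φ t) t * derivWithin φ (Icc 0 T) t * deriv (w t) τ
      + b 0 (φ t) t * deriv (fun σ => v 0 t σ ^ 2 * w t σ) τ
      - 2 * deriv (fun σ => deriv (v 0 t) σ * deriv (w t) σ) τ
      - iteratedDeriv 3 (v 0 t) τ * w t τ
    = forcing T a b φ v j t τ

/-- `v_0, …, v_n` are terms of the expansion on the curve `x = φ(t)`: `v_0` is the main term and,
for `1 ≤ j ≤ n`, `v_j ∈ G̃` solves the equation for the `j`-th term. -/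
def AreTerms (T : ℝ) (a b : ℕ → ℝ → ℝ → ℝ) (φ C₀ : ℝ → ℝ) (n : ℕ)
    (v : ℕ → ℝ → ℝ → ℝ) : Prop :=
  (∀ t ∈ Icc 0 T, ∀ τ : ℝ, v 0 t τ = mainTerm (a 0) (b 0) φ C₀ t τ) ∧
  ∀ j, 1 ≤ j → j ≤ n → InGt T (v j) ∧ SolvesTermEq T a b φ v j (v j)

/-- The orthogonality condition `∫ 𝓕_j v₀ dτ = 0` for all `t ∈ [0,T]`. -/
def Orthogonality (T : ℝ) (a b : ℕ → ℝ → ℝ → ℝ) (φ : ℝ → ℝ) (v : ℕ → ℝ → ℝ → ℝ)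
    (j : ℕ) : Prop :=
  ∀ t ∈ Icc 0 T, ∫ τ, forcing T a b φ v j t τ * v 0 t τ = 0

/-- `Φ_j(t,τ) = ∫_{-∞}^τ 𝓕_j(t,ξ) dξ + E_j(t)`, where `E_j(t) = -∫_ℝ 𝓕_j(t,ξ) dξ` is the constant
of integration for which `Φ_j(t,τ) → 0` as `τ → +∞`. -/
def primitiveForcing (T : ℝ) (a b : ℕ → ℝ → ℝ → ℝ) (φ : ℝ → ℝ) (v : ℕ → ℝ → ℝ → ℝ)
    (j : ℕ) (t τ : ℝ) : ℝ :=
  (∫ ξ in Iic τ, forcing T a b φ v j t ξ) + -∫ ξ, forcing T a b φ v j t ξ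

/-- The condition `lim_{τ → -∞} Φ_j(t,τ) = 0` for all `t ∈ [0,T]`. -/
def LimitCondition (T : ℝ) (a b : ℕ → ℝ → ℝ → ℝ) (φ : ℝ → ℝ) (v : ℕ → ℝ → ℝ → ℝ)
    (j : ℕ) : Prop :=
  ∀ t ∈ Icc 0 T, Tendsto (primitiveForcing T a b φ v j t) atBot (𝓝 0)

/-- The continuation `V_j(x,t,τ) = v_j(t,τ)` off the curve `x = φ(t)`. -/
def prolong (v : ℕ → ℝ → ℝ → ℝ) (j : ℕ) (_x t τ : ℝ) : ℝ := v j t τ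

/-- `∑_{j ≤ n} ε^j [U_j(x,t) + V_j(x,t,(x - φ(t))/ε)]`. -/
def partialSum (φ : ℝ → ℝ) (U : ℕ → ℝ → ℝ → ℝ) (V : ℕ → ℝ → ℝ → ℝ → ℝ) (n : ℕ)
    (x t ε : ℝ) : ℝ :=
  ∑ j ∈ Finset.range (n + 1), ε ^ j * (U j x t + V j x t ((x - φ t) / ε))

/-- `u` is, up to order `N`, a one-phase soliton-like function with phase `φ`, background terms
`U_j` and singular terms `V_j`. -/
def IsSolitonLike (T : ℝ) (N : ℕ) (φ : ℝ → ℝ) (U : ℕ → ℝ → ℝ → ℝ) (V : ℕ → ℝ → ℝ → ℝ → ℝ)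
    (u : ℝ → ℝ → ℝ → ℝ) : Prop :=
  ContDiffOn ℝ ∞ φ (Icc 0 T) ∧
  (∀ j ≤ N, ContDiffOn ℝ ∞ (fun z : ℝ × ℝ => U j z.1 z.2) (strip T)) ∧
  InG0 T (V 0) ∧ (∃ x, ∃ t ∈ Icc 0 T, ∃ τ, V 0 x t τ ≠ 0) ∧
  (∀ j, 1 ≤ j → j ≤ N → InG T (V j)) ∧
  ∀ n ≤ N, IsBigOEps T (n + 1) (fun x t ε => u x t ε - partialSum φ U V n x t ε)

/-- The approximation `u_N(x,t,ε) = ∑_{j ≤ N} ε^j V_j(x,t,(x - φ(t))/ε)` (zero background). -/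
def approx (φ : ℝ → ℝ) (V : ℕ → ℝ → ℝ → ℝ → ℝ) (N : ℕ) (x t ε : ℝ) : ℝ :=
  ∑ j ∈ Finset.range (N + 1), ε ^ j * V j x t ((x - φ t) / ε)

end VcmCH

end

noncomputable section

namespace VcmCH

open MeasureTheory

/-! Write c = φ' and take a₀, b₀ on the curve. The operator acting on a term is the `τ`-derivative
of a second-order expression (`hasDerivAt_firstIntegral`), so the equation for a term integrates
once, to (c - v₀) w'' - v₀' w' + (-a₀ c + b₀ v₀² - v₀'') w = Φ. Since b₀ c = 6 a₀ and v₀ = -c sech²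
y with y = √a₀ τ/2 + C₀, division by a₀ c / 4 leaves one equation whose coefficients do not depend
on t: ((1 + S) W')' + (-4 + 4 S + 18 S²) W = g, where S = sech² y.

This equation is self-adjoint. Its solution `solA` = S tanh is ∂_τ v₀ up to a factor and decays like
S; reduction of order gives a second solution `solB`, which grows like cosh² y. Variation of
constants therefore gives a rapidly decaying W for rapidly decaying g once ∫ solA g = 0. The limit
condition makes 𝓕_j of mean zero, so that Φ decays at both ends, and integration by parts turns ∫
𝓕_j v₀ = 0 into ∫ Φ ∂_τ v₀ = 0, which is the required solvability condition
(`exists_firstIntegral_eq`). Smoothness in t follows because the solution operator commutes with ∂_t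
(`Sch.varConst`).

A term is only assumed to lie in G̃, where it may have a nonzero limit at -∞. But the first integral
minus Φ is constant in τ, tends to 0 at +∞ and to -a₀ c times that limit at -∞; as a₀ c ≠ 0 the
limit vanishes (`sch_of_solves`). By induction every term decays rapidly at both ends (`sch_terms`).

For the accuracy, multiply the residual by ε and replace a, b by their formal expansions on the
curve. The replacement costs ε^(N+1) times a power of 1 + |τ| (`expansion_error`), and the decay of
the terms absorbs that power. What remains is a polynomial in ε whose coefficients up to order N
vanish: order 0 is the travelling-wave equation of v₀, order n+1 is the equation for v_{n+1}
(`exists_residualPoly_bound`). Division by ε leaves O(ε^N). Where |τ| ≥ ε^(-κ), every term is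
smaller than any power of ε, which gives O(ε^(N+1)) there. -/

/-- `ft` and `fy` are the partial derivatives of `f` on `[0,T] × ℝ`. -/
def HasPartials (T : ℝ) (f ft fy : ℝ → ℝ → ℝ) : Prop :=
  ∀ t ∈ Icc 0 T, ∀ y : ℝ,
    HasDerivWithinAt (fun s => f s y) (ft t y) (Icc 0 T) t ∧ HasDerivAt (f t) (fy t y) y

/-- Joint continuity on `[0,T] × ℝ`. -/
def ContOn (T : ℝ) (f : ℝ → ℝ → ℝ) : Prop :=
  ContinuousOn (fun z : ℝ × ℝ => f z.1 z.2) (Icc 0 T ×ˢ univ)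

/-- `f` has continuous partial derivatives on `[0,T] × ℝ` up to order `k`, all of which
satisfy `P`. -/
def Tame (T : ℝ) (P : (ℝ → ℝ → ℝ) → Prop) : ℕ → (ℝ → ℝ → ℝ) → Prop
  | 0, f => ContOn T f ∧ P f
  | k + 1, f => (ContOn T f ∧ P f) ∧
      ∃ ft fy, HasPartials T f ft fy ∧ Tame T P k ft ∧ Tame T P k fy

/-- Decay faster than any power of `τ`, uniformly in `t`. -/
def Rapid (T : ℝ) (f : ℝ → ℝ → ℝ) : Prop :=
  ∀ n : ℕ, ∃ C, ∀ t ∈ Icc 0 T, ∀ y : ℝ, (1 + |y|) ^ n * |f t y| ≤ C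

/-- At most polynomial growth in `τ`, uniformly in `t`. -/
def Moderate (T : ℝ) (f : ℝ → ℝ → ℝ) : Prop :=
  ∃ n : ℕ, ∃ C, ∀ t ∈ Icc 0 T, ∀ y : ℝ, |f t y| ≤ C * (1 + |y|) ^ n

/-- Smooth functions on `[0,T] × ℝ`, described by their partial derivatives. -/
def Smooth (T : ℝ) (f : ℝ → ℝ → ℝ) : Prop := ∀ k, Tame T (fun _ => True) k f

/-- Smooth functions all of whose partial derivatives decay rapidly in `τ`. -/
def Sch (T : ℝ) (f : ℝ → ℝ → ℝ) : Prop := ∀ k, Tame T (Rapid T) k f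

/-- Smooth functions all of whose partial derivatives have polynomial growth in `τ`. -/
def Temp (T : ℝ) (f : ℝ → ℝ → ℝ) : Prop := ∀ k, Tame T (Moderate T) k f

/-! ### Differential calculus on `[0,T] × ℝ` through partial derivatives -/

section Tame

variable {T : ℝ} {P Q R : (ℝ → ℝ → ℝ) → Prop} {f g ft fy gt gy : ℝ → ℝ → ℝ} {k : ℕ}

theorem ContOn.congr (hf : ContOn T f) (h : ∀ t ∈ Icc 0 T, ∀ y, g t y = f t y) : ContOn T g :=
  ContinuousOn.congr hf fun z hz => h z.1 hz.1 z.2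

theorem ContOn.slice (hf : ContOn T f) {t : ℝ} (ht : t ∈ Icc 0 T) : Continuous (f t) :=
  hf.comp_continuous (f := fun y : ℝ => (t, y)) (by fun_prop) fun y => ⟨ht, mem_univ _⟩

theorem HasPartials.congr (hf : HasPartials T f ft fy) (h : ∀ t ∈ Icc 0 T, ∀ y, g t y = f t y) :
    HasPartials T g ft fy := fun t ht y =>
  ⟨(hf t ht y).1.congr (fun s hs => h s hs y) (h t ht y), by
    have : g t = f t := funext (h t ht)
    rw [this]; exact (hf t ht y).2⟩

theorem HasPartials.add (hf : HasPartials T f ft fy) (hg : HasPartials T g gt gy) :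
    HasPartials T (fun t y => f t y + g t y) (fun t y => ft t y + gt t y)
      (fun t y => fy t y + gy t y) := fun t ht y =>
  ⟨(hf t ht y).1.add (hg t ht y).1, (hf t ht y).2.add (hg t ht y).2⟩

theorem HasPartials.mul (hf : HasPartials T f ft fy) (hg : HasPartials T g gt gy) :
    HasPartials T (fun t y => f t y * g t y) (fun t y => ft t y * g t y + f t y * gt t y)
      (fun t y => fy t y * g t y + f t y * gy t y) := fun t ht y =>
  ⟨(hf t ht y).1.mul (hg t ht y).1, (hf t ht y).2.mul (hg t ht y).2⟩

theorem HasPartials.unique (hT : 0 < T) {ft' fy' : ℝ → ℝ → ℝ} (hf : HasPartials T f ft fy)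
    (hf' : HasPartials T f ft' fy') {t : ℝ} (ht : t ∈ Icc 0 T) (y : ℝ) :
    ft t y = ft' t y ∧ fy t y = fy' t y :=
  ⟨(uniqueDiffOn_Icc hT t ht).eq_deriv _ (hf t ht y).1 (hf' t ht y).1,
    (hf t ht y).2.unique (hf' t ht y).2⟩

theorem Tame.contOn (hf : Tame T P k f) : ContOn T f := by
  cases k with
  | zero => exact hf.1
  | succ k => exact hf.1.1

theorem Tame.prop (hf : Tame T P k f) : P f := by
  cases k with
  | zero => exact hf.2
  | succ k => exact hf.1.2

theorem Tame.of_succ (hf : Tame T P (k + 1) f) : Tame T P k f := by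
  induction k generalizing f with
  | zero => exact hf.1
  | succ k ih =>
    obtain ⟨h, ft, fy, h1, h2, h3⟩ := hf
    exact ⟨h, ft, fy, h1, ih h2, ih h3⟩

theorem Tame.mono (hPQ : ∀ f, P f → Q f) (hf : Tame T P k f) : Tame T Q k f := by
  induction k generalizing f with
  | zero => exact ⟨hf.1, hPQ _ hf.2⟩
  | succ k ih =>
    obtain ⟨h, ft, fy, h1, h2, h3⟩ := hf
    exact ⟨⟨h.1, hPQ _ h.2⟩, ft, fy, h1, ih h2, ih h3⟩

theorem Tame.congr (hP : ∀ f g, (∀ t ∈ Icc 0 T, ∀ y, g t y = f t y) → P f → P g)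
    (hf : Tame T P k f) (h : ∀ t ∈ Icc 0 T, ∀ y, g t y = f t y) : Tame T P k g := by
  cases k with
  | zero => exact ⟨hf.1.congr h, hP _ _ h hf.2⟩
  | succ k =>
    obtain ⟨h', ft, fy, h1, h2⟩ := hf
    exact ⟨⟨h'.1.congr h, hP _ _ h h'.2⟩, ft, fy, h1.congr h, h2⟩

theorem Tame.add (hP : ∀ f g, P f → P g → P (fun t y => f t y + g t y))
    (hf : Tame T P k f) (hg : Tame T P k g) : Tame T P k (fun t y => f t y + g t y) := by
  induction k generalizing f g with
  | zero => exact ⟨ContinuousOn.add hf.1 hg.1, hP _ _ hf.2 hg.2⟩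
  | succ k ih =>
    obtain ⟨h, ft, fy, h1, h2, h3⟩ := hf
    obtain ⟨h', gt, gy, h1', h2', h3'⟩ := hg
    exact ⟨⟨ContinuousOn.add h.1 h'.1, hP _ _ h.2 h'.2⟩, _, _, h1.add h1', ih h2 h2', ih h3 h3'⟩

/-- The three predicates let a single Leibniz induction serve both for moderate times moderate and
for rapid times moderate. -/
theorem Tame.mul (hPQ : ∀ f g, P f → Q g → R (fun t y => f t y * g t y))
    (hR : ∀ f g, R f → R g → R (fun t y => f t y + g t y))
    (hf : Tame T P k f) (hg : Tame T Q k g) : Tame T R k (fun t y => f t y * g t y) := by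
  induction k generalizing f g with
  | zero => exact ⟨ContinuousOn.mul hf.1 hg.1, hPQ _ _ hf.2 hg.2⟩
  | succ k ih =>
    have hf' := hf.of_succ
    have hg' := hg.of_succ
    obtain ⟨h, ft, fy, h1, h2, h3⟩ := hf
    obtain ⟨h', gt, gy, h1', h2', h3'⟩ := hg
    exact ⟨⟨ContinuousOn.mul h.1 h'.1, hPQ _ _ h.2 h'.2⟩, _, _, h1.mul h1',
      (ih h2 hg').add hR (ih hf' h2'), (ih h3 hg').add hR (ih hf' h3')⟩

theorem Rapid.congr (hf : Rapid T f) (h : ∀ t ∈ Icc 0 T, ∀ y, g t y = f t y) : Rapid T g := by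
  intro n
  obtain ⟨C, hC⟩ := hf n
  exact ⟨C, fun t ht y => by rw [h t ht y]; exact hC t ht y⟩

theorem Rapid.add (hf : Rapid T f) (hg : Rapid T g) : Rapid T (fun t y => f t y + g t y) := by
  intro n
  obtain ⟨C, hC⟩ := hf n
  obtain ⟨D, hD⟩ := hg n
  refine ⟨C + D, fun t ht y => ?_⟩
  have h1 := hC t ht y
  have h2 := hD t ht y
  have h3 := abs_add_le (f t y) (g t y)
  have h4 : 0 ≤ (1 + |y|) ^ n := by positivity
  nlinarith

theorem Rapid.mul (hf : Rapid T f) (hg : Moderate T g) : Rapid T (fun t y => f t y * g t y) := by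
  intro n
  obtain ⟨m, D, hD⟩ := hg
  obtain ⟨C, hC⟩ := hf (n + m)
  refine ⟨C * |D|, fun t ht y => ?_⟩
  have h1 := hC t ht y
  have h2 := hD t ht y
  have h4 : 0 ≤ (1 + |y|) ^ m := by positivity
  rw [abs_mul]
  calc (1 + |y|) ^ n * (|f t y| * |g t y|)
      ≤ (1 + |y|) ^ n * (|f t y| * (|D| * (1 + |y|) ^ m)) := by
        gcongr
        exact h2.trans (by gcongr; exact le_abs_self D)
    _ = ((1 + |y|) ^ (n + m) * |f t y|) * |D| := by ring
    _ ≤ C * |D| := by gcongr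

theorem Rapid.moderate (hf : Rapid T f) : Moderate T f := by
  obtain ⟨C, hC⟩ := hf 0
  exact ⟨0, C, fun t ht y => by simpa using hC t ht y⟩

theorem Rapid.bounded (hf : Rapid T f) : ∃ C, 0 ≤ C ∧ ∀ t ∈ Icc 0 T, ∀ y, |f t y| ≤ C := by
  obtain ⟨C, hC⟩ := hf 0
  exact ⟨|C|, abs_nonneg _, fun t ht y => by simpa using (hC t ht y).trans (le_abs_self C)⟩

theorem Moderate.congr (hf : Moderate T f) (h : ∀ t ∈ Icc 0 T, ∀ y, g t y = f t y) :
    Moderate T g := by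
  obtain ⟨n, C, hC⟩ := hf
  exact ⟨n, C, fun t ht y => by rw [h t ht y]; exact hC t ht y⟩

theorem Moderate.add (hf : Moderate T f) (hg : Moderate T g) :
    Moderate T (fun t y => f t y + g t y) := by
  obtain ⟨n, C, hC⟩ := hf
  obtain ⟨m, D, hD⟩ := hg
  refine ⟨n + m, |C| + |D|, fun t ht y => (abs_add_le _ _).trans ?_⟩
  have h0 : 1 ≤ 1 + |y| := by linarith [abs_nonneg y]
  rw [add_mul]
  refine add_le_add ((hC t ht y).trans ?_) ((hD t ht y).trans ?_)
  · refine mul_le_mul (le_abs_self C) (pow_le_pow_right₀ h0 (by omega)) (by positivity)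
      (abs_nonneg _)
  · refine mul_le_mul (le_abs_self D) (pow_le_pow_right₀ h0 (by omega)) (by positivity)
      (abs_nonneg _)

theorem Moderate.mul (hf : Moderate T f) (hg : Moderate T g) :
    Moderate T (fun t y => f t y * g t y) := by
  obtain ⟨n, C, hC⟩ := hf
  obtain ⟨m, D, hD⟩ := hg
  refine ⟨n + m, |C| * |D|, fun t ht y => ?_⟩
  rw [abs_mul, pow_add, mul_mul_mul_comm]
  exact mul_le_mul ((hC t ht y).trans (by gcongr; exact le_abs_self C))
    ((hD t ht y).trans (by gcongr; exact le_abs_self D)) (abs_nonneg _) (by positivity)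

theorem rapid_zero : Rapid T (fun _ _ => 0) := fun n => ⟨0, by simp⟩

theorem moderate_const (c : ℝ) : Moderate T (fun _ _ => c) := ⟨0, |c|, by simp⟩

theorem hasPartials_const (c : ℝ) : HasPartials T (fun _ _ => c) (fun _ _ => 0) (fun _ _ => 0) :=
  fun _ _ _ => ⟨hasDerivWithinAt_const _ _ _, hasDerivAt_const _ _⟩

theorem tame_zero (hP : P (fun _ _ => 0)) : Tame T P k (fun _ _ => 0) := by
  induction k with
  | zero => exact ⟨continuousOn_const, hP⟩
  | succ k ih => exact ⟨⟨continuousOn_const, hP⟩, _, _, hasPartials_const 0, ih, ih⟩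

theorem sch_zero : Sch T (fun _ _ => 0) := fun _ => tame_zero rapid_zero

theorem temp_const (c : ℝ) : Temp T (fun _ _ => c) := fun k => by
  cases k with
  | zero => exact ⟨continuousOn_const, moderate_const c⟩
  | succ k =>
    exact ⟨⟨continuousOn_const, moderate_const c⟩, _, _, hasPartials_const c,
      tame_zero (moderate_const 0), tame_zero (moderate_const 0)⟩

theorem Sch.rapid (hf : Sch T f) : Rapid T f := (hf 0).2

theorem Sch.contOn (hf : Sch T f) : ContOn T f := (hf 0).1

theorem Temp.moderate (hf : Temp T f) : Moderate T f := (hf 0).2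

theorem Sch.congr (hf : Sch T f) (h : ∀ t ∈ Icc 0 T, ∀ y, g t y = f t y) : Sch T g :=
  fun k => (hf k).congr (fun _ _ h h' => h'.congr h) h

theorem Temp.congr (hf : Temp T f) (h : ∀ t ∈ Icc 0 T, ∀ y, g t y = f t y) : Temp T g :=
  fun k => (hf k).congr (fun _ _ h h' => h'.congr h) h

theorem Smooth.congr (hf : Smooth T f) (h : ∀ t ∈ Icc 0 T, ∀ y, g t y = f t y) : Smooth T g :=
  fun k => (hf k).congr (fun _ _ _ _ => trivial) h

theorem Sch.temp (hf : Sch T f) : Temp T f := fun k => (hf k).mono fun _ h => h.moderate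

theorem Sch.smooth (hf : Sch T f) : Smooth T f := fun k => (hf k).mono fun _ _ => trivial

theorem Sch.add (hf : Sch T f) (hg : Sch T g) : Sch T (fun t y => f t y + g t y) :=
  fun k => (hf k).add (fun _ _ => Rapid.add) (hg k)

theorem Temp.add (hf : Temp T f) (hg : Temp T g) : Temp T (fun t y => f t y + g t y) :=
  fun k => (hf k).add (fun _ _ => Moderate.add) (hg k)

theorem Tame.mul_moderate (hf : Tame T (Rapid T) k f) (hg : Tame T (Moderate T) k g) :
    Tame T (Rapid T) k (fun t y => f t y * g t y) :=
  hf.mul (fun _ _ => Rapid.mul) (fun _ _ => Rapid.add) hg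

theorem Sch.mul (hf : Sch T f) (hg : Temp T g) : Sch T (fun t y => f t y * g t y) :=
  fun k => (hf k).mul_moderate (hg k)

theorem Temp.mul (hf : Temp T f) (hg : Temp T g) : Temp T (fun t y => f t y * g t y) :=
  fun k => (hf k).mul (fun _ _ => Moderate.mul) (fun _ _ => Moderate.add) (hg k)

theorem Temp.mul_sch (hf : Temp T f) (hg : Sch T g) : Sch T (fun t y => f t y * g t y) :=
  (hg.mul hf).congr fun _ _ _ => mul_comm _ _

theorem Sch.neg (hf : Sch T f) : Sch T (fun t y => -f t y) :=
  (hf.mul (temp_const (-1))).congr fun _ _ _ => by ring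

theorem Sch.sub (hf : Sch T f) (hg : Sch T g) : Sch T (fun t y => f t y - g t y) :=
  (hf.add hg.neg).congr fun _ _ _ => by ring

theorem Temp.neg (hf : Temp T f) : Temp T (fun t y => -f t y) :=
  (hf.mul (temp_const (-1))).congr fun _ _ _ => by ring

theorem Temp.sub (hf : Temp T f) (hg : Temp T g) : Temp T (fun t y => f t y - g t y) :=
  (hf.add hg.neg).congr fun _ _ _ => by ring

theorem Temp.pow (hf : Temp T f) (n : ℕ) : Temp T (fun t y => f t y ^ n) := by
  induction n with
  | zero => exact (temp_const 1).congr fun _ _ _ => by simp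
  | succ n ih => exact (ih.mul hf).congr fun _ _ _ => by ring

theorem sch_sum {ι : Type*} (s : Finset ι) {F : ι → ℝ → ℝ → ℝ} (h : ∀ i ∈ s, Sch T (F i)) :
    Sch T (fun t y => ∑ i ∈ s, F i t y) := by
  classical
  induction s using Finset.induction_on with
  | empty => simpa using sch_zero
  | insert a s ha ih =>
    refine ((h a (Finset.mem_insert_self _ _)).add
      (ih fun i hi => h i (Finset.mem_insert_of_mem hi))).congr fun t _ y => ?_
    rw [Finset.sum_insert ha]

theorem temp_sum {ι : Type*} (s : Finset ι) {F : ι → ℝ → ℝ → ℝ} (h : ∀ i ∈ s, Temp T (F i)) :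
    Temp T (fun t y => ∑ i ∈ s, F i t y) := by
  classical
  induction s using Finset.induction_on with
  | empty => simpa using temp_const 0
  | insert a s ha ih =>
    refine ((h a (Finset.mem_insert_self _ _)).add
      (ih fun i hi => h i (Finset.mem_insert_of_mem hi))).congr fun t _ y => ?_
    rw [Finset.sum_insert ha]

/-- Each order `k` comes with its own witnesses for the partials. Since `0 < T`, partials are
unique, so the pair found at order 1 serves all orders. -/
theorem Sch.exists_partials (hT : 0 < T) (hf : Sch T f) :
    ∃ ft fy, HasPartials T f ft fy ∧ Sch T ft ∧ Sch T fy := by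
  obtain ⟨_, ft, fy, h, _⟩ := hf 1
  refine ⟨ft, fy, h, fun k => ?_, fun k => ?_⟩ <;>
  · obtain ⟨_, ft', fy', h', h1, h2⟩ := hf (k + 1)
    first
    | exact h1.congr (fun _ _ h h' => h'.congr h) fun t ht y => (h.unique hT h' ht y).1
    | exact h2.congr (fun _ _ h h' => h'.congr h) fun t ht y => (h.unique hT h' ht y).2

theorem Smooth.exists_partials (hT : 0 < T) (hf : Smooth T f) :
    ∃ ft fy, HasPartials T f ft fy ∧ Smooth T ft ∧ Smooth T fy := by
  obtain ⟨_, ft, fy, h, _⟩ := hf 1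
  refine ⟨ft, fy, h, fun k => ?_, fun k => ?_⟩ <;>
  · obtain ⟨_, ft', fy', h', h1, h2⟩ := hf (k + 1)
    first
    | exact h1.congr (fun _ _ _ _ => trivial) fun t ht y => (h.unique hT h' ht y).1
    | exact h2.congr (fun _ _ _ _ => trivial) fun t ht y => (h.unique hT h' ht y).2

theorem Sch.of_hasPartials (hT : 0 < T) (hf : Sch T f) (h : HasPartials T f ft fy) :
    Sch T ft ∧ Sch T fy := by
  obtain ⟨gt, gy, h', h1, h2⟩ := hf.exists_partials hT
  exact ⟨h1.congr fun t ht y => (h.unique hT h' ht y).1,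
    h2.congr fun t ht y => (h.unique hT h' ht y).2⟩

theorem Smooth.of_hasPartials (hT : 0 < T) (hf : Smooth T f) (h : HasPartials T f ft fy) :
    Smooth T ft ∧ Smooth T fy := by
  obtain ⟨gt, gy, h', h1, h2⟩ := hf.exists_partials hT
  exact ⟨h1.congr fun t ht y => (h.unique hT h' ht y).1,
    h2.congr fun t ht y => (h.unique hT h' ht y).2⟩

theorem Smooth.hasPartials (hT : 0 < T) (hf : Smooth T f) :
    HasPartials T f (fun t y => derivWithin (fun s => f s y) (Icc 0 T) t)
      (fun t y => deriv (f t) y) := by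
  obtain ⟨ft, fy, h, -⟩ := hf.exists_partials hT
  intro t ht y
  exact ⟨(h t ht y).1.differentiableWithinAt.hasDerivWithinAt,
    (h t ht y).2.differentiableAt.hasDerivAt⟩

/-- The increment is split through the corner (t, y'). Both legs stay in the band, also at the end
times, and on each the mean value inequality applies to the function minus its linear part, whose
derivative is at most c/2 by continuity. -/
theorem HasPartials.hasFDerivWithinAt (h : HasPartials T f ft fy) (hft : ContOn T ft)
    (hfy : ContOn T fy) {z : ℝ × ℝ} (hz : z ∈ Icc 0 T ×ˢ (univ : Set ℝ)) :
    HasFDerivWithinAt (fun z : ℝ × ℝ => f z.1 z.2)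
      (ft z.1 z.2 • ContinuousLinearMap.fst ℝ ℝ ℝ + fy z.1 z.2 • ContinuousLinearMap.snd ℝ ℝ ℝ)
      (Icc 0 T ×ˢ univ) z := by
  rw [hasFDerivWithinAt_iff_isLittleO, Asymptotics.isLittleO_iff]
  intro c hc
  obtain ⟨t, y⟩ := z
  have ht : t ∈ Icc 0 T := hz.1
  obtain ⟨δ₁, hδ₁, h1⟩ := Metric.continuousOn_iff.1 hft (t, y) hz (c / 2) (by positivity)
  obtain ⟨δ₂, hδ₂, h2⟩ := Metric.continuousOn_iff.1 hfy (t, y) hz (c / 2) (by positivity)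
  set δ := min δ₁ δ₂
  have hδ : 0 < δ := lt_min hδ₁ hδ₂
  filter_upwards [self_mem_nhdsWithin, mem_nhdsWithin_of_mem_nhds (Metric.ball_mem_nhds (t, y) hδ)]
    with ⟨t', y'⟩ hz' hb
  have ht' : t' ∈ Icc 0 T := hz'.1
  rw [Metric.mem_ball, Prod.dist_eq, max_lt_iff] at hb
  obtain ⟨hbt, hby⟩ := hb
  simp only at hbt hby
  have e1 : ‖(f t' y' - ft t y * t') - (f t y' - ft t y * t)‖ ≤ c / 2 * ‖t' - t‖ := by
    refine Convex.norm_image_sub_le_of_norm_hasDerivWithin_le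
      (f := fun s => f s y' - ft t y * s) (f' := fun s => ft s y' - ft t y)
      (s := Icc 0 T ∩ Metric.ball t δ) ?_ ?_ ((convex_Icc 0 T).inter (convex_ball t δ))
      ⟨ht, Metric.mem_ball_self hδ⟩ ⟨ht', hbt⟩
    · intro s hs
      have := ((h s hs.1 y').1.mono inter_subset_left).sub
        (((hasDerivWithinAt_id s (Icc 0 T ∩ Metric.ball t δ)).const_mul (ft t y)))
      rw [mul_one] at this
      exact this
    · intro s hs
      have := h1 (s, y') ⟨hs.1, mem_univ _⟩ (by
        rw [Prod.dist_eq, max_lt_iff]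
        exact ⟨(Metric.mem_ball.1 hs.2).trans_le (min_le_left _ _),
          hby.trans_le (min_le_left _ _)⟩)
      exact this.le
  have e2 : ‖(f t y' - fy t y * y') - (f t y - fy t y * y)‖ ≤ c / 2 * ‖y' - y‖ := by
    refine Convex.norm_image_sub_le_of_norm_hasDerivWithin_le
      (f := fun s => f t s - fy t y * s) (f' := fun s => fy t s - fy t y)
      (s := Metric.ball y δ) ?_ ?_ (convex_ball y δ)
      (Metric.mem_ball_self hδ) hby
    · intro s hs
      have := ((h t ht s).2.hasDerivWithinAt (s := Metric.ball y δ)).sub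
        (((hasDerivWithinAt_id s (Metric.ball y δ)).const_mul (fy t y)))
      rw [mul_one] at this
      exact this
    · intro s hs
      have := h2 (t, s) ⟨ht, mem_univ _⟩ (by
        rw [Prod.dist_eq, max_lt_iff]
        exact ⟨by simpa using hδ₂, (Metric.mem_ball.1 hs).trans_le (min_le_right _ _)⟩)
      exact this.le
  have e3 : ‖t' - t‖ ≤ ‖((t', y') : ℝ × ℝ) - (t, y)‖ := norm_fst_le (((t', y') : ℝ × ℝ) - (t, y))
  have e4 : ‖y' - y‖ ≤ ‖((t', y') : ℝ × ℝ) - (t, y)‖ := norm_snd_le (((t', y') : ℝ × ℝ) - (t, y))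
  have e5 : f t' y' - f t y - (ft t y • ContinuousLinearMap.fst ℝ ℝ ℝ
      + fy t y • ContinuousLinearMap.snd ℝ ℝ ℝ) (((t', y') : ℝ × ℝ) - (t, y))
      = ((f t' y' - ft t y * t') - (f t y' - ft t y * t))
        + ((f t y' - fy t y * y') - (f t y - fy t y * y)) := by
    simp
    ring
  simp only [e5]
  refine (norm_add_le _ _).trans ?_
  nlinarith

/-- Bounded partial derivatives make a function jointly continuous. -/
theorem HasPartials.contOn (h : HasPartials T f ft fy) (hft : Rapid T ft) (hfy : Rapid T fy) :
    ContOn T f := by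
  obtain ⟨C, hC0, hC⟩ := hft.bounded
  obtain ⟨D, hD0, hD⟩ := hfy.bounded
  have key : ∀ z ∈ Icc 0 T ×ˢ (univ : Set ℝ), ∀ z' ∈ Icc 0 T ×ˢ (univ : Set ℝ),
      dist (f z.1 z.2) (f z'.1 z'.2) ≤ (C + D).toNNReal * dist z z' := by
    rintro ⟨t, y⟩ ⟨ht, -⟩ ⟨t', y'⟩ ⟨ht', -⟩
    have e1 : ‖f t y - f t' y‖ ≤ C * ‖t - t'‖ :=
      Convex.norm_image_sub_le_of_norm_hasDerivWithin_le (f := fun s => f s y)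
        (fun s hs => (h s hs y).1) (fun s hs => hC s hs y) (convex_Icc 0 T) ht' ht
    have e2 : ‖f t' y - f t' y'‖ ≤ D * ‖y - y'‖ :=
      Convex.norm_image_sub_le_of_norm_hasDerivWithin_le (f := f t') (s := univ)
        (fun s _ => (h t' ht' s).2.hasDerivWithinAt) (fun s _ => hD t' ht' s) convex_univ
        (mem_univ _) (mem_univ _)
    have e3 : ‖t - t'‖ ≤ dist (t, y) (t', y') := by
      rw [Prod.dist_eq, ← dist_eq_norm]; exact le_max_left _ _
    have e4 : ‖y - y'‖ ≤ dist (t, y) (t', y') := by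
      rw [Prod.dist_eq, ← dist_eq_norm]; exact le_max_right _ _
    rw [Real.coe_toNNReal _ (by positivity)]
    refine (dist_triangle _ (f t' y) _).trans ?_
    rw [dist_eq_norm, dist_eq_norm]
    simp only
    nlinarith
  exact (LipschitzOnWith.of_dist_le_mul key).continuousOn

theorem uniqueDiffOn_band (hT : 0 < T) : UniqueDiffOn ℝ (Icc 0 T ×ˢ (univ : Set ℝ)) :=
  (uniqueDiffOn_Icc hT).prod uniqueDiffOn_univ

theorem Smooth.contDiffOn (hT : 0 < T) (hf : Smooth T f) :
    ContDiffOn ℝ ∞ (fun z : ℝ × ℝ => f z.1 z.2) (Icc 0 T ×ˢ univ) := by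
  rw [contDiffOn_infty]
  intro k
  induction k generalizing f with
  | zero => exact contDiffOn_zero.2 (hf 0).1
  | succ k ih =>
    obtain ⟨ft, fy, h, h1, h2⟩ := hf.exists_partials hT
    have hd := fun z hz => h.hasFDerivWithinAt (h1 0).1 (h2 0).1 (z := z) hz
    push_cast
    rw [contDiffOn_succ_iff_fderivWithin (uniqueDiffOn_band hT)]
    refine ⟨fun z hz => (hd z hz).differentiableWithinAt, by simp, ?_⟩
    refine ContDiffOn.congr (f := fun z : ℝ × ℝ => ft z.1 z.2 • ContinuousLinearMap.fst ℝ ℝ ℝ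
      + fy z.1 z.2 • ContinuousLinearMap.snd ℝ ℝ ℝ) ?_ fun z hz =>
        (hd z hz).fderivWithin (uniqueDiffOn_band hT z hz)
    exact ((ih h1).smul contDiffOn_const).add ((ih h2).smul contDiffOn_const)

theorem hasPartials_of_contDiffOn
    (hf : ContDiffOn ℝ ∞ (fun z : ℝ × ℝ => f z.1 z.2) (Icc 0 T ×ˢ univ)) :
    HasPartials T f
      (fun t y => fderivWithin ℝ (fun z : ℝ × ℝ => f z.1 z.2) (Icc 0 T ×ˢ univ) (t, y) (1, 0))
      (fun t y => fderivWithin ℝ (fun z : ℝ × ℝ => f z.1 z.2) (Icc 0 T ×ˢ univ) (t, y) (0, 1)) := by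
  intro t ht y
  have hd := (hf.differentiableOn (by simp) (t, y) ⟨ht, mem_univ _⟩).hasFDerivWithinAt
  constructor
  · have h1 : HasDerivWithinAt (fun s : ℝ => (s, y)) ((1 : ℝ), (0 : ℝ)) (Icc 0 T) t :=
      (hasDerivWithinAt_id t _).prodMk (hasDerivWithinAt_const _ _ _)
    exact HasFDerivWithinAt.comp_hasDerivWithinAt t hd h1 fun s hs => mk_mem_prod hs (mem_univ _)
  · have h1 : HasDerivWithinAt (fun s : ℝ => (t, s)) ((0 : ℝ), (1 : ℝ)) univ y :=
      (hasDerivWithinAt_const _ _ _).prodMk (hasDerivWithinAt_id y _)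
    have := HasFDerivWithinAt.comp_hasDerivWithinAt y hd h1 fun s _ => mk_mem_prod ht (mem_univ s)
    rwa [hasDerivWithinAt_univ] at this

theorem contDiffOn_fderivWithin_apply (hT : 0 < T)
    (hf : ContDiffOn ℝ ∞ (fun z : ℝ × ℝ => f z.1 z.2) (Icc 0 T ×ˢ univ)) (e : ℝ × ℝ) :
    ContDiffOn ℝ ∞ (fun z : ℝ × ℝ =>
      fderivWithin ℝ (fun z : ℝ × ℝ => f z.1 z.2) (Icc 0 T ×ˢ univ) z e) (Icc 0 T ×ˢ univ) :=
  ((contDiffOn_infty_iff_fderivWithin (uniqueDiffOn_band hT)).1 hf).2.clm_apply contDiffOn_const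

theorem smooth_of_contDiffOn (hT : 0 < T)
    (hf : ContDiffOn ℝ ∞ (fun z : ℝ × ℝ => f z.1 z.2) (Icc 0 T ×ˢ univ)) : Smooth T f := by
  intro k
  induction k generalizing f with
  | zero => exact ⟨hf.continuousOn, trivial⟩
  | succ k ih =>
    exact ⟨⟨hf.continuousOn, trivial⟩, _, _, hasPartials_of_contDiffOn hf,
      ih (contDiffOn_fderivWithin_apply hT hf _), ih (contDiffOn_fderivWithin_apply hT hf _)⟩

/-- Mixed partial derivatives commute, also at the endpoints of `[0,T]`. -/
theorem Smooth.deriv_comm (hT : 0 < T) (hf : Smooth T f) {t : ℝ} (ht : t ∈ Icc 0 T) (y : ℝ) :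
    deriv (fun σ => derivWithin (fun s => f s σ) (Icc 0 T) t) y
      = derivWithin (fun s => deriv (f s) y) (Icc 0 T) t := by
  have hc := hf.contDiffOn hT
  set S : Set (ℝ × ℝ) := Icc 0 T ×ˢ univ
  set F : ℝ × ℝ → ℝ := fun z => f z.1 z.2
  have hp := hasPartials_of_contDiffOn hc
  have hu := uniqueDiffOn_band hT
  have hmem : (t, y) ∈ S := ⟨ht, mem_univ _⟩
  have hud := uniqueDiffOn_Icc hT
  have hd2 : DifferentiableWithinAt ℝ (fderivWithin ℝ F S) S (t, y) :=
    ((contDiffOn_infty_iff_fderivWithin hu).1 hc).2.differentiableOn (by simp) _ hmem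
  -- At t = 0 and t = T the symmetry of the second derivative is inherited from the interior; this
  -- is where `0 < T` enters.
  have hcl : (t, y) ∈ closure (interior S) := by
    rw [interior_prod_eq, closure_prod_eq, interior_univ, closure_univ, interior_Icc,
      closure_Ioo hT.ne]
    exact hmem
  have hsym := (hc (t, y) hmem).isSymmSndFDerivWithinAt
    (by simp only [minSmoothness_of_isRCLikeNormedField]; exact WithTop.coe_le_coe.2 (le_top : (2 : ℕ∞) ≤ ⊤)) hu hcl hmem
  have key : ∀ e : ℝ × ℝ, ∀ e' : ℝ × ℝ,
      fderivWithin ℝ (fun z : ℝ × ℝ => fderivWithin ℝ F S z e) S (t, y) e'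
        = fderivWithin ℝ (fderivWithin ℝ F S) S (t, y) e' e := by
    intro e e'
    have h := hd2.hasFDerivWithinAt.clm_apply (hasFDerivWithinAt_const e (t, y) S)
    rw [h.fderivWithin (hu _ hmem)]
    simp
  have h10 := hasPartials_of_contDiffOn (f := fun t y => fderivWithin ℝ F S (t, y) (1, 0))
    (contDiffOn_fderivWithin_apply hT hc (1, 0))
  have h01 := hasPartials_of_contDiffOn (f := fun t y => fderivWithin ℝ F S (t, y) (0, 1))
    (contDiffOn_fderivWithin_apply hT hc (0, 1))
  have e1 : (fun σ => derivWithin (fun s => f s σ) (Icc 0 T) t)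
      = fun σ => fderivWithin ℝ F S (t, σ) (1, 0) :=
    funext fun σ => (hp t ht σ).1.derivWithin (hud t ht)
  have e2 : derivWithin (fun s => deriv (f s) y) (Icc 0 T) t
      = derivWithin (fun s => fderivWithin ℝ F S (s, y) (0, 1)) (Icc 0 T) t :=
    derivWithin_congr (fun s hs => (hp s hs y).2.deriv) (hp t ht y).2.deriv
  rw [e1, e2, (h10 t ht y).2.deriv, (h01 t ht y).1.derivWithin (hud t ht)]
  exact (key _ _).trans ((hsym.eq _ _).trans (key _ _).symm)

theorem Sch.derivWithin (hT : 0 < T) (hf : Sch T f) :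
    Sch T (fun t y => derivWithin (fun s => f s y) (Icc 0 T) t) :=
  (hf.of_hasPartials hT (hf.smooth.hasPartials hT)).1

theorem Sch.deriv (hT : 0 < T) (hf : Sch T f) : Sch T (fun t y => deriv (f t) y) :=
  (hf.of_hasPartials hT (hf.smooth.hasPartials hT)).2

theorem Smooth.derivWithin (hT : 0 < T) (hf : Smooth T f) :
    Smooth T (fun t y => derivWithin (fun s => f s y) (Icc 0 T) t) :=
  (hf.of_hasPartials hT (hf.hasPartials hT)).1

theorem Smooth.deriv (hT : 0 < T) (hf : Smooth T f) : Smooth T (fun t y => deriv (f t) y) :=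
  (hf.of_hasPartials hT (hf.hasPartials hT)).2

theorem partialTTau_succ_left (p q : ℕ) (f : ℝ → ℝ → ℝ) (t y : ℝ) :
    partialTTau T (p + 1) q f t y
      = _root_.derivWithin (fun s => partialTTau T p q f s y) (Icc 0 T) t := by
  simp only [partialTTau, iteratedDerivWithin_succ]

theorem partialTTau_zero_left (q : ℕ) (f : ℝ → ℝ → ℝ) (t y : ℝ) :
    partialTTau T 0 q f t y = iteratedDeriv q (f t) y := by
  simp only [partialTTau, iteratedDerivWithin_zero]

theorem partialTTau_zero_succ (q : ℕ) (f : ℝ → ℝ → ℝ) (t y : ℝ) :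
    partialTTau T 0 (q + 1) f t y = _root_.deriv (partialTTau T 0 q f t) y := by
  rw [partialTTau_zero_left, iteratedDeriv_succ]
  rfl

theorem Smooth.partialTTau (hT : 0 < T) (hf : Smooth T f) (p q : ℕ) :
    Smooth T (partialTTau T p q f) := by
  induction p with
  | zero =>
    induction q with
    | zero => exact hf.congr fun t _ y => by simp [partialTTau_zero_left]
    | succ q ih => exact (ih.deriv hT).congr fun t _ y => partialTTau_zero_succ _ _ _ _
  | succ p ih => exact (ih.derivWithin hT).congr fun t _ y => partialTTau_succ_left _ _ _ _ _

theorem Sch.partialTTau (hT : 0 < T) (hf : Sch T f) (p q : ℕ) :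
    Sch T (partialTTau T p q f) := by
  induction p with
  | zero =>
    induction q with
    | zero => exact hf.congr fun t _ y => by simp [partialTTau_zero_left]
    | succ q ih => exact (ih.deriv hT).congr fun t _ y => partialTTau_zero_succ _ _ _ _
  | succ p ih => exact (ih.derivWithin hT).congr fun t _ y => partialTTau_succ_left _ _ _ _ _

/-- In `partialTTau` the `τ`-derivatives are innermost, so one more `τ`-derivative has to be
commuted past the `p` time derivatives, one at a time. -/
theorem Smooth.hasPartials_partialTTau (hT : 0 < T) (hf : Smooth T f) (p q : ℕ) :
    HasPartials T (VcmCH.partialTTau T p q f) (VcmCH.partialTTau T (p + 1) q f)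
      (VcmCH.partialTTau T p (q + 1) f) := by
  have hcomm : ∀ t ∈ Icc 0 T, ∀ y, VcmCH.partialTTau T p (q + 1) f t y
      = _root_.deriv (VcmCH.partialTTau T p q f t) y := by
    induction p with
    | zero => exact fun t _ y => partialTTau_zero_succ _ _ _ _
    | succ p ih =>
      intro t ht y
      have h := (hf.partialTTau hT p q).deriv_comm hT ht y
      have e1 : (fun σ => _root_.derivWithin (fun s => VcmCH.partialTTau T p q f s σ) (Icc 0 T) t)
          = VcmCH.partialTTau T (p + 1) q f t :=
        funext fun σ => (partialTTau_succ_left _ _ _ _ _).symm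
      rw [e1] at h
      rw [h, partialTTau_succ_left]
      exact derivWithin_congr (fun s hs => ih s hs y) (ih t ht y)
  intro t ht y
  rw [hcomm t ht y, partialTTau_succ_left]
  exact (hf.partialTTau hT p q).hasPartials hT t ht y

end Tame

/-! ### Rapid decay, affine changes of variable, and the spaces `G`, `G̃` -/

section Classes

variable {T : ℝ} {f g : ℝ → ℝ → ℝ}

theorem bounded_of_contDiffOn {c : ℝ → ℝ} (hc : ContDiffOn ℝ ∞ c (Icc 0 T)) :
    ∃ C, 0 ≤ C ∧ ∀ t ∈ Icc 0 T, |c t| ≤ C := by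
  obtain ⟨C, hC⟩ := isCompact_Icc.exists_bound_of_continuousOn hc.continuousOn
  exact ⟨|C|, abs_nonneg _, fun t ht => (hC t ht).trans (le_abs_self C)⟩

theorem moderate_of_contDiffOn {c : ℝ → ℝ} (hc : ContDiffOn ℝ ∞ c (Icc 0 T)) :
    Moderate T (fun t _ => c t) := by
  obtain ⟨C, -, hC⟩ := bounded_of_contDiffOn hc
  exact ⟨0, C, fun t ht y => by simpa using hC t ht⟩

theorem contOn_of_contDiffOn {c : ℝ → ℝ} (hc : ContDiffOn ℝ ∞ c (Icc 0 T)) :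
    ContOn T (fun t _ => c t) :=
  hc.continuousOn.comp continuousOn_fst fun _ hz => hz.1

theorem temp_of_contDiffOn (hT : 0 < T) {c : ℝ → ℝ} (hc : ContDiffOn ℝ ∞ c (Icc 0 T)) :
    Temp T (fun t _ => c t) := by
  intro k
  induction k generalizing c with
  | zero => exact ⟨contOn_of_contDiffOn hc, moderate_of_contDiffOn hc⟩
  | succ k ih =>
    have h := (contDiffOn_infty_iff_derivWithin (uniqueDiffOn_Icc hT)).1 hc
    exact ⟨⟨contOn_of_contDiffOn hc, moderate_of_contDiffOn hc⟩,
      fun t _ => derivWithin c (Icc 0 T) t, fun _ _ => 0,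
      fun t ht y => ⟨(h.1 t ht).hasDerivWithinAt, hasDerivAt_const _ _⟩, ih h.2,
      tame_zero (moderate_const 0)⟩

theorem temp_snd : Temp T (fun _ y => y) := by
  have hm : Moderate T (fun _ y => y) := ⟨1, 1, fun t _ y => by simp⟩
  intro k
  cases k with
  | zero => exact ⟨continuousOn_snd, hm⟩
  | succ k =>
    exact ⟨⟨continuousOn_snd, hm⟩, fun _ _ => 0, fun _ _ => 1,
      fun t _ y => ⟨hasDerivWithinAt_const _ _ _, hasDerivAt_id y⟩, temp_const 0 k, temp_const 1 k⟩

theorem ContOn.comp_affine (hf : ContOn T f) {α β : ℝ → ℝ} (hα : ContDiffOn ℝ ∞ α (Icc 0 T))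
    (hβ : ContDiffOn ℝ ∞ β (Icc 0 T)) : ContOn T (fun t y => f t (α t * y + β t)) := by
  have h : ContinuousOn (fun z : ℝ × ℝ => (z.1, α z.1 * z.2 + β z.1)) (Icc 0 T ×ˢ univ) :=
    continuousOn_fst.prodMk (((contOn_of_contDiffOn hα).mul continuousOn_snd).add
      (contOn_of_contDiffOn hβ))
  exact ContinuousOn.comp (t := Icc 0 T ×ˢ univ) hf h fun z hz => ⟨hz.1, mem_univ _⟩

theorem HasPartials.comp_affine {ft fy : ℝ → ℝ → ℝ} (h : HasPartials T f ft fy)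
    (hft : ContOn T ft) (hfy : ContOn T fy) {α β : ℝ → ℝ} (hα : ContDiffOn ℝ ∞ α (Icc 0 T))
    (hβ : ContDiffOn ℝ ∞ β (Icc 0 T)) :
    HasPartials T (fun t y => f t (α t * y + β t))
      (fun t y => ft t (α t * y + β t) + fy t (α t * y + β t) *
        (derivWithin α (Icc 0 T) t * y + derivWithin β (Icc 0 T) t))
      (fun t y => fy t (α t * y + β t) * α t) := by
  intro t ht y
  constructor
  · have hF := h.hasFDerivWithinAt hft hfy (z := (t, α t * y + β t)) ⟨ht, mem_univ _⟩
    have hα' := (hα.differentiableOn (by simp) t ht).hasDerivWithinAt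
    have hβ' := (hβ.differentiableOn (by simp) t ht).hasDerivWithinAt
    have hA : HasDerivWithinAt (fun s => (s, α s * y + β s))
        ((1 : ℝ), derivWithin α (Icc 0 T) t * y + derivWithin β (Icc 0 T) t) (Icc 0 T) t :=
      (hasDerivWithinAt_id t _).prodMk ((hα'.mul_const y).add hβ')
    have := HasFDerivWithinAt.comp_hasDerivWithinAt t hF hA fun s hs => mk_mem_prod hs (mem_univ _)
    simpa using! this
  · have hA : HasDerivAt (fun y => α t * y + β t) (α t) y := by
      simpa using! ((hasDerivAt_id y).const_mul (α t)).add_const (β t)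
    exact (h t ht (α t * y + β t)).2.comp y hA

/-- The time derivative of the composite carries the factor α' y + β', which grows linearly; hence
`P` has to be stable under moderate factors. -/
theorem Tame.comp_affine (hT : 0 < T) {P : (ℝ → ℝ → ℝ) → Prop} {α β : ℝ → ℝ}
    (hα : ContDiffOn ℝ ∞ α (Icc 0 T)) (hβ : ContDiffOn ℝ ∞ β (Icc 0 T))
    (hadd : ∀ f g, P f → P g → P (fun t y => f t y + g t y))
    (hmul : ∀ f g, P f → Moderate T g → P (fun t y => f t y * g t y))
    (hcomp : ∀ f, P f → P (fun t y => f t (α t * y + β t))) {k : ℕ} (hf : Tame T P k f) :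
    Tame T P k (fun t y => f t (α t * y + β t)) := by
  induction k generalizing f with
  | zero => exact ⟨hf.1.comp_affine hα hβ, hcomp _ hf.2⟩
  | succ k ih =>
    obtain ⟨h, ft, fy, h1, h2, h3⟩ := hf
    have hα' := ((contDiffOn_infty_iff_derivWithin (uniqueDiffOn_Icc hT)).1 hα).2
    have hβ' := ((contDiffOn_infty_iff_derivWithin (uniqueDiffOn_Icc hT)).1 hβ).2
    refine ⟨⟨h.1.comp_affine hα hβ, hcomp _ h.2⟩, _, _,
      h1.comp_affine h2.contOn h3.contOn hα hβ, ?_, ?_⟩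
    · exact (ih h2).add hadd ((ih h3).mul hmul hadd
        ((((temp_of_contDiffOn hT hα').mul temp_snd).add (temp_of_contDiffOn hT hβ')) k))
    · exact (ih h3).mul hmul hadd (temp_of_contDiffOn hT hα k)

theorem Rapid.comp_affine (hf : Rapid T f) {α β : ℝ → ℝ} (hα : ContDiffOn ℝ ∞ α (Icc 0 T))
    (hβ : ContDiffOn ℝ ∞ β (Icc 0 T)) (h0 : ∀ t ∈ Icc 0 T, α t ≠ 0) :
    Rapid T (fun t y => f t (α t * y + β t)) := by
  -- Compactness bounds α⁻¹, so that α y + β grows at least in proportion to y.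
  obtain ⟨m, hm0, hm⟩ := bounded_of_contDiffOn (hα.inv h0)
  obtain ⟨B, hB0, hB⟩ := bounded_of_contDiffOn hβ
  have key : ∀ t ∈ Icc 0 T, ∀ y : ℝ, 1 + |y| ≤ (1 + m + m * B) * (1 + |α t * y + β t|) := by
    intro t ht y
    have e1 : y = (α t)⁻¹ * ((α t * y + β t) - β t) := by field_simp [h0 t ht]; ring
    have e2 : |y| ≤ m * (|α t * y + β t| + B) := by
      calc |y| = |(α t)⁻¹| * |(α t * y + β t) - β t| := by rw [← abs_mul, ← e1]
        _ ≤ m * (|α t * y + β t| + B) := by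
          refine mul_le_mul (hm t ht) ((abs_sub _ _).trans ?_) (abs_nonneg _) hm0
          gcongr
          exact hB t ht
    have e3 := abs_nonneg (α t * y + β t)
    have e4 : 0 ≤ m * B * |α t * y + β t| := by positivity
    nlinarith
  intro n
  obtain ⟨C, hC⟩ := hf n
  refine ⟨(1 + m + m * B) ^ n * C, fun t ht y => ?_⟩
  calc (1 + |y|) ^ n * |f t (α t * y + β t)|
      ≤ ((1 + m + m * B) * (1 + |α t * y + β t|)) ^ n * |f t (α t * y + β t)| := by
        gcongr
        exact key t ht y
    _ = (1 + m + m * B) ^ n * ((1 + |α t * y + β t|) ^ n * |f t (α t * y + β t)|) := by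
        rw [mul_pow]; ring
    _ ≤ _ := by
        gcongr
        exact hC t ht _

theorem Sch.comp_affine (hT : 0 < T) (hf : Sch T f) {α β : ℝ → ℝ}
    (hα : ContDiffOn ℝ ∞ α (Icc 0 T)) (hβ : ContDiffOn ℝ ∞ β (Icc 0 T))
    (h0 : ∀ t ∈ Icc 0 T, α t ≠ 0) : Sch T (fun t y => f t (α t * y + β t)) := fun k =>
  (hf k).comp_affine hT hα hβ (fun _ _ => Rapid.add) (fun _ _ => Rapid.mul)
    (fun _ h => h.comp_affine hα hβ h0)

/-- The bound with one power more than needed leaves a factor 1/(1 + |τ|), uniformly in t. -/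
theorem tendstoUniformlyOn_of_rapid (hf : Rapid T f) {l : Filter ℝ} (hl : Tendsto abs l atTop)
    (n : ℕ) : TendstoUniformlyOn (fun τ t : ℝ => τ ^ n * f t τ) (fun _ => 0) l (Icc 0 T) := by
  rw [Metric.tendstoUniformlyOn_iff]
  intro ε hε
  obtain ⟨C, hC⟩ := hf (n + 1)
  filter_upwards [hl.eventually_gt_atTop (C / ε)] with y hy t ht
  rw [dist_zero_left, Real.norm_eq_abs, abs_mul, abs_pow]
  have h1 := hC t ht y
  have h0 : 0 < 1 + |y| := by positivity
  rw [div_lt_iff₀ hε] at hy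
  have h2 : |y| ^ n * |f t y| ≤ (1 + |y|) ^ n * |f t y| := by
    gcongr
    linarith
  have h3 : (1 + |y|) * ((1 + |y|) ^ n * |f t y|) ≤ C := by
    rw [← mul_assoc, ← pow_succ']; exact h1
  by_contra! hcon
  nlinarith

theorem rapid_of_tendstoUniformlyOn (hf : ContOn T f)
    (htop : ∀ n : ℕ, TendstoUniformlyOn (fun τ t : ℝ => τ ^ n * f t τ) (fun _ => 0) atTop (Icc 0 T))
    (hbot : ∀ n : ℕ, TendstoUniformlyOn (fun τ t : ℝ => τ ^ n * f t τ) (fun _ => 0) atBot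
      (Icc 0 T)) : Rapid T f := by
  intro n
  obtain ⟨Y, hY⟩ := eventually_atTop.1 (Metric.tendstoUniformlyOn_iff.1 (htop n) 1 one_pos)
  obtain ⟨Z, hZ⟩ := eventually_atBot.1 (Metric.tendstoUniformlyOn_iff.1 (hbot n) 1 one_pos)
  -- The cut-offs are pushed beyond ±1, so that outside them 1 + |y| ≤ 2|y|; this is the source of
  -- the constant 2 ^ n.
  have hc : ContinuousOn (fun z : ℝ × ℝ => (1 + |z.2|) ^ n * |f z.1 z.2|)
      (Icc 0 T ×ˢ Icc (min Z (-1)) (max Y 1)) := by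
    refine ContinuousOn.mul (by fun_prop) ?_
    exact (hf.mono (prod_mono subset_rfl (subset_univ _))).abs
  obtain ⟨C, hC⟩ := (isCompact_Icc.prod isCompact_Icc).exists_bound_of_continuousOn hc
  refine ⟨max C (2 ^ n), fun t ht y => ?_⟩
  have far : 1 ≤ |y| → |y ^ n * f t y| < 1 → (1 + |y|) ^ n * |f t y| ≤ max C (2 ^ n) := by
    intro h1 h2
    refine le_max_of_le_right ?_
    rw [abs_mul, abs_pow] at h2
    calc (1 + |y|) ^ n * |f t y| ≤ (2 * |y|) ^ n * |f t y| := by gcongr; linarith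
      _ = 2 ^ n * (|y| ^ n * |f t y|) := by rw [mul_pow]; ring
      _ ≤ 2 ^ n * 1 := by gcongr
      _ = 2 ^ n := mul_one _
  by_cases h1 : max Y 1 < y
  · refine far (((le_max_right _ _).trans h1.le).trans (le_abs_self y)) ?_
    simpa using hY y ((le_max_left _ _).trans h1.le) t ht
  by_cases h2 : y < min Z (-1)
  · refine far ?_ ?_
    · have := h2.le.trans (min_le_right _ _)
      rw [abs_of_neg (by linarith)]
      linarith
    · simpa using hZ y (h2.le.trans (min_le_left _ _)) t ht
  exact le_max_of_le_left ((le_abs_self _).trans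
    (hC (t, y) ⟨ht, not_lt.1 h2, not_lt.1 h1⟩))

theorem partialTTau_congr (p q : ℕ) (h : ∀ t ∈ Icc 0 T, ∀ y, g t y = f t y) {t : ℝ}
    (ht : t ∈ Icc 0 T) (y : ℝ) : partialTTau T p q g t y = partialTTau T p q f t y := by
  refine iteratedDerivWithin_congr (fun s hs => ?_) ht
  have : g s = f s := funext (h s hs)
  simp only [this]

theorem InGt.smooth (hT : 0 < T) (hf : InGt T f) : Smooth T f := smooth_of_contDiffOn hT hf.1

/-- The limit function `gm` coincides with the pointwise limit at -∞, hence vanishes on `[0,T]`, and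
the defining conditions of G̃ become decay of the function itself on both sides. -/
theorem InGt.sch (hT : 0 < T) (hf : InGt T f) (h0 : ∀ t ∈ Icc 0 T, Tendsto (f t) atBot (𝓝 0)) :
    Sch T f := by
  have hs := hf.smooth hT
  obtain ⟨-, htop, gm, -, hbot⟩ := hf
  have hgm : ∀ t ∈ Icc 0 T, gm t = 0 := by
    intro t ht
    have h1 := (hbot 0 0 0).tendsto_at ht
    simp only [pow_zero, one_mul, partialTTau, iteratedDerivWithin_zero, iteratedDeriv_zero] at h1
    have h2 := (h0 t ht).sub h1
    simp only [sub_sub_cancel, sub_zero] at h2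
    exact tendsto_nhds_unique tendsto_const_nhds h2
  have hbot' : ∀ n p q : ℕ, TendstoUniformlyOn (fun τ t : ℝ => τ ^ n * partialTTau T p q f t τ)
      (fun _ => 0) atBot (Icc 0 T) := by
    intro n p q
    refine (hbot n p q).congr (Eventually.of_forall fun τ t ht => ?_)
    simp only
    rw [partialTTau_congr (f := f) p q (fun s hs y => by rw [hgm s hs, sub_zero]) ht]
  have key : ∀ k p q, Tame T (Rapid T) k (partialTTau T p q f) := by
    intro k
    induction k with
    | zero =>
      intro p q
      have hc := (hs.partialTTau hT p q 0).1
      exact ⟨hc, rapid_of_tendstoUniformlyOn hc (fun n => htop n p q) fun n => hbot' n p q⟩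
    | succ k ih =>
      intro p q
      exact ⟨⟨(ih p q).contOn, (ih p q).prop⟩, _, _, hs.hasPartials_partialTTau hT p q,
        ih _ _, ih _ _⟩
  intro k
  exact (key k 0 0).congr (fun _ _ h h' => h'.congr h) fun t _ y => by
    simp [partialTTau_zero_left]

theorem Sch.tendsto_atTop (hf : Sch T f) {t : ℝ} (ht : t ∈ Icc 0 T) :
    Tendsto (f t) atTop (𝓝 0) := by
  simpa using (tendstoUniformlyOn_of_rapid hf.rapid tendsto_abs_atTop_atTop 0).tendsto_at ht

theorem Sch.tendsto_atBot (hf : Sch T f) {t : ℝ} (ht : t ∈ Icc 0 T) :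
    Tendsto (f t) atBot (𝓝 0) := by
  simpa using (tendstoUniformlyOn_of_rapid hf.rapid tendsto_abs_atBot_atTop 0).tendsto_at ht

theorem Sch.inGt0 (hT : 0 < T) (hf : Sch T f) : InGt0 T f := by
  refine ⟨⟨hf.smooth.contDiffOn hT, fun n p q =>
    tendstoUniformlyOn_of_rapid (hf.partialTTau hT p q).rapid tendsto_abs_atTop_atTop n,
    fun _ => 0, contDiffOn_const, fun n p q => ?_⟩, ?_⟩
  · simpa only [sub_zero] using
      tendstoUniformlyOn_of_rapid (hf.partialTTau hT p q).rapid tendsto_abs_atBot_atTop n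
  · simpa only [pow_zero, one_mul] using
      tendstoUniformlyOn_of_rapid hf.rapid tendsto_abs_atBot_atTop 0

theorem partialXTTau_const_left (p q r : ℕ) (f : ℝ → ℝ → ℝ) (x t τ : ℝ) :
    partialXTTau T p q r (fun _ => f) x t τ = if p = 0 then partialTTau T q r f t τ else 0 := by
  simp only [partialXTTau, iteratedDeriv_const]
  rfl

theorem Sch.inG0 (hT : 0 < T) (hf : Sch T f) : InG0 T (fun _ => f) := by
  have key : ∀ l : Filter ℝ, Tendsto abs l atTop → ∀ n p q r : ℕ, ∀ K : Set (ℝ × ℝ), K ⊆ strip T →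
      TendstoUniformlyOn (fun (τ : ℝ) (z : ℝ × ℝ) =>
        τ ^ n * partialXTTau T p q r (fun _ => f) z.1 z.2 τ) (fun _ => 0) l K := by
    intro l hl n p q r K hK
    simp only [partialXTTau_const_left]
    split_ifs with hp
    · exact ((tendstoUniformlyOn_of_rapid (hf.partialTTau hT q r).rapid hl n).comp
        (Prod.snd : ℝ × ℝ → ℝ)).mono fun z hz => (hK hz).2
    · simp only [mul_zero]
      exact (tendsto_const_nhds (x := (0 : ℝ))).tendstoUniformlyOn_const K
  refine ⟨⟨?_, fun n p q r K _ hK => key _ tendsto_abs_atTop_atTop n p q r K hK,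
    fun _ _ => 0, contDiffOn_const, fun n p q r K _ hK => ?_⟩, fun K _ hK => ?_⟩
  · exact (hf.smooth.contDiffOn hT).comp (t := Icc 0 T ×ˢ univ)
      (f := fun z : ℝ × ℝ × ℝ => z.2) contDiff_snd.contDiffOn fun z hz => hz.2
  · simpa only [sub_zero] using key _ tendsto_abs_atBot_atTop n p q r K hK
  · have := key _ tendsto_abs_atBot_atTop 0 0 0 0 K hK
    simpa [partialXTTau_const_left, partialTTau_zero_left] using! this

end Classes

/-! ### Decay and growth of hyperbolic functions -/

section Hyperbolic

theorem one_sub_tanh_sq (y : ℝ) : 1 - Real.tanh y ^ 2 = (Real.cosh y ^ 2)⁻¹ := by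
  have h := Real.cosh_pos y
  rw [Real.tanh_eq_sinh_div_cosh, Real.cosh_sq y]
  have h' : Real.sinh y ^ 2 + 1 ≠ 0 := by positivity
  have : Real.cosh y ^ 2 ≠ 0 := by positivity
  rw [div_pow, Real.cosh_sq y]
  field_simp
  ring

theorem one_sub_tanh_sq_pos (y : ℝ) : 0 < 1 - Real.tanh y ^ 2 := by
  rw [one_sub_tanh_sq]
  have := Real.cosh_pos y
  positivity

theorem hasDerivAt_tanh (y : ℝ) : HasDerivAt Real.tanh (1 - Real.tanh y ^ 2) y := by
  have h := Real.cosh_pos y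
  have h1 := (Real.hasDerivAt_sinh y).div (Real.hasDerivAt_cosh y) h.ne'
  have e : Real.tanh = Real.sinh / Real.cosh := by
    funext s
    rw [Real.tanh_eq_sinh_div_cosh]
    rfl
  rw [e]
  convert! h1 using 1
  simp only [Pi.div_apply]
  field_simp

theorem abs_tanh_le_one (y : ℝ) : |Real.tanh y| ≤ 1 := by
  have := one_sub_tanh_sq_pos y
  exact abs_le_one_iff_mul_self_le_one.2 (by nlinarith)

/-- `cosh² ξ / cosh² y` decays rapidly in `|y| - |ξ|`. -/
theorem exists_cosh_sq_ratio_bound (n : ℕ) : ∃ C, 0 ≤ C ∧ ∀ ξ y : ℝ, |ξ| ≤ |y| →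
    (1 + |y|) ^ n * Real.cosh ξ ^ 2 ≤ C * (1 + |ξ|) ^ n * Real.cosh y ^ 2 := by
  refine ⟨2 * (n.factorial * Real.exp 1), by positivity, fun ξ y h => ?_⟩
  -- With s the gap, one factor cosh ξ / cosh y ≤ 2 exp(-s) pays for (1 + s) ^ n ≤ n! exp(1 + s);
  -- the other factor is only bounded by 1.
  set s := |y| - |ξ|
  have hs : 0 ≤ s := sub_nonneg.2 h
  have e1 : (1 + s) ^ n ≤ n.factorial * Real.exp 1 * Real.exp s := by
    have := Real.pow_div_factorial_le_exp (1 + s) (by positivity) n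
    rw [div_le_iff₀ (by positivity), Real.exp_add] at this
    linarith
  have e2 : 1 + |y| ≤ (1 + |ξ|) * (1 + s) := by
    have : |y| = s + |ξ| := by simp [s]
    nlinarith [abs_nonneg ξ, mul_nonneg (abs_nonneg ξ) hs]
  have e3 : Real.cosh ξ ≤ Real.cosh y := Real.cosh_le_cosh.2 h
  have e4 : Real.exp s * Real.cosh ξ ≤ 2 * Real.cosh y := by
    have h1 : Real.cosh ξ ≤ Real.exp |ξ| := by
      rw [← Real.cosh_abs, Real.cosh_eq]
      have := Real.exp_le_exp.2 (by linarith [abs_nonneg ξ] : -|ξ| ≤ |ξ|)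
      linarith
    have h2 : Real.exp |y| ≤ 2 * Real.cosh y := by
      rw [← Real.cosh_abs y, Real.cosh_eq]
      have := Real.exp_pos (-|y|)
      linarith
    calc Real.exp s * Real.cosh ξ ≤ Real.exp s * Real.exp |ξ| := by gcongr
      _ = Real.exp |y| := by rw [← Real.exp_add]; simp [s]
      _ ≤ _ := h2
  have hp := Real.cosh_pos ξ
  have hp' := Real.cosh_pos y
  calc (1 + |y|) ^ n * Real.cosh ξ ^ 2
      ≤ ((1 + |ξ|) * (1 + s)) ^ n * Real.cosh ξ ^ 2 := by gcongr
    _ = (1 + |ξ|) ^ n * (1 + s) ^ n * Real.cosh ξ ^ 2 := by rw [mul_pow]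
    _ ≤ (1 + |ξ|) ^ n * (n.factorial * Real.exp 1 * Real.exp s) * Real.cosh ξ ^ 2 := by gcongr
    _ = n.factorial * Real.exp 1 * (1 + |ξ|) ^ n * ((Real.exp s * Real.cosh ξ) * Real.cosh ξ) := by
        ring
    _ ≤ n.factorial * Real.exp 1 * (1 + |ξ|) ^ n * ((2 * Real.cosh y) * Real.cosh y) := by
        gcongr
    _ = _ := by ring

variable {T : ℝ}

theorem contOn_of_continuous {h : ℝ → ℝ} (hh : Continuous h) : ContOn T (fun _ y => h y) :=
  (hh.comp continuous_snd).continuousOn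

theorem continuous_tanh : Continuous Real.tanh :=
  continuous_iff_continuousAt.2 fun y => (hasDerivAt_tanh y).continuousAt

/-- The derivative is a polynomial in tanh, so the induction on the order feeds itself. -/
theorem temp_tanh : Temp T (fun _ y => Real.tanh y) := by
  have hm : Moderate T (fun _ y => Real.tanh y) := ⟨0, 1, fun t _ y => by
    simpa using abs_tanh_le_one y⟩
  have hc := contOn_of_continuous (T := T) continuous_tanh
  intro k
  induction k with
  | zero => exact ⟨hc, hm⟩
  | succ k ih =>
    refine ⟨⟨hc, hm⟩, fun _ _ => 0, fun _ y => 1 + -1 * (Real.tanh y * Real.tanh y),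
      fun t _ y => ⟨hasDerivWithinAt_const _ _ _, ?_⟩, temp_const 0 k, ?_⟩
    · convert! hasDerivAt_tanh y using 1
      ring
    · exact (temp_const 1 k).add (fun _ _ => Moderate.add) ((temp_const (-1) k).mul
        (fun _ _ => Moderate.mul) (fun _ _ => Moderate.add)
        (ih.mul (fun _ _ => Moderate.mul) (fun _ _ => Moderate.add) ih))

theorem two_sub_tanh_sq_pos (y : ℝ) : 1 < 2 - Real.tanh y ^ 2 := by
  linarith [one_sub_tanh_sq_pos y]

/-- This is 1/(1 + S), needed to solve the integrated equation for its second derivative. Its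
derivative is a tempered function times its own square. -/
theorem temp_inv_two_sub_tanh_sq : Temp T (fun _ y => (2 - Real.tanh y ^ 2)⁻¹) := by
  have hm : Moderate T (fun _ y => (2 - Real.tanh y ^ 2)⁻¹) := ⟨0, 1, fun t _ y => by
    have := two_sub_tanh_sq_pos y
    rw [abs_of_pos (by positivity)]
    simpa using inv_le_one_of_one_le₀ this.le⟩
  have hc := contOn_of_continuous (T := T) (h := fun y => (2 - Real.tanh y ^ 2)⁻¹)
    ((continuous_const.sub (continuous_tanh.pow 2)).inv₀ fun y =>
      (zero_lt_one.trans (two_sub_tanh_sq_pos y)).ne')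
  intro k
  induction k with
  | zero => exact ⟨hc, hm⟩
  | succ k ih =>
    refine ⟨⟨hc, hm⟩, fun _ _ => 0, fun _ y => 2 * Real.tanh y * (1 - Real.tanh y ^ 2) *
      ((2 - Real.tanh y ^ 2)⁻¹ * (2 - Real.tanh y ^ 2)⁻¹),
      fun t _ y => ⟨hasDerivWithinAt_const _ _ _, ?_⟩, temp_const 0 k, ?_⟩
    · have h0 : 2 - Real.tanh y ^ 2 ≠ 0 := by linarith [two_sub_tanh_sq_pos y]
      convert! (((hasDerivAt_tanh y).pow 2).const_sub 2).inv h0 using 1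
      simp only [Pi.pow_apply]
      field_simp
      ring
    · exact ((((temp_const 2).mul temp_tanh).mul ((temp_const 1).sub (temp_tanh.pow 2))) k).mul
        (fun _ _ => Moderate.mul) (fun _ _ => Moderate.add)
        (ih.mul (fun _ _ => Moderate.mul) (fun _ _ => Moderate.add) ih)

theorem hasDerivAt_one_sub_tanh_sq (y : ℝ) : HasDerivAt (fun y => 1 - Real.tanh y ^ 2)
    ((1 - Real.tanh y ^ 2) * (-2 * Real.tanh y)) y := by
  convert! ((hasDerivAt_tanh y).pow 2).const_sub 1 using 1
  simp
  ring

theorem sch_one_sub_tanh_sq : Sch T (fun _ y => 1 - Real.tanh y ^ 2) := by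
  have hr : Rapid T (fun _ y => 1 - Real.tanh y ^ 2) := by
    intro n
    obtain ⟨C, -, hC⟩ := exists_cosh_sq_ratio_bound n
    refine ⟨C, fun t _ y => ?_⟩
    have := hC 0 y (by simp)
    have hp := Real.cosh_pos y
    rw [abs_of_pos (one_sub_tanh_sq_pos y), one_sub_tanh_sq, ← div_eq_mul_inv,
      div_le_iff₀ (by positivity)]
    simpa using this
  have hc := contOn_of_continuous (T := T) (h := fun y => 1 - Real.tanh y ^ 2)
    (continuous_const.sub (continuous_tanh.pow 2))
  intro k
  induction k with
  | zero => exact ⟨hc, hr⟩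
  | succ k ih =>
    exact ⟨⟨hc, hr⟩, fun _ _ => 0, _,
      fun t _ y => ⟨hasDerivWithinAt_const _ _ _, hasDerivAt_one_sub_tanh_sq y⟩, sch_zero k,
      ih.mul_moderate (((temp_const (-2)).mul temp_tanh) k)⟩

end Hyperbolic

/-! ### Integrals depending on `t`, and primitives of rapidly decaying functions -/

section Integrals

variable {T : ℝ} {f g h : ℝ → ℝ → ℝ}

/-- Dominated convergence for difference quotients within `[0,T]`, which the mean value inequality
bounds by `bound`; the end times are thereby included. -/
theorem hasDerivWithinAt_integral {μ : Measure ℝ} {f f' : ℝ → ℝ → ℝ} {bound : ℝ → ℝ}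
    (hint : ∀ t ∈ Icc 0 T, Integrable (f t) μ)
    (hd : ∀ t ∈ Icc 0 T, ∀ ξ, HasDerivWithinAt (fun s => f s ξ) (f' t ξ) (Icc 0 T) t)
    (hb : ∀ᵐ ξ ∂μ, ∀ t ∈ Icc 0 T, |f' t ξ| ≤ bound ξ) (hbound : Integrable bound μ)
    {t : ℝ} (ht : t ∈ Icc 0 T) :
    HasDerivWithinAt (fun s => ∫ ξ, f s ξ ∂μ) (∫ ξ, f' t ξ ∂μ) (Icc 0 T) t := by
  rw [hasDerivWithinAt_iff_tendsto_slope]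
  have hmem : ∀ᶠ s in 𝓝[Icc 0 T \ {t}] t, s ∈ Icc 0 T \ {t} := self_mem_nhdsWithin
  have hslope : ∀ᶠ s in 𝓝[Icc 0 T \ {t}] t,
      ∫ ξ, slope (fun s => f s ξ) t s ∂μ = slope (fun s => ∫ ξ, f s ξ ∂μ) t s := by
    filter_upwards [hmem] with s hs
    simp only [slope_def_module]
    rw [integral_smul, integral_sub (hint s hs.1) (hint t ht)]
  refine Tendsto.congr' hslope (tendsto_integral_filter_of_dominated_convergence bound ?_ ?_
    hbound ?_)
  · filter_upwards [hmem] with s hs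
    simp only [slope_def_module]
    exact (((hint s hs.1).sub (hint t ht)).smul (s - t)⁻¹).aestronglyMeasurable
  · filter_upwards [hmem] with s hs
    filter_upwards [hb] with ξ hξ
    have := Convex.norm_image_sub_le_of_norm_hasDerivWithin_le (f := fun s => f s ξ)
      (fun r hr => hd r hr ξ) (fun r hr => hξ r hr) (convex_Icc 0 T) ht hs.1
    have h0 : 0 < ‖s - t‖ := norm_pos_iff.2 (sub_ne_zero.2 hs.2)
    rw [slope_def_module, norm_smul, norm_inv, inv_mul_le_iff₀ h0]
    linarith
  · exact Eventually.of_forall fun ξ => hasDerivWithinAt_iff_tendsto_slope.1 (hd t ht ξ)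

/-- Two spare powers of the weight buy an integrable majorant independent of t. -/
theorem Rapid.exists_weighted_bound (hg : Rapid T g) (n : ℕ) :
    ∃ C, 0 ≤ C ∧ ∀ t ∈ Icc 0 T, ∀ y : ℝ, (1 + |y|) ^ n * |g t y| ≤ C * (1 + y ^ 2)⁻¹ := by
  obtain ⟨C, hC⟩ := hg (n + 2)
  refine ⟨|C|, abs_nonneg _, fun t ht y => ?_⟩
  rw [← div_eq_mul_inv, le_div_iff₀ (by positivity)]
  refine le_trans ?_ ((hC t ht y).trans (le_abs_self C))
  rw [pow_add]
  have : 1 + y ^ 2 ≤ (1 + |y|) ^ 2 := by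
    rw [← sq_abs]
    nlinarith [abs_nonneg y]
  calc (1 + |y|) ^ n * |g t y| * (1 + y ^ 2) ≤ (1 + |y|) ^ n * |g t y| * (1 + |y|) ^ 2 := by gcongr
    _ = _ := by ring

theorem integrable_of_bound {u : ℝ → ℝ} (hu : Continuous u) {C : ℝ}
    (h : ∀ y, |u y| ≤ C * (1 + y ^ 2)⁻¹) : Integrable u :=
  (integrable_inv_one_add_sq.const_mul C).mono' hu.aestronglyMeasurable (Eventually.of_forall h)

theorem Sch.integrable (hf : Sch T f) {t : ℝ} (ht : t ∈ Icc 0 T) : Integrable (f t) := by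
  obtain ⟨C, -, hC⟩ := hf.rapid.exists_weighted_bound 0
  exact integrable_of_bound (hf.contOn.slice ht) fun y => by simpa using hC t ht y

theorem setIntegral_abs_le {u : ℝ → ℝ} {C : ℝ} (hC : 0 ≤ C) (s : Set ℝ) (hs : MeasurableSet s)
    (h : ∀ y ∈ s, |u y| ≤ C * (1 + y ^ 2)⁻¹) : |∫ y in s, u y| ≤ C * Real.pi := by
  have hi : Integrable fun y : ℝ => C * (1 + y ^ 2)⁻¹ := integrable_inv_one_add_sq.const_mul C
  calc |∫ y in s, u y| ≤ ∫ y in s, C * (1 + y ^ 2)⁻¹ :=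
        norm_integral_le_of_norm_le (f := u) hi.integrableOn
          ((ae_restrict_iff' hs).2 (Eventually.of_forall fun y hy => h y hy))
    _ ≤ ∫ y, C * (1 + y ^ 2)⁻¹ :=
        setIntegral_le_integral hi (Eventually.of_forall fun y => by positivity)
    _ = C * Real.pi := by rw [integral_const_mul, integral_univ_inv_one_add_sq]

/-- A primitive vanishing at both ends inherits weighted bounds. -/
theorem weighted_primitive_bound {u wt : ℝ → ℝ} {C : ℝ} (hC : 0 ≤ C) (hu : Integrable u)
    (h0 : ∫ ξ, u ξ = 0) (hwt : ∀ y, 0 ≤ wt y) (hmono : ∀ ξ y, |y| ≤ |ξ| → wt y ≤ wt ξ)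
    (h : ∀ ξ, wt ξ * |u ξ| ≤ C * (1 + ξ ^ 2)⁻¹) (y : ℝ) :
    wt y * |∫ ξ in Iic y, u ξ| ≤ C * Real.pi := by
  have key : ∀ s : Set ℝ, MeasurableSet s → (∀ ξ ∈ s, |y| ≤ |ξ|) →
      wt y * |∫ ξ in s, u ξ| ≤ C * Real.pi := by
    intro s hs hys
    rw [← abs_of_nonneg (hwt y), ← abs_mul, ← integral_const_mul]
    refine setIntegral_abs_le hC s hs fun ξ hξ => ?_
    rw [abs_mul, abs_of_nonneg (hwt y)]
    exact le_trans (by gcongr; exact hmono ξ y (hys ξ hξ)) (h ξ)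
  -- Up to sign, the primitive is the integral over either tail, as the total integral is zero. On
  -- the tail beyond y, away from 0, the weight at y is dominated by the weight under the integral.
  rcases le_total y 0 with hy | hy
  · refine key _ measurableSet_Iic fun ξ hξ => ?_
    have hξ' : ξ ≤ y := hξ
    rw [abs_of_nonpos hy, abs_of_nonpos (hξ'.trans hy)]
    linarith
  · have e : ∫ ξ in Iic y, u ξ = -∫ ξ in Ioi y, u ξ := by
      have := integral_add_compl (s := Iic y) measurableSet_Iic hu
      rw [compl_Iic, h0] at this
      linarith
    rw [e, abs_neg]
    refine key _ measurableSet_Ioi fun ξ hξ => ?_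
    have hξ' : y < ξ := hξ
    rw [abs_of_nonneg hy, abs_of_nonneg (hy.trans hξ'.le)]
    exact hξ'.le

theorem hasDerivAt_integral_Iic {u : ℝ → ℝ} (hu : Continuous u) (hi : Integrable u) (y : ℝ) :
    HasDerivAt (fun y => ∫ ξ in Iic y, u ξ) (u y) y := by
  have e : (fun y => ∫ ξ in Iic y, u ξ) = fun y => (∫ ξ in Iic 0, u ξ) + ∫ ξ in (0 : ℝ)..y, u ξ := by
    funext y
    rw [← intervalIntegral.integral_Iic_sub_Iic hi.integrableOn hi.integrableOn]
    ring
  rw [e]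
  exact (intervalIntegral.integral_hasDerivAt_right (hu.intervalIntegrable _ _)
    (hu.stronglyMeasurableAtFilter _ _) hu.continuousAt).const_add _

theorem Sch.hasDerivWithinAt_setIntegral {ft fy : ℝ → ℝ → ℝ} (hf : Sch T f)
    (h : HasPartials T f ft fy) (hft : Sch T ft) (s : Set ℝ) {t : ℝ} (ht : t ∈ Icc 0 T) :
    HasDerivWithinAt (fun r => ∫ ξ in s, f r ξ) (∫ ξ in s, ft t ξ) (Icc 0 T) t := by
  obtain ⟨C, -, hC⟩ := hft.rapid.exists_weighted_bound 0
  exact hasDerivWithinAt_integral (fun r hr => (hf.integrable hr).integrableOn)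
    (fun r hr ξ => (h r hr ξ).1)
    (Eventually.of_forall fun ξ r hr => by simpa using hC r hr ξ)
    (integrable_inv_one_add_sq.const_mul C).integrableOn ht

/-- The vanishing mean is differentiated under the integral sign. This keeps conditions of mean zero
alive under ∂_t, as the inductions over the order of derivatives require. -/
theorem Sch.integral_partial_eq_zero (hT : 0 < T) {ft fy : ℝ → ℝ → ℝ} (hf : Sch T f)
    (h : HasPartials T f ft fy) (h0 : ∀ t ∈ Icc 0 T, ∫ ξ, f t ξ = 0) {t : ℝ} (ht : t ∈ Icc 0 T) :
    ∫ ξ, ft t ξ = 0 := by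
  have h1 := hf.hasDerivWithinAt_setIntegral h (hf.of_hasPartials hT h).1 univ ht
  simp only [setIntegral_univ] at h1
  have h2 : HasDerivWithinAt (fun r => ∫ ξ, f r ξ) 0 (Icc 0 T) t :=
    (hasDerivWithinAt_const t (Icc 0 T) (0 : ℝ)).congr (fun s hs => h0 s hs) (h0 t ht)
  exact (uniqueDiffOn_Icc hT t ht).eq_deriv _ h1 h2

theorem Sch.hasPartials_primitive {ft fy : ℝ → ℝ → ℝ} (hf : Sch T f)
    (h : HasPartials T f ft fy) (hft : Sch T ft) :
    HasPartials T (fun t y => ∫ ξ in Iic y, f t ξ) (fun t y => ∫ ξ in Iic y, ft t ξ) f :=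
  fun _ ht y => ⟨hf.hasDerivWithinAt_setIntegral h hft _ ht,
    hasDerivAt_integral_Iic (hf.contOn.slice ht) (hf.integrable ht) y⟩

theorem Sch.rapid_primitive (hf : Sch T f) (h0 : ∀ t ∈ Icc 0 T, ∫ ξ, f t ξ = 0) :
    Rapid T (fun t y => ∫ ξ in Iic y, f t ξ) := by
  intro n
  obtain ⟨C, hC0, hC⟩ := hf.rapid.exists_weighted_bound n
  exact ⟨C * Real.pi, fun t ht y => weighted_primitive_bound (wt := fun y => (1 + |y|) ^ n) hC0
    (hf.integrable ht) (h0 t ht) (fun y => by positivity)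
    (fun ξ y h => by gcongr) (fun ξ => hC t ht ξ) y⟩

/-- ∂_t acts on the integrand and ∂_τ returns `f`, so the partials are again of the types already
treated. Joint continuity comes from the boundedness of both partials. -/
theorem Sch.primitive (hT : 0 < T) (hf : Sch T f) (h0 : ∀ t ∈ Icc 0 T, ∫ ξ, f t ξ = 0) :
    Sch T (fun t y => ∫ ξ in Iic y, f t ξ) := by
  have hc : ∀ f, Sch T f → (∀ t ∈ Icc 0 T, ∫ ξ, f t ξ = 0) →
      ContOn T (fun t y => ∫ ξ in Iic y, f t ξ) := by
    intro f hf h0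
    obtain ⟨ft, fy, h, h1, h2⟩ := hf.exists_partials hT
    exact (hf.hasPartials_primitive h h1).contOn
      (h1.rapid_primitive fun t ht => hf.integral_partial_eq_zero hT h h0 ht) hf.rapid
  intro k
  induction k generalizing f with
  | zero => exact ⟨hc f hf h0, hf.rapid_primitive h0⟩
  | succ k ih =>
    obtain ⟨ft, fy, h, h1, h2⟩ := hf.exists_partials hT
    exact ⟨⟨hc f hf h0, hf.rapid_primitive h0⟩, _, _, hf.hasPartials_primitive h h1,
      ih h1 fun t ht => hf.integral_partial_eq_zero hT h h0 ht, hf k⟩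

end Integrals

/-! ### Two independent solutions of the homogeneous equation -/

section Fundamental

/-- The bounded solution `sech² tanh` of `(1+S) w'' - 2 S tanh · w' + (-4 + 4 S + 18 S²) w = 0`,
`S = sech² = 1 - tanh²`. -/
def solA (y : ℝ) : ℝ := Real.tanh y * (1 - Real.tanh y ^ 2)

/-- The derivative of `solA`. -/
def solA' (y : ℝ) : ℝ := (1 - Real.tanh y ^ 2) * (1 - 3 * Real.tanh y ^ 2)

/-- The derivative of the regular part of `∫ 1 / ((1 + S) solA²)`. -/
def solDens (y : ℝ) : ℝ :=
  ((1 - Real.tanh y ^ 2) ^ 2)⁻¹ + 1 - (1 - Real.tanh y ^ 2) / (2 * (2 - Real.tanh y ^ 2))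

/-- The primitive of `solDens` vanishing at `0`. -/
def solPrim (y : ℝ) : ℝ := ∫ ξ in (0 : ℝ)..y, solDens ξ

/-- A second solution, growing at both ends, with `(1 + S) (solA solB' - solA' solB) = 1`. -/
def solB (y : ℝ) : ℝ := -(1 - Real.tanh y ^ 2) / 2 + solA y * solPrim y

/-- The derivative of `solB`. -/
def solB' (y : ℝ) : ℝ := solA y + solA' y * solPrim y + solA y * solDens y

/-- The second derivative at `y` of a solution of the inhomogeneous equation with value `w`, slope
`w'` and right-hand side `g`. -/
def secondDeriv (y w w' g : ℝ) : ℝ :=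
  (g + 2 * solA y * w' - (-4 + 4 * (1 - Real.tanh y ^ 2) + 18 * (1 - Real.tanh y ^ 2) ^ 2) * w)
    * (2 - Real.tanh y ^ 2)⁻¹

theorem continuous_solDens : Continuous solDens := by
  have h := continuous_tanh
  unfold solDens
  refine ((Continuous.inv₀ (by fun_prop) fun y => ?_).add continuous_const).sub
    (Continuous.div (by fun_prop) (by fun_prop) fun y => ?_)
  · have := one_sub_tanh_sq_pos y
    positivity
  · have := two_sub_tanh_sq_pos y
    positivity

theorem hasDerivAt_solA (y : ℝ) : HasDerivAt solA (solA' y) y := by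
  have h := (hasDerivAt_tanh y).mul (hasDerivAt_one_sub_tanh_sq y)
  unfold solA'
  convert! h using 1
  ring

theorem hasDerivAt_solPrim (y : ℝ) : HasDerivAt solPrim (solDens y) y :=
  intervalIntegral.integral_hasDerivAt_right (continuous_solDens.intervalIntegrable _ _)
    (continuous_solDens.stronglyMeasurableAtFilter _ _) continuous_solDens.continuousAt

theorem hasDerivAt_solB (y : ℝ) : HasDerivAt solB (solB' y) y := by
  have h := ((hasDerivAt_one_sub_tanh_sq y).neg.div_const 2).add
    ((hasDerivAt_solA y).mul (hasDerivAt_solPrim y))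
  convert! h using 1
  simp only [solB', solA]
  ring

theorem continuous_solB : Continuous solB :=
  continuous_iff_continuousAt.2 fun y => (hasDerivAt_solB y).continuousAt

/-- Translation invariance is behind this: the derivative of a travelling wave solves the linearised
equation, and `solA` is that derivative up to scaling. -/
theorem hasDerivAt_solA' (y : ℝ) : HasDerivAt solA' (secondDeriv y (solA y) (solA' y) 0) y := by
  have h := (hasDerivAt_one_sub_tanh_sq y).mul
    ((((hasDerivAt_tanh y).pow 2).const_mul 3).const_sub 1)
  convert! h using 1
  have h0 : 2 - Real.tanh y ^ 2 ≠ 0 := by linarith [two_sub_tanh_sq_pos y]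
  simp only [secondDeriv, solA, solA', Pi.pow_apply]
  field_simp
  ring

theorem hasDerivAt_solDens (y : ℝ) : HasDerivAt solDens
    (4 * Real.tanh y / (1 - Real.tanh y ^ 2) ^ 2
      + Real.tanh y * (1 - Real.tanh y ^ 2) / (2 - Real.tanh y ^ 2) ^ 2) y := by
  have h0 : 2 - Real.tanh y ^ 2 ≠ 0 := by linarith [two_sub_tanh_sq_pos y]
  have h1 := (one_sub_tanh_sq_pos y).ne'
  have hS := hasDerivAt_one_sub_tanh_sq y
  have h := (((hS.pow 2).inv (pow_ne_zero 2 h1)).add_const 1).sub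
    (hS.div ((((hasDerivAt_tanh y).pow 2).const_sub 2).const_mul 2) (mul_ne_zero two_ne_zero h0))
  convert! h using 1
  simp only [Pi.pow_apply]
  field_simp
  ring

theorem hasDerivAt_solB' (y : ℝ) : HasDerivAt solB' (secondDeriv y (solB y) (solB' y) 0) y := by
  have h := ((hasDerivAt_solA y).add ((hasDerivAt_solA' y).mul (hasDerivAt_solPrim y))).add
    ((hasDerivAt_solA y).mul (hasDerivAt_solDens y))
  convert! h using 1
  have h0 : 2 - Real.tanh y ^ 2 ≠ 0 := by linarith [two_sub_tanh_sq_pos y]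
  have h1 := (one_sub_tanh_sq_pos y).ne'
  simp only [secondDeriv, solB, solB', solA, solA', solDens]
  field_simp
  ring

/-- Reduction of order. One has 1/((1 + S) solA²) = S/(2 tanh²) + `solDens`, where the first summand
has the primitive -1/(2 tanh). Multiplied by `solA`, this singular part becomes the smooth function
-S/2 that opens `solB`. Away from 0 the identity says (solB/solA)' = 1/((1 + S) solA²). -/
theorem wronskian_sol (y : ℝ) :
    solB' y * solA y - solA' y * solB y = (2 - Real.tanh y ^ 2)⁻¹ := by
  have h0 : 2 - Real.tanh y ^ 2 ≠ 0 := by linarith [two_sub_tanh_sq_pos y]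
  have h1 := (one_sub_tanh_sq_pos y).ne'
  simp only [solB, solB', solA, solA', solDens]
  field_simp
  ring

theorem cosh_sq_mul_one_sub_tanh_sq (y : ℝ) : (1 - Real.tanh y ^ 2) * Real.cosh y ^ 2 = 1 := by
  have := Real.cosh_pos y
  rw [one_sub_tanh_sq, inv_mul_cancel₀ (by positivity)]

theorem abs_solA_le (y : ℝ) : |solA y| * Real.cosh y ^ 2 ≤ 1 := by
  rw [solA, abs_mul, abs_of_pos (one_sub_tanh_sq_pos y), mul_assoc, cosh_sq_mul_one_sub_tanh_sq,
    mul_one]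
  exact abs_tanh_le_one y

theorem abs_solA'_le (y : ℝ) : |solA' y| * Real.cosh y ^ 2 ≤ 2 := by
  rw [solA', abs_mul, abs_of_pos (one_sub_tanh_sq_pos y), mul_right_comm,
    cosh_sq_mul_one_sub_tanh_sq, one_mul, abs_le]
  have := one_sub_tanh_sq_pos y
  constructor <;> nlinarith [sq_nonneg (Real.tanh y)]

theorem abs_solDens_le (y : ℝ) : |solDens y| ≤ 2 * (Real.cosh y ^ 2) ^ 2 := by
  have h0 := two_sub_tanh_sq_pos y
  have h1 := one_sub_tanh_sq_pos y
  have hc : 1 ≤ Real.cosh y ^ 2 := one_le_pow₀ (Real.one_le_cosh y)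
  have h2 : (1 - Real.tanh y ^ 2) / (2 * (2 - Real.tanh y ^ 2)) ≤ 1 := by
    rw [div_le_one (by positivity)]
    linarith
  have h3 : 0 ≤ (1 - Real.tanh y ^ 2) / (2 * (2 - Real.tanh y ^ 2)) := by positivity
  have h4 : ((1 - Real.tanh y ^ 2) ^ 2)⁻¹ = (Real.cosh y ^ 2) ^ 2 := by
    rw [one_sub_tanh_sq, inv_pow, inv_inv]
  rw [solDens, h4, abs_le]
  constructor <;> nlinarith

theorem abs_le_of_mem_uIoc {ξ y : ℝ} (h : ξ ∈ uIoc 0 y) : |ξ| ≤ |y| := by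
  rcases le_total 0 y with hy | hy
  · rw [uIoc_of_le hy] at h
    rw [abs_of_nonneg hy, abs_of_pos h.1]; exact h.2
  · rw [uIoc_of_ge hy] at h
    rw [abs_of_nonpos hy, abs_of_nonpos h.2]; linarith [h.1]

theorem abs_solPrim_le (y : ℝ) : |solPrim y| ≤ 2 * (Real.cosh y ^ 2) ^ 2 * |y| := by
  have := intervalIntegral.norm_integral_le_of_norm_le_const (a := 0) (b := y) (f := solDens)
    (C := 2 * (Real.cosh y ^ 2) ^ 2) fun ξ hξ => by
      refine (abs_solDens_le ξ).trans ?_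
      have h := abs_le_of_mem_uIoc hξ
      have := Real.cosh_pos ξ
      have := Real.cosh_le_cosh.2 h
      gcongr
  simpa [solPrim] using! this

/-- The decay cosh⁻² of `solA` is set against the bound cosh⁴ |y| for `solPrim`. The factor 1 + |y|
is not sharp, but it costs only one power of the weight. -/
theorem abs_solB_le (y : ℝ) : |solB y| ≤ 8 * ((1 + |y|) * Real.cosh y ^ 2) := by
  have hc : 1 ≤ Real.cosh y ^ 2 := one_le_pow₀ (Real.one_le_cosh y)
  have h1 := one_sub_tanh_sq_pos y
  have e1 : |-(1 - Real.tanh y ^ 2) / 2| ≤ 1 := by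
    rw [abs_le]; constructor <;> nlinarith [sq_nonneg (Real.tanh y)]
  have e2 : |solA y * solPrim y| ≤ 2 * Real.cosh y ^ 2 * |y| := by
    rw [abs_mul]
    calc |solA y| * |solPrim y| ≤ |solA y| * (2 * (Real.cosh y ^ 2) ^ 2 * |y|) := by
          gcongr; exact abs_solPrim_le y
      _ = (|solA y| * Real.cosh y ^ 2) * (2 * Real.cosh y ^ 2 * |y|) := by ring
      _ ≤ 1 * (2 * Real.cosh y ^ 2 * |y|) := by gcongr; exact abs_solA_le y
      _ = _ := one_mul _
  have e3 := abs_add_le (-(1 - Real.tanh y ^ 2) / 2) (solA y * solPrim y)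
  rw [solB]
  nlinarith [mul_nonneg (abs_nonneg y) (zero_le_one.trans hc)]

theorem abs_solB'_le (y : ℝ) : |solB' y| ≤ 8 * ((1 + |y|) * Real.cosh y ^ 2) := by
  have hc : 1 ≤ Real.cosh y ^ 2 := one_le_pow₀ (Real.one_le_cosh y)
  have e1 : |solA y| ≤ 1 :=
    (le_mul_of_one_le_right (abs_nonneg _) hc).trans (abs_solA_le y)
  have e2 : |solA' y * solPrim y| ≤ 2 * (2 * Real.cosh y ^ 2 * |y|) := by
    rw [abs_mul]
    calc |solA' y| * |solPrim y| ≤ |solA' y| * (2 * (Real.cosh y ^ 2) ^ 2 * |y|) := by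
          gcongr; exact abs_solPrim_le y
      _ = (|solA' y| * Real.cosh y ^ 2) * (2 * Real.cosh y ^ 2 * |y|) := by ring
      _ ≤ 2 * (2 * Real.cosh y ^ 2 * |y|) := by gcongr; exact abs_solA'_le y
  have e3 : |solA y * solDens y| ≤ 2 * Real.cosh y ^ 2 := by
    rw [abs_mul]
    calc |solA y| * |solDens y| ≤ |solA y| * (2 * (Real.cosh y ^ 2) ^ 2) := by
          gcongr; exact abs_solDens_le y
      _ = (|solA y| * Real.cosh y ^ 2) * (2 * Real.cosh y ^ 2) := by ring
      _ ≤ 1 * (2 * Real.cosh y ^ 2) := by gcongr; exact abs_solA_le y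
      _ = _ := one_mul _
  have e4 := abs_add_three (solA y) (solA' y * solPrim y) (solA y * solDens y)
  rw [solB']
  nlinarith [mul_nonneg (abs_nonneg y) (zero_le_one.trans hc)]

end Fundamental

/-! ### Variation of constants in the class of rapidly decaying functions -/

section SolutionOperator

variable {T : ℝ} {g : ℝ → ℝ → ℝ}

/-- `eB(y) ∫_{-∞}^y solA g - eA(y) ∫_0^y solB g`, the formula of variation of constants for
`eA = solA`, `eB = solB`. -/
def varConst (eA eB : ℝ → ℝ) (g : ℝ → ℝ → ℝ) (t y : ℝ) : ℝ :=
  eB y * (∫ ξ in Iic y, solA ξ * g t ξ) - eA y * ∫ ξ in (0 : ℝ)..y, solB ξ * g t ξ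

theorem temp_solA : Temp T (fun _ y => solA y) :=
  temp_tanh.mul ((temp_const 1).sub (temp_tanh.pow 2))

theorem Sch.solA_mul (hg : Sch T g) : Sch T (fun t y => solA y * g t y) := temp_solA.mul_sch hg

/-- The growth of `e` is compensated by the primitive: `solA` absorbs cosh² under the integral, and
the vanishing mean allows this weight to be moved inside the integral for either sign of y. -/
theorem rapid_mul_integral_solA {e : ℝ → ℝ} (he : ∀ y, |e y| ≤ 8 * ((1 + |y|) * Real.cosh y ^ 2))
    (hg : Sch T g) (h0 : ∀ t ∈ Icc 0 T, ∫ ξ, solA ξ * g t ξ = 0) :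
    Rapid T (fun t y => e y * ∫ ξ in Iic y, solA ξ * g t ξ) := by
  intro n
  obtain ⟨C, hC0, hC⟩ := hg.rapid.exists_weighted_bound (n + 1)
  refine ⟨8 * (C * Real.pi), fun t ht y => ?_⟩
  have key := weighted_primitive_bound (wt := fun y => (1 + |y|) ^ (n + 1) * Real.cosh y ^ 2)
    (u := fun ξ => solA ξ * g t ξ) hC0 (hg.solA_mul.integrable ht) (h0 t ht)
    (fun y => by positivity) (fun ξ y h => by
      have h1 := Real.cosh_le_cosh.2 h
      have h2 := Real.cosh_pos y
      gcongr) (fun ξ => by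
      refine le_trans ?_ (hC t ht ξ)
      rw [abs_mul]
      calc (1 + |ξ|) ^ (n + 1) * Real.cosh ξ ^ 2 * (|solA ξ| * |g t ξ|)
          = (|solA ξ| * Real.cosh ξ ^ 2) * ((1 + |ξ|) ^ (n + 1) * |g t ξ|) := by ring
        _ ≤ 1 * ((1 + |ξ|) ^ (n + 1) * |g t ξ|) := by gcongr; exact abs_solA_le ξ
        _ = _ := one_mul _) y
  rw [abs_mul]
  calc (1 + |y|) ^ n * (|e y| * |∫ ξ in Iic y, solA ξ * g t ξ|)
      ≤ (1 + |y|) ^ n * (8 * ((1 + |y|) * Real.cosh y ^ 2) *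
          |∫ ξ in Iic y, solA ξ * g t ξ|) := by gcongr; exact he y
    _ = 8 * ((1 + |y|) ^ (n + 1) * Real.cosh y ^ 2 * |∫ ξ in Iic y, solA ξ * g t ξ|) := by ring
    _ ≤ 8 * (C * Real.pi) := by gcongr

/-- The integral grows with `solB`, but only between 0 and y; there the decay of `e` dominates cosh²
ξ, and the ratio bound carries the polynomial weight along. -/
theorem rapid_mul_integral_solB {e : ℝ → ℝ} (he : ∀ y, |e y| * Real.cosh y ^ 2 ≤ 2)
    (hg : Sch T g) : Rapid T (fun t y => e y * ∫ ξ in (0 : ℝ)..y, solB ξ * g t ξ) := by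
  intro n
  obtain ⟨D, hD0, hD⟩ := exists_cosh_sq_ratio_bound n
  obtain ⟨C, hC0, hC⟩ := hg.rapid.exists_weighted_bound (n + 1)
  refine ⟨2 * (8 * D * C * Real.pi), fun t ht y => ?_⟩
  have key : (1 + |y|) ^ n * |∫ ξ in (0 : ℝ)..y, solB ξ * g t ξ|
      ≤ Real.cosh y ^ 2 * (8 * D * C * Real.pi) := by
    rw [intervalIntegral.abs_integral_eq_abs_integral_uIoc]
    rw [← abs_of_nonneg (by positivity : 0 ≤ (1 + |y|) ^ n), ← abs_mul, ← integral_const_mul]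
    refine (setIntegral_abs_le (C := Real.cosh y ^ 2 * (8 * D * C)) (by positivity) _
      measurableSet_uIoc fun ξ hξ => ?_).trans_eq (by ring)
    rw [abs_mul, abs_mul, abs_of_nonneg (by positivity : 0 ≤ (1 + |y|) ^ n)]
    calc (1 + |y|) ^ n * (|solB ξ| * |g t ξ|)
        ≤ (1 + |y|) ^ n * (8 * ((1 + |ξ|) * Real.cosh ξ ^ 2) * |g t ξ|) := by
          gcongr; exact abs_solB_le ξ
      _ = ((1 + |y|) ^ n * Real.cosh ξ ^ 2) * (8 * (1 + |ξ|) * |g t ξ|) := by ring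
      _ ≤ (D * (1 + |ξ|) ^ n * Real.cosh y ^ 2) * (8 * (1 + |ξ|) * |g t ξ|) :=
          mul_le_mul_of_nonneg_right (hD ξ y (abs_le_of_mem_uIoc hξ)) (by positivity)
      _ = Real.cosh y ^ 2 * (8 * D) * ((1 + |ξ|) ^ (n + 1) * |g t ξ|) := by ring
      _ ≤ Real.cosh y ^ 2 * (8 * D) * (C * (1 + ξ ^ 2)⁻¹) :=
          mul_le_mul_of_nonneg_left (hC t ht ξ) (by positivity)
      _ = _ := by ring
  rw [abs_mul]
  calc (1 + |y|) ^ n * (|e y| * |∫ ξ in (0 : ℝ)..y, solB ξ * g t ξ|)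
      = |e y| * ((1 + |y|) ^ n * |∫ ξ in (0 : ℝ)..y, solB ξ * g t ξ|) := by ring
    _ ≤ |e y| * (Real.cosh y ^ 2 * (8 * D * C * Real.pi)) := by gcongr
    _ = (|e y| * Real.cosh y ^ 2) * (8 * D * C * Real.pi) := by ring
    _ ≤ 2 * (8 * D * C * Real.pi) := by gcongr; exact he y

theorem rapid_varConst {eA eB : ℝ → ℝ} (hA : ∀ y, |eA y| * Real.cosh y ^ 2 ≤ 2)
    (hB : ∀ y, |eB y| ≤ 8 * ((1 + |y|) * Real.cosh y ^ 2)) (hg : Sch T g)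
    (h0 : ∀ t ∈ Icc 0 T, ∫ ξ, solA ξ * g t ξ = 0) : Rapid T (varConst eA eB g) := by
  refine ((rapid_mul_integral_solA hB hg h0).add
    ((rapid_mul_integral_solB hA hg).mul (moderate_const (-1)))).congr fun t _ y => ?_
  rw [varConst]
  ring

theorem hasDerivWithinAt_integral_solB {gt gy : ℝ → ℝ → ℝ} (hg : Sch T g)
    (h : HasPartials T g gt gy) (hgt : Sch T gt) (y : ℝ) {t : ℝ} (ht : t ∈ Icc 0 T) :
    HasDerivWithinAt (fun s => ∫ ξ in (0 : ℝ)..y, solB ξ * g s ξ)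
      (∫ ξ in (0 : ℝ)..y, solB ξ * gt t ξ) (Icc 0 T) t := by
  obtain ⟨C, hC0, hC⟩ := hgt.rapid.bounded
  have hb : Continuous fun ξ => |solB ξ| * C := by
    have := continuous_solB
    fun_prop
  have key : ∀ a b : ℝ, HasDerivWithinAt (fun s => ∫ ξ in Ioc a b, solB ξ * g s ξ)
      (∫ ξ in Ioc a b, solB ξ * gt t ξ) (Icc 0 T) t := by
    intro a b
    refine hasDerivWithinAt_integral (bound := fun ξ => |solB ξ| * C) (fun s hs => ?_)
      (fun s hs ξ => (h s hs ξ).1.const_mul (solB ξ)) (Eventually.of_forall fun ξ s hs => ?_)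
      ?_ ht
    · exact ((continuous_solB.mul (hg.contOn.slice hs)).integrableOn_Icc).mono_set
        Ioc_subset_Icc_self
    · rw [abs_mul]
      gcongr
      exact hC s hs ξ
    · exact hb.integrableOn_Icc.mono_set Ioc_subset_Icc_self
  -- An interval integral is by definition the difference of two integrals over half-open intervals,
  -- one of them empty.
  exact (key 0 y).sub (key y 0)

/-- Time differentiation only reaches g, as the kernels do not depend on t. The functions eA, eB are
left general so that the computation applies to the pair (solA, solB), where the extra term cancels,
and to its derivatives, where that term is the Wronskian. -/
theorem hasPartials_varConst {eA eB eA' eB' : ℝ → ℝ} (hA : ∀ y, HasDerivAt eA (eA' y) y)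
    (hB : ∀ y, HasDerivAt eB (eB' y) y) {gt gy : ℝ → ℝ → ℝ} (hg : Sch T g)
    (h : HasPartials T g gt gy) (hgt : Sch T gt) :
    HasPartials T (varConst eA eB g) (varConst eA eB gt)
      (fun t y => varConst eA' eB' g t y + (eB y * solA y - eA y * solB y) * g t y) := by
  intro t ht y
  have hmul : HasPartials T (fun t ξ => solA ξ * g t ξ) (fun t ξ => solA ξ * gt t ξ)
      (fun t ξ => solA' ξ * g t ξ + solA ξ * gy t ξ) := fun t ht ξ =>
    ⟨(h t ht ξ).1.const_mul _, (hasDerivAt_solA ξ).mul (h t ht ξ).2⟩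
  have hp := hg.solA_mul.hasPartials_primitive hmul hgt.solA_mul t ht y
  have hc : Continuous fun ξ => solB ξ * g t ξ := continuous_solB.mul (hg.contOn.slice ht)
  refine ⟨(hp.1.const_mul (eB y)).sub
    ((hasDerivWithinAt_integral_solB hg h hgt y ht).const_mul (eA y)), ?_⟩
  have := ((hB y).mul hp.2).sub ((hA y).mul (intervalIntegral.integral_hasDerivAt_right
    (hc.intervalIntegrable 0 y) (hc.stronglyMeasurableAtFilter _ _) hc.continuousAt))
  convert! this using 1
  simp only [varConst]
  ring

theorem secondDeriv_varConst (g : ℝ → ℝ → ℝ) (t y : ℝ) :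
    varConst (fun y => secondDeriv y (solA y) (solA' y) 0)
        (fun y => secondDeriv y (solB y) (solB' y) 0) g t y
      + (solB' y * solA y - solA' y * solB y) * g t y
      = secondDeriv y (varConst solA solB g t y) (varConst solA' solB' g t y) (g t y) := by
  rw [wronskian_sol]
  simp only [varConst, secondDeriv]
  ring

/-- The solution operator maps smooth rapidly decaying families to such families. -/
theorem Sch.varConst (hT : 0 < T) (hg : Sch T g)
    (h0 : ∀ t ∈ Icc 0 T, ∫ ξ, solA ξ * g t ξ = 0) :
    Sch T (varConst solA solB g) ∧ Sch T (VcmCH.varConst solA' solB' g) ∧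
    ∀ t ∈ Icc 0 T, ∀ y, HasDerivAt (VcmCH.varConst solA solB g t)
        (VcmCH.varConst solA' solB' g t y) y ∧
      HasDerivAt (VcmCH.varConst solA' solB' g t) (secondDeriv y (VcmCH.varConst solA solB g t y)
        (VcmCH.varConst solA' solB' g t y) (g t y)) y := by
  have hA : ∀ y, |solA y| * Real.cosh y ^ 2 ≤ 2 := fun y => (abs_solA_le y).trans one_le_two
  have orth : ∀ g gt gy : ℝ → ℝ → ℝ, Sch T g → HasPartials T g gt gy →
      (∀ t ∈ Icc 0 T, ∫ ξ, solA ξ * g t ξ = 0) → ∀ t ∈ Icc 0 T, ∫ ξ, solA ξ * gt t ξ = 0 := by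
    intro g gt gy hg h h0 t ht
    refine hg.solA_mul.integral_partial_eq_zero (ft := fun t ξ => solA ξ * gt t ξ)
      (fy := fun t ξ => solA' ξ * g t ξ + solA ξ * gy t ξ) hT (fun t ht ξ =>
        ⟨(h t ht ξ).1.const_mul _, (hasDerivAt_solA ξ).mul (h t ht ξ).2⟩) h0 ht
  have part : ∀ g gt gy : ℝ → ℝ → ℝ, Sch T g → HasPartials T g gt gy → Sch T gt →
      HasPartials T (VcmCH.varConst solA solB g) (VcmCH.varConst solA solB gt)
        (VcmCH.varConst solA' solB' g) ∧
      HasPartials T (VcmCH.varConst solA' solB' g) (VcmCH.varConst solA' solB' gt)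
        (fun t y => secondDeriv y (VcmCH.varConst solA solB g t y)
          (VcmCH.varConst solA' solB' g t y) (g t y)) := by
    intro g gt gy hg h hgt
    have h1 := hasPartials_varConst hasDerivAt_solA hasDerivAt_solB hg h hgt
    have h2 := hasPartials_varConst hasDerivAt_solA' hasDerivAt_solB' hg h hgt
    simp only [secondDeriv_varConst] at h2
    refine ⟨fun t ht y => ⟨(h1 t ht y).1, ?_⟩, h2⟩
    convert! (h1 t ht y).2 using 1
    ring
  have hcoef : Temp T (fun _ y => 2 * solA y) := (temp_const 2).mul temp_solA
  have hcoef' : Temp T (fun _ y => -(-4 + 4 * (1 - Real.tanh y ^ 2)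
      + 18 * (1 - Real.tanh y ^ 2) ^ 2)) :=
    (((temp_const (-4)).add ((temp_const 4).mul sch_one_sub_tanh_sq.temp)).add
      ((temp_const 18).mul (sch_one_sub_tanh_sq.temp.pow 2))).neg
  have second : ∀ g : ℝ → ℝ → ℝ, Sch T g → ∀ k,
      Tame T (Rapid T) k (VcmCH.varConst solA solB g) →
      Tame T (Rapid T) k (VcmCH.varConst solA' solB' g) →
      Tame T (Rapid T) k (fun t y => secondDeriv y (VcmCH.varConst solA solB g t y)
          (VcmCH.varConst solA' solB' g t y) (g t y)) := by
    intro g hg k h1 h2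
    refine (Tame.mul_moderate ((((hg k).add (fun _ _ => Rapid.add)
      (h2.mul_moderate (hcoef k))).add (fun _ _ => Rapid.add) (h1.mul_moderate (hcoef' k))))
      (temp_inv_two_sub_tanh_sq k)).congr (fun _ _ h h' => h'.congr h) fun t _ y => ?_
    rw [secondDeriv]
    ring
  have rap : ∀ g : ℝ → ℝ → ℝ, Sch T g → (∀ t ∈ Icc 0 T, ∫ ξ, solA ξ * g t ξ = 0) →
      Rapid T (VcmCH.varConst solA solB g) ∧ Rapid T (VcmCH.varConst solA' solB' g) :=
    fun g hg h0 => ⟨rapid_varConst hA abs_solB_le hg h0,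
      rapid_varConst abs_solA'_le abs_solB'_le hg h0⟩
  -- Joint continuity is obtained from bounded partials, which is why the rapid bounds for g and for
  -- its time derivative come before it.
  have base : ∀ g : ℝ → ℝ → ℝ, Sch T g → (∀ t ∈ Icc 0 T, ∫ ξ, solA ξ * g t ξ = 0) →
      Tame T (Rapid T) 0 (VcmCH.varConst solA solB g) ∧
      Tame T (Rapid T) 0 (VcmCH.varConst solA' solB' g) := by
    intro g hg h0
    obtain ⟨gt, gy, h, hgt, -⟩ := hg.exists_partials hT
    obtain ⟨p1, p2⟩ := part g gt gy hg h hgt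
    have r := rap g hg h0
    have r' := rap gt hgt (orth g gt gy hg h h0)
    have c1 := p1.contOn r'.1 r.2
    refine ⟨⟨c1, r.1⟩, ⟨p2.contOn r'.2 ?_, r.2⟩⟩
    refine Rapid.congr (Rapid.mul (Rapid.add (Rapid.add hg.rapid (r.2.mul hcoef.moderate))
      (r.1.mul hcoef'.moderate)) temp_inv_two_sub_tanh_sq.moderate) fun t _ y => ?_
    rw [secondDeriv]
    ring
  -- The induction is over all admissible g at once: ∂_t replaces g by its time derivative, which is
  -- still orthogonal to `solA`, while the second space derivative is read off from the equation and
  -- needs only order `k` of the solution and its slope.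
  have main : ∀ k, ∀ g : ℝ → ℝ → ℝ, Sch T g → (∀ t ∈ Icc 0 T, ∫ ξ, solA ξ * g t ξ = 0) →
      Tame T (Rapid T) k (VcmCH.varConst solA solB g) ∧
      Tame T (Rapid T) k (VcmCH.varConst solA' solB' g) := by
    intro k
    induction k with
    | zero => exact base
    | succ k ih =>
      intro g hg h0
      obtain ⟨gt, gy, h, hgt, -⟩ := hg.exists_partials hT
      obtain ⟨p1, p2⟩ := part g gt gy hg h hgt
      obtain ⟨b1, b2⟩ := base g hg h0
      obtain ⟨i1, i2⟩ := ih g hg h0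
      obtain ⟨j1, j2⟩ := ih gt hgt (orth g gt gy hg h h0)
      exact ⟨⟨b1, _, _, p1, j1, i2⟩, ⟨b2, _, _, p2, j2, second g hg k i1 i2⟩⟩
  obtain ⟨gt, gy, h, hgt, -⟩ := hg.exists_partials hT
  obtain ⟨p1, p2⟩ := part g gt gy hg h hgt
  exact ⟨fun k => (main k g hg h0).1, fun k => (main k g hg h0).2,
    fun t ht y => ⟨(p1 t ht y).2, (p2 t ht y).2⟩⟩

end SolutionOperator

/-! ### Restriction of the coefficients to the curve -/

section Curves

variable {T : ℝ} {f : ℝ → ℝ → ℝ}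

theorem Smooth.slice (hT : 0 < T) (hf : Smooth T f) {t : ℝ} (ht : t ∈ Icc 0 T) :
    ContDiff ℝ ∞ (f t) := by
  have h := (hf.contDiffOn hT).comp (s := univ) (f := fun y : ℝ => (t, y))
    (by fun_prop) fun y _ => ⟨ht, mem_univ _⟩
  exact contDiffOn_univ.1 h

/-- Finite `n` is allowed because the bootstrap for the phase meets a `φ` not yet known to be
smooth. -/
theorem contDiffOn_comp_curve {n : ℕ∞} {a : ℝ → ℝ → ℝ} {φ : ℝ → ℝ}
    (ha : ContDiffOn ℝ ∞ (fun z : ℝ × ℝ => a z.1 z.2) (strip T))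
    (hφ : ContDiffOn ℝ n φ (Icc 0 T)) : ContDiffOn ℝ n (fun t => a (φ t) t) (Icc 0 T) :=
  (ha.of_le (by exact_mod_cast le_top)).comp (f := fun t => (φ t, t)) (hφ.prodMk contDiffOn_id)
    fun t ht => ⟨mem_univ _, ht⟩

theorem smooth_swap (hT : 0 < T) {a : ℝ → ℝ → ℝ}
    (ha : ContDiffOn ℝ ∞ (fun z : ℝ × ℝ => a z.1 z.2) (strip T)) : Smooth T (fun t x => a x t) :=
  smooth_of_contDiffOn hT (ha.comp (f := fun z : ℝ × ℝ => (z.2, z.1)) (by fun_prop)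
    fun z hz => ⟨mem_univ _, hz.1⟩)

theorem contDiffOn_iteratedDeriv_curve (hT : 0 < T) {a : ℝ → ℝ → ℝ} {φ : ℝ → ℝ}
    (ha : ContDiffOn ℝ ∞ (fun z : ℝ × ℝ => a z.1 z.2) (strip T))
    (hφ : ContDiffOn ℝ ∞ φ (Icc 0 T)) (i : ℕ) :
    ContDiffOn ℝ ∞ (fun t => iteratedDeriv i (fun x => a x t) (φ t)) (Icc 0 T) := by
  have h := (((smooth_swap hT ha).partialTTau hT 0 i).contDiffOn hT).comp
    (f := fun t => (t, φ t)) (contDiffOn_id.prodMk hφ) fun t ht => ⟨ht, mem_univ _⟩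
  refine h.congr fun t _ => ?_
  simp only [Function.comp, partialTTau_zero_left]

end Curves

/-! ### The phase and the main term -/

/-- The hypotheses on the coefficients, the phase and the phase shift. -/
structure Setting (T : ℝ) (N : ℕ) (a b : ℕ → ℝ → ℝ → ℝ) (φ C₀ : ℝ → ℝ) : Prop where
  pos : 0 < T
  smooth_a : ∀ k ≤ N, ContDiffOn ℝ ∞ (fun z : ℝ × ℝ => a k z.1 z.2) (strip T)
  smooth_b : ∀ k ≤ N, ContDiffOn ℝ ∞ (fun z : ℝ × ℝ => b k z.1 z.2) (strip T)
  ne_zero : ∀ x : ℝ, ∀ t ∈ Icc 0 T, a 0 x t * b 0 x t ≠ 0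
  phase : IsPhase T (a 0) (b 0) φ
  coeff_pos : ∀ t ∈ Icc 0 T, 0 < a 0 (φ t) t
  smooth_shift : ContDiffOn ℝ ∞ C₀ (Icc 0 T)

namespace Setting

variable {T : ℝ} {N : ℕ} {a b : ℕ → ℝ → ℝ → ℝ} {φ C₀ : ℝ → ℝ} (S : Setting T N a b φ C₀)
include S

theorem b_ne_zero (x : ℝ) {t : ℝ} (ht : t ∈ Icc 0 T) : b 0 x t ≠ 0 :=
  (mul_ne_zero_iff.1 (S.ne_zero x t ht)).2

theorem derivWithin_phase {t : ℝ} (ht : t ∈ Icc 0 T) :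
    derivWithin φ (Icc 0 T) t = 6 * a 0 (φ t) t / b 0 (φ t) t :=
  (S.phase t ht).derivWithin (uniqueDiffOn_Icc S.pos t ht)

theorem phase_ne_zero {t : ℝ} (ht : t ∈ Icc 0 T) : derivWithin φ (Icc 0 T) t ≠ 0 := by
  rw [S.derivWithin_phase ht]
  exact div_ne_zero (mul_ne_zero (by norm_num) (S.coeff_pos t ht).ne') (S.b_ne_zero _ ht)

/-- Bootstrap: a phase of class C^n makes the right-hand side of its own equation C^n, so the phase
is C^(n+1). -/
theorem contDiffOn_phase : ContDiffOn ℝ ∞ φ (Icc 0 T) := by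
  rw [contDiffOn_infty]
  intro n
  induction n with
  | zero => exact contDiffOn_zero.2 fun t ht => (S.phase t ht).continuousWithinAt
  | succ n ih =>
    push_cast
    rw [contDiffOn_succ_iff_derivWithin (uniqueDiffOn_Icc S.pos)]
    refine ⟨fun t ht => (S.phase t ht).differentiableWithinAt, by simp, ?_⟩
    have ha := contDiffOn_comp_curve (n := n) (S.smooth_a 0 (Nat.zero_le _)) ih
    have hb := contDiffOn_comp_curve (n := n) (S.smooth_b 0 (Nat.zero_le _)) ih
    exact ((contDiffOn_const.mul ha).div hb fun t ht => S.b_ne_zero _ ht).congr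
      fun t ht => S.derivWithin_phase ht

theorem contDiffOn_speed : ContDiffOn ℝ ∞ (derivWithin φ (Icc 0 T)) (Icc 0 T) :=
  ((contDiffOn_infty_iff_derivWithin (uniqueDiffOn_Icc S.pos)).1 S.contDiffOn_phase).2

theorem contDiffOn_coeff : ContDiffOn ℝ ∞ (fun t => a 0 (φ t) t) (Icc 0 T) :=
  contDiffOn_comp_curve (n := ⊤) (S.smooth_a 0 (Nat.zero_le _)) S.contDiffOn_phase

theorem contDiffOn_width : ContDiffOn ℝ ∞ (fun t => Real.sqrt (a 0 (φ t) t) / 2) (Icc 0 T) :=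
  (S.contDiffOn_coeff.sqrt fun t ht => (S.coeff_pos t ht).ne').div_const 2

theorem width_pos {t : ℝ} (ht : t ∈ Icc 0 T) : 0 < Real.sqrt (a 0 (φ t) t) / 2 := by
  have := S.coeff_pos t ht
  positivity

/-- The phase equation identifies the amplitude -6 a₀/b₀ with minus the speed; this ties the profile
to the travelling-wave equation. -/
theorem mainTerm_eq {t : ℝ} (ht : t ∈ Icc 0 T) (τ : ℝ) :
    mainTerm (a 0) (b 0) φ C₀ t τ = -derivWithin φ (Icc 0 T) t *
      (1 - Real.tanh (Real.sqrt (a 0 (φ t) t) / 2 * τ + C₀ t) ^ 2) := by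
  rw [mainTerm, one_sub_tanh_sq, S.derivWithin_phase ht, div_eq_mul_inv, mul_div_right_comm]
  ring

theorem sch_mainTerm : Sch T (mainTerm (a 0) (b 0) φ C₀) :=
  ((temp_of_contDiffOn S.pos S.contDiffOn_speed.neg).mul_sch
    (sch_one_sub_tanh_sq.comp_affine S.pos S.contDiffOn_width S.smooth_shift
      fun _ ht => (S.width_pos ht).ne')).congr fun _ ht τ => S.mainTerm_eq ht τ

end Setting

/-! ### Rapid decay of the forcing terms -/

section Coefficients

variable {T : ℝ} {N : ℕ} {a b c : ℕ → ℝ → ℝ → ℝ} {φ C₀ : ℝ → ℝ} {v : ℕ → ℝ → ℝ → ℝ}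

theorem temp_coeffExpansion (hT : 0 < T)
    (hc : ∀ k ≤ N, ContDiffOn ℝ ∞ (fun z : ℝ × ℝ => c k z.1 z.2) (strip T))
    (hφ : ContDiffOn ℝ ∞ φ (Icc 0 T)) {m : ℕ} (hm : m ≤ N) :
    Temp T (coeffExpansion c φ m) := by
  refine temp_sum _ fun p hp => ?_
  have hp' := Finset.HasAntidiagonal.mem_antidiagonal.1 hp
  have h1 := (temp_snd (T := T).pow p.2).mul (temp_const ((p.2.factorial : ℝ)⁻¹))
  exact h1.mul (temp_of_contDiffOn hT (contDiffOn_iteratedDeriv_curve hT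
    (hc p.1 (by omega)) hφ p.2))

namespace Setting

variable (S : Setting T N a b φ C₀)
include S

/-- Taylor expansion makes the coefficients grow polynomially in τ, but every summand also contains
a rapidly decaying factor, a derivative of some `v l`. -/
theorem sch_orderCoeff {n : ℕ} (hn : n + 1 ≤ N) (hv : ∀ l ≤ n + 1, Sch T (v l)) :
    Sch T (orderCoeff T a b φ v n) := by
  have hA : ∀ m ≤ n + 1, Temp T (coeffExpansion a φ m) := fun m hm =>
    temp_coeffExpansion S.pos S.smooth_a S.contDiffOn_phase (hm.trans hn)
  have hB : ∀ m ≤ n + 1, Temp T (coeffExpansion b φ m) := fun m hm =>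
    temp_coeffExpansion S.pos S.smooth_b S.contDiffOn_phase (hm.trans hn)
  have hd : ∀ l ≤ n + 1, ∀ p q, Sch T (partialTTau T p q (v l)) := fun l hl p q =>
    (hv l hl).partialTTau S.pos p q
  have hφ := temp_of_contDiffOn S.pos S.contDiffOn_speed
  refine (((((Sch.sub (sch_sum _ fun p hp => ?_) (hφ.mul_sch (sch_sum _ fun p hp => ?_))).sub
    (hd n (Nat.le_succ n) 1 2)).add (hφ.mul_sch (hd (n + 1) le_rfl 0 3))).add
    (sch_sum _ fun p hp => sch_sum _ fun q hq => sch_sum _ fun r hr => ?_)).sub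
    ((temp_const 2).mul_sch (sch_sum _ fun p hp => ?_))).sub (sch_sum _ fun p hp => ?_)
  all_goals have hp' := Finset.HasAntidiagonal.mem_antidiagonal.1 hp
  · exact (hA _ (by omega)).mul_sch (hd _ (by omega) _ _)
  · exact (hA _ (by omega)).mul_sch (hd _ (by omega) _ _)
  · have hq' := Finset.HasAntidiagonal.mem_antidiagonal.1 hq
    have hr' := Finset.HasAntidiagonal.mem_antidiagonal.1 hr
    exact (((hB _ (by omega)).mul_sch (hv _ (by omega))).mul (hv _ (by omega)).temp).mul
      (hd _ (by omega) _ _).temp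
  · exact (hd _ (by omega) _ _).mul (hd _ (by omega) _ _).temp
  · exact (hv _ (by omega)).mul (hd _ (by omega) _ _).temp

theorem sch_forcing {j : ℕ} (h1 : 1 ≤ j) (hj : j ≤ N) (hv : ∀ l < j, Sch T (v l)) :
    Sch T (forcing T a b φ v j) := by
  refine (S.sch_orderCoeff (n := j - 1) (by omega) fun l _ => ?_).neg
  split_ifs with h
  · exact hv l h
  · exact sch_zero

end Setting

end Coefficients

/-! ### The equation for the terms as a total derivative -/

section FirstIntegral

/-- The first integral of the left-hand side of the equation for the terms. -/
def firstIntegral (c A B : ℝ) (v w : ℝ → ℝ) (τ : ℝ) : ℝ :=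
  (c - v τ) * iteratedDeriv 2 w τ - deriv v τ * deriv w τ
    + (-A * c + B * v τ ^ 2 - iteratedDeriv 2 v τ) * w τ

theorem hasDerivAt_iteratedDeriv {w : ℝ → ℝ} (hw : ContDiff ℝ ∞ w) (k : ℕ) (τ : ℝ) :
    HasDerivAt (iteratedDeriv k w) (iteratedDeriv (k + 1) w τ) τ := by
  rw [iteratedDeriv_succ]
  exact ((hw.differentiable_iteratedDeriv k (by exact_mod_cast WithTop.coe_lt_top k)) τ).hasDerivAt

/-- The point is the identity (v w'' + v' w' + v'' w)' = v w''' + 2 (v' w')' + v''' w; the other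
terms are visibly derivatives. -/
theorem hasDerivAt_firstIntegral (c A B : ℝ) {v w : ℝ → ℝ} (hv : ContDiff ℝ ∞ v)
    (hw : ContDiff ℝ ∞ w) (τ : ℝ) :
    HasDerivAt (firstIntegral c A B v w)
      ((c - v τ) * iteratedDeriv 3 w τ - A * c * deriv w τ
        + B * deriv (fun σ => v σ ^ 2 * w σ) τ
        - 2 * deriv (fun σ => deriv v σ * deriv w σ) τ
        - iteratedDeriv 3 v τ * w τ) τ := by
  have v0 := hasDerivAt_iteratedDeriv hv 0 τ
  have v1 := hasDerivAt_iteratedDeriv hv 1 τ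
  have v2 := hasDerivAt_iteratedDeriv hv 2 τ
  have w0 := hasDerivAt_iteratedDeriv hw 0 τ
  have w1 := hasDerivAt_iteratedDeriv hw 1 τ
  have w2 := hasDerivAt_iteratedDeriv hw 2 τ
  simp only [iteratedDeriv_zero, iteratedDeriv_one, zero_add, Nat.reduceAdd] at v0 v1 v2 w0 w1 w2
  have e1 : deriv (fun σ => v σ ^ 2 * w σ) τ = _ := ((v0.pow 2).mul w0).deriv
  have e2 : deriv (fun σ => deriv v σ * deriv w σ) τ = _ := (v1.mul w1).deriv
  rw [e1, e2]
  have h := (((v0.const_sub c).mul w2).sub (v1.mul w1)).add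
    (((((v0.pow 2).const_mul B).const_add (-A * c)).sub v2).mul w0)
  convert! h using 1
  simp only [Pi.pow_apply, Pi.sub_apply]
  ring

end FirstIntegral

/-! ### Solvability of the equation for a term, and decay of its solutions -/

theorem integral_comp_affine_eq_zero {G : ℝ → ℝ} {α : ℝ} (hα : α ≠ 0) (β : ℝ)
    (h : ∫ τ, G (α * τ + β) = 0) : ∫ y, G y = 0 := by
  have h1 := Measure.integral_comp_mul_left (fun y => G (y + β)) α
  rw [h, integral_add_right_eq_self (μ := volume) G β] at h1
  have h2 : |α⁻¹| ≠ 0 := abs_ne_zero.2 (inv_ne_zero hα)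
  simpa [h2, hα] using h1.symm

/-- At -∞ the integral over the half-line disappears and Φ_j tends to minus the total integral of
the forcing. Afterwards Φ_j is simply the primitive from -∞. -/
theorem integral_forcing_eq_zero {T : ℝ} {a b : ℕ → ℝ → ℝ → ℝ} {φ : ℝ → ℝ}
    {v : ℕ → ℝ → ℝ → ℝ} {j : ℕ} (hF : Sch T (forcing T a b φ v j))
    (hlim : LimitCondition T a b φ v j) {t : ℝ} (ht : t ∈ Icc 0 T) :
    ∫ ξ, forcing T a b φ v j t ξ = 0 := by
  have hi := hF.integrable ht
  have h1 : Tendsto (fun τ => ∫ ξ in Iic τ, forcing T a b φ v j t ξ) atBot (𝓝 0) := by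
    have h2 := (intervalIntegral_tendsto_integral_Iic 0 hi.integrableOn tendsto_id).const_sub
      (∫ ξ in Iic 0, forcing T a b φ v j t ξ)
    rw [sub_self] at h2
    refine h2.congr fun τ => ?_
    rw [← intervalIntegral.integral_Iic_sub_Iic hi.integrableOn hi.integrableOn]
    simp
  have h3 := (hlim t ht).sub h1
  simp only [primitiveForcing, add_sub_cancel_left, sub_zero] at h3
  have := tendsto_nhds_unique h3 tendsto_const_nhds
  linarith

namespace Setting

variable {T : ℝ} {N : ℕ} {a b : ℕ → ℝ → ℝ → ℝ} {φ C₀ : ℝ → ℝ} (S : Setting T N a b φ C₀)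
  {F : ℝ → ℝ → ℝ} {v : ℕ → ℝ → ℝ → ℝ}
include S

theorem hasDerivAt_mainTerm {t : ℝ} (ht : t ∈ Icc 0 T) (τ : ℝ) :
    HasDerivAt (mainTerm (a 0) (b 0) φ C₀ t)
      (2 * derivWithin φ (Icc 0 T) t * (Real.sqrt (a 0 (φ t) t) / 2) *
        solA (Real.sqrt (a 0 (φ t) t) / 2 * τ + C₀ t)) τ := by
  have e : mainTerm (a 0) (b 0) φ C₀ t = fun τ => -derivWithin φ (Icc 0 T) t *
      (1 - Real.tanh (Real.sqrt (a 0 (φ t) t) / 2 * τ + C₀ t) ^ 2) :=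
    funext fun τ => S.mainTerm_eq ht τ
  have hA : HasDerivAt (fun τ => Real.sqrt (a 0 (φ t) t) / 2 * τ + C₀ t)
      (Real.sqrt (a 0 (φ t) t) / 2) τ := by
    simpa using! ((hasDerivAt_id τ).const_mul (Real.sqrt (a 0 (φ t) t) / 2)).add_const (C₀ t)
  rw [e]
  convert! ((hasDerivAt_one_sub_tanh_sq _).comp τ hA).const_mul (-derivWithin φ (Icc 0 T) t) using 1
  rw [solA]
  ring

theorem deriv_mainTerm {t : ℝ} (ht : t ∈ Icc 0 T) :
    deriv (mainTerm (a 0) (b 0) φ C₀ t) = fun τ =>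
      2 * derivWithin φ (Icc 0 T) t * (Real.sqrt (a 0 (φ t) t) / 2) *
        solA (Real.sqrt (a 0 (φ t) t) / 2 * τ + C₀ t) :=
  funext fun τ => (S.hasDerivAt_mainTerm ht τ).deriv

theorem iteratedDeriv_two_mainTerm {t : ℝ} (ht : t ∈ Icc 0 T) (τ : ℝ) :
    iteratedDeriv 2 (mainTerm (a 0) (b 0) φ C₀ t) τ =
      2 * derivWithin φ (Icc 0 T) t * (Real.sqrt (a 0 (φ t) t) / 2) ^ 2 *
        solA' (Real.sqrt (a 0 (φ t) t) / 2 * τ + C₀ t) := by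
  have hA : HasDerivAt (fun τ => Real.sqrt (a 0 (φ t) t) / 2 * τ + C₀ t)
      (Real.sqrt (a 0 (φ t) t) / 2) τ := by
    simpa using! ((hasDerivAt_id τ).const_mul (Real.sqrt (a 0 (φ t) t) / 2)).add_const (C₀ t)
  rw [iteratedDeriv_succ, iteratedDeriv_one, S.deriv_mainTerm ht]
  refine HasDerivAt.deriv ?_
  convert! ((hasDerivAt_solA _).comp τ hA).const_mul
    (2 * derivWithin φ (Icc 0 T) t * (Real.sqrt (a 0 (φ t) t) / 2)) using 1
  ring

theorem width_sq {t : ℝ} (ht : t ∈ Icc 0 T) :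
    (Real.sqrt (a 0 (φ t) t) / 2) ^ 2 = a 0 (φ t) t / 4 := by
  rw [div_pow, Real.sq_sqrt (S.coeff_pos t ht).le]
  norm_num

theorem coeff_mul_speed {t : ℝ} (ht : t ∈ Icc 0 T) :
    b 0 (φ t) t * derivWithin φ (Icc 0 T) t = 6 * a 0 (φ t) t := by
  rw [S.derivWithin_phase ht, mul_div_cancel₀ _ (S.b_ne_zero _ ht)]

/-- Integration by parts; the primitive times v₀ is integrable along with its derivative, so no
boundary term appears. This converts the orthogonality condition into orthogonality of Φ to the
kernel element ∂_τ v₀. -/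
theorem integral_primitive_mul_deriv_mainTerm (hF : Sch T F) (h0 : ∀ t ∈ Icc 0 T, ∫ ξ, F t ξ = 0)
    (horth : ∀ t ∈ Icc 0 T, ∫ τ, F t τ * mainTerm (a 0) (b 0) φ C₀ t τ = 0) {t : ℝ}
    (ht : t ∈ Icc 0 T) :
    ∫ τ, (∫ ξ in Iic τ, F t ξ) * deriv (mainTerm (a 0) (b 0) φ C₀ t) τ = 0 := by
  have hΦ := hF.primitive S.pos h0
  have hv := S.sch_mainTerm
  have i1 := (hF.mul hv.temp).integrable ht
  have i2 := (hΦ.mul (hv.deriv S.pos).temp).integrable ht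
  have hd : ∀ τ, HasDerivAt (fun τ => (∫ ξ in Iic τ, F t ξ) * mainTerm (a 0) (b 0) φ C₀ t τ)
      (F t τ * mainTerm (a 0) (b 0) φ C₀ t τ
        + (∫ ξ in Iic τ, F t ξ) * deriv (mainTerm (a 0) (b 0) φ C₀ t) τ) τ := fun τ =>
    (hasDerivAt_integral_Iic (hF.contOn.slice ht) (hF.integrable ht) τ).mul
      (S.hasDerivAt_mainTerm ht τ).differentiableAt.hasDerivAt
  have h1 := integral_eq_zero_of_hasDerivAt_of_integrable hd (i1.add i2)
    ((hΦ.mul hv.temp).integrable ht)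
  rw [integral_add i1 i2, horth t ht, zero_add] at h1
  exact h1

/-- Solvability of the integrated equation in the class of rapidly decaying functions. -/
theorem exists_firstIntegral_eq (hF : Sch T F) (h0 : ∀ t ∈ Icc 0 T, ∫ ξ, F t ξ = 0)
    (horth : ∀ t ∈ Icc 0 T, ∫ τ, F t τ * mainTerm (a 0) (b 0) φ C₀ t τ = 0) :
    ∃ w, Sch T w ∧ ∀ t ∈ Icc 0 T, ∀ τ,
      firstIntegral (derivWithin φ (Icc 0 T) t) (a 0 (φ t) t) (b 0 (φ t) t)
        (mainTerm (a 0) (b 0) φ C₀ t) (w t) τ = ∫ ξ in Iic τ, F t ξ := by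
  set c : ℝ → ℝ := derivWithin φ (Icc 0 T)
  set A : ℝ → ℝ := fun t => a 0 (φ t) t
  set α : ℝ → ℝ := fun t => Real.sqrt (A t) / 2
  set Φ : ℝ → ℝ → ℝ := fun t τ => ∫ ξ in Iic τ, F t ξ
  have hα0 : ∀ t ∈ Icc 0 T, α t ≠ 0 := fun t ht => (S.width_pos ht).ne'
  have hA0 : ∀ t ∈ Icc 0 T, A t ≠ 0 := fun t ht => (S.coeff_pos t ht).ne'
  have hc0 : ∀ t ∈ Icc 0 T, c t ≠ 0 := fun t ht => S.phase_ne_zero ht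
  have hαs : ContDiffOn ℝ ∞ α (Icc 0 T) := S.contDiffOn_width
  have hΦ : Sch T Φ := hF.primitive S.pos h0
  -- In the variable y = α τ + C₀ the equation loses its dependence on t. The factor 4/(A c) comes
  -- from dividing by A c / 4, where A / 4 = α².
  set g : ℝ → ℝ → ℝ := fun t y => 4 / (A t * c t) * Φ t ((α t)⁻¹ * y + -C₀ t / α t)
  have hg : Sch T g := (temp_of_contDiffOn S.pos (contDiffOn_const.div
      (S.contDiffOn_coeff.mul S.contDiffOn_speed)
      fun t ht => mul_ne_zero (hA0 t ht) (hc0 t ht))).mul_sch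
    (hΦ.comp_affine S.pos (hαs.inv hα0) (S.smooth_shift.neg.div hαs hα0)
      fun t ht => inv_ne_zero (hα0 t ht))
  have hgα : ∀ t ∈ Icc 0 T, ∀ τ, g t (α t * τ + C₀ t) = 4 / (A t * c t) * Φ t τ := by
    intro t ht τ
    have : (α t)⁻¹ * (α t * τ + C₀ t) + -C₀ t / α t = τ := by
      field_simp [hα0 t ht]
      ring
    simp only [g, this]
  have horth' : ∀ t ∈ Icc 0 T, ∫ y, solA y * g t y = 0 := by
    intro t ht
    refine integral_comp_affine_eq_zero (hα0 t ht) (C₀ t) ?_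
    have h1 := S.integral_primitive_mul_deriv_mainTerm hF h0 horth ht
    rw [S.deriv_mainTerm ht] at h1
    have h2 : (fun τ => solA (α t * τ + C₀ t) * g t (α t * τ + C₀ t)) = fun τ =>
        (2 / (A t * c t ^ 2 * α t)) * (Φ t τ * (2 * c t * α t * solA (α t * τ + C₀ t))) := by
      funext τ
      rw [hgα t ht]
      field_simp [hα0 t ht, hA0 t ht, hc0 t ht]
      ring
    rw [h2, integral_const_mul]
    exact mul_eq_zero_of_right _ h1
  obtain ⟨hW, -, hW'⟩ := hg.varConst S.pos horth'
  set W := varConst solA solB g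
  set W' := varConst solA' solB' g
  refine ⟨fun t τ => W t (α t * τ + C₀ t), hW.comp_affine S.pos hαs S.smooth_shift hα0,
    fun t ht τ => ?_⟩
  have hAff : ∀ τ, HasDerivAt (fun τ => α t * τ + C₀ t) (α t) τ := fun τ => by
    simpa using! ((hasDerivAt_id τ).const_mul (α t)).add_const (C₀ t)
  have d1 : deriv (fun τ => W t (α t * τ + C₀ t)) = fun τ => W' t (α t * τ + C₀ t) * α t :=
    funext fun τ => ((hW' t ht _).1.comp τ (hAff τ)).deriv
  have d2 : iteratedDeriv 2 (fun τ => W t (α t * τ + C₀ t)) τ =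
      secondDeriv (α t * τ + C₀ t) (W t (α t * τ + C₀ t)) (W' t (α t * τ + C₀ t))
        (g t (α t * τ + C₀ t)) * α t * α t := by
    rw [iteratedDeriv_succ, iteratedDeriv_one, d1]
    exact (((hW' t ht _).2.comp τ (hAff τ)).mul_const (α t)).deriv
  -- The square root enters only through α² and b₀ only through b₀ c. Once both are eliminated, a
  -- rational identity in tanh y is left.
  have hsq : α t * α t = A t / 4 := by rw [← sq]; exact S.width_sq ht
  have hbc : b 0 (φ t) t * c t = 6 * A t := S.coeff_mul_speed ht
  rw [firstIntegral, d2, d1, S.deriv_mainTerm ht, S.iteratedDeriv_two_mainTerm ht, S.mainTerm_eq ht,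
    hgα t ht, S.width_sq ht]
  change _ = Φ t τ
  have hb : b 0 (φ t) t = 6 * A t / c t := by
    rw [eq_div_iff (hc0 t ht), hbc]
  have h2 : 2 - Real.tanh (α t * τ + C₀ t) ^ 2 ≠ 0 := by
    linarith [two_sub_tanh_sq_pos (α t * τ + C₀ t)]
  have e1 : ∀ s, s * α t * α t = s * (A t / 4) := fun s => by rw [mul_assoc, hsq]
  rw [hb, e1]
  have e2 : ∀ p q : ℝ, 2 * c t * α t * p * (q * α t) = 2 * c t * (A t / 4) * p * q := fun p q => by
    rw [← hsq]; ring
  change (c t - -c t * (1 - Real.tanh (α t * τ + C₀ t) ^ 2)) * _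
    - 2 * c t * α t * solA (α t * τ + C₀ t) * (W' t (α t * τ + C₀ t) * α t)
    + (-A t * c t + 6 * A t / c t * (-c t * (1 - Real.tanh (α t * τ + C₀ t) ^ 2)) ^ 2
      - 2 * c t * (A t / 4) * solA' (α t * τ + C₀ t)) * W t (α t * τ + C₀ t) = Φ t τ
  rw [e2]
  generalize α t * τ + C₀ t = y at *
  have hA := hA0 t ht
  have hc := hc0 t ht
  simp only [secondDeriv, solA, solA']
  field_simp
  ring

theorem solvesTermEq_of_firstIntegral_eq {j : ℕ} {w : ℝ → ℝ → ℝ}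
    (hv : ∀ t ∈ Icc 0 T, ∀ τ, v 0 t τ = mainTerm (a 0) (b 0) φ C₀ t τ)
    (hF : Sch T (forcing T a b φ v j)) (hw : Sch T w)
    (h : ∀ t ∈ Icc 0 T, ∀ τ,
      firstIntegral (derivWithin φ (Icc 0 T) t) (a 0 (φ t) t) (b 0 (φ t) t)
        (mainTerm (a 0) (b 0) φ C₀ t) (w t) τ = ∫ ξ in Iic τ, forcing T a b φ v j t ξ) :
    SolvesTermEq T a b φ v j w := by
  intro t ht τ
  have e : v 0 t = mainTerm (a 0) (b 0) φ C₀ t := funext (hv t ht)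
  rw [e]
  have h1 := hasDerivAt_firstIntegral (derivWithin φ (Icc 0 T) t) (a 0 (φ t) t) (b 0 (φ t) t)
    (S.sch_mainTerm.smooth.slice S.pos ht) (hw.smooth.slice S.pos ht) τ
  have h2 := hasDerivAt_integral_Iic (hF.contOn.slice ht) (hF.integrable ht) τ
  rw [← funext (h t ht)] at h2
  exact h1.unique h2

/-- A solution of the equation for a term with one-sided decay decays at both ends. -/
theorem sch_of_solves {j : ℕ} {w : ℝ → ℝ → ℝ}
    (hv : ∀ t ∈ Icc 0 T, ∀ τ, v 0 t τ = mainTerm (a 0) (b 0) φ C₀ t τ)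
    (hF : Sch T (forcing T a b φ v j)) (hlim : LimitCondition T a b φ v j)
    (hw : InGt T w) (hsol : SolvesTermEq T a b φ v j w) : Sch T w := by
  have hws := hw.smooth S.pos
  have hΦ := hF.primitive S.pos fun t ht => integral_forcing_eq_zero hF hlim ht
  obtain ⟨-, htop, gm, -, hbot⟩ := id hw
  have hvs := S.sch_mainTerm
  refine hw.sch S.pos fun t ht => ?_
  set c := derivWithin φ (Icc 0 T) t
  set V := mainTerm (a 0) (b 0) φ C₀ t
  have e : v 0 t = V := funext (hv t ht)
  -- The equation says that the first integral and Φ have the same derivative; their constant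
  -- difference is then evaluated at both ends.
  have hconst : ∀ x y : ℝ, firstIntegral c (a 0 (φ t) t) (b 0 (φ t) t) V (w t) x
      - (∫ ξ in Iic x, forcing T a b φ v j t ξ)
      = firstIntegral c (a 0 (φ t) t) (b 0 (φ t) t) V (w t) y
      - ∫ ξ in Iic y, forcing T a b φ v j t ξ := by
    have hd : ∀ τ, HasDerivAt (fun τ => firstIntegral c (a 0 (φ t) t) (b 0 (φ t) t) V (w t) τ
        - ∫ ξ in Iic τ, forcing T a b φ v j t ξ) 0 τ := by
      intro τ
      have h1 := (hasDerivAt_firstIntegral c (a 0 (φ t) t) (b 0 (φ t) t)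
        (hvs.smooth.slice S.pos ht) (hws.slice S.pos ht) τ).sub
        (hasDerivAt_integral_Iic (hF.contOn.slice ht) (hF.integrable ht) τ)
      have h2 := hsol t ht τ
      rw [e] at h2
      rw [h2, sub_self] at h1
      exact h1
    exact is_const_of_deriv_eq_zero (fun τ => (hd τ).differentiableAt) fun τ => (hd τ).deriv
  have v1 := hvs.partialTTau S.pos 0 1
  have v2 := hvs.partialTTau S.pos 0 2
  -- All derivatives of w, and v₀ with its derivatives, tend to 0; only the constant part -a₀ c of
  -- the zeroth-order coefficient survives. It is used with m = 0 at +∞ and m = `gm t` at -∞.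
  have hlimit : ∀ l : Filter ℝ, ∀ m : ℝ, Tendsto V l (𝓝 0) →
      Tendsto (partialTTau T 0 1 (mainTerm (a 0) (b 0) φ C₀) t) l (𝓝 0) →
      Tendsto (partialTTau T 0 2 (mainTerm (a 0) (b 0) φ C₀) t) l (𝓝 0) →
      Tendsto (w t) l (𝓝 m) → Tendsto (deriv (w t)) l (𝓝 0) →
      Tendsto (iteratedDeriv 2 (w t)) l (𝓝 0) →
      Tendsto (fun τ => ∫ ξ in Iic τ, forcing T a b φ v j t ξ) l (𝓝 0) →
      Tendsto (fun τ => firstIntegral c (a 0 (φ t) t) (b 0 (φ t) t) V (w t) τ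
        - ∫ ξ in Iic τ, forcing T a b φ v j t ξ) l (𝓝 (-a 0 (φ t) t * c * m)) := by
    intro l m h0 h1 h2 k0 k1 k2 k3
    have h1' : Tendsto (deriv V) l (𝓝 0) := h1.congr fun τ => by
      rw [partialTTau_zero_left, iteratedDeriv_one]
    have h2' : Tendsto (iteratedDeriv 2 V) l (𝓝 0) := h2.congr fun τ => by
      rw [partialTTau_zero_left]
    have := ((((h0.const_sub c).mul k2).sub (h1'.mul k1)).add
      (((((h0.pow 2).const_mul (b 0 (φ t) t)).const_add (-a 0 (φ t) t * c)).sub h2').mul k0)).sub k3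
    convert! this using 2
    ring
  have hT' := hlimit atTop 0 (hvs.tendsto_atTop ht) (v1.tendsto_atTop ht) (v2.tendsto_atTop ht)
    (by simpa [partialTTau_zero_left] using (htop 0 0 0).tendsto_at ht)
    (by simpa [partialTTau_zero_left, iteratedDeriv_one] using (htop 0 0 1).tendsto_at ht)
    (by simpa [partialTTau_zero_left] using (htop 0 0 2).tendsto_at ht) (hΦ.tendsto_atTop ht)
  have k0 : Tendsto (w t) atBot (𝓝 (gm t)) := by
    have := ((hbot 0 0 0).tendsto_at ht).add_const (gm t)
    simpa [partialTTau_zero_left] using this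
  have hB' := hlimit atBot (gm t) (hvs.tendsto_atBot ht) (v1.tendsto_atBot ht)
    (v2.tendsto_atBot ht) k0
    (by simpa [partialTTau_zero_left, iteratedDeriv_one] using (hbot 0 0 1).tendsto_at ht)
    (by simpa [partialTTau_zero_left, iteratedDeriv_succ'] using (hbot 0 0 2).tendsto_at ht)
    (hΦ.tendsto_atBot ht)
  rw [funext fun τ => hconst τ 0] at hT' hB'
  have h1 := tendsto_nhds_unique tendsto_const_nhds hT'
  have h2 := tendsto_nhds_unique tendsto_const_nhds hB'
  rw [h1, mul_zero] at h2
  have h3 : gm t = 0 := by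
    have hA := (S.coeff_pos t ht).ne'
    have hc : c ≠ 0 := S.phase_ne_zero ht
    simpa [hA, hc] using h2.symm
  rwa [h3] at k0

/-- All terms decay rapidly. -/
theorem sch_terms {n : ℕ} (hn : n ≤ N) (hv : AreTerms T a b φ C₀ n v)
    (hlim : ∀ j, 1 ≤ j → j ≤ n → LimitCondition T a b φ v j) : ∀ j ≤ n, Sch T (v j) := by
  intro j
  induction j using Nat.strong_induction_on with
  | _ j ih =>
    intro hj
    rcases Nat.eq_zero_or_pos j with rfl | hpos
    · exact S.sch_mainTerm.congr hv.1
    · have hF := S.sch_forcing hpos (hj.trans hn) fun l hl => ih l hl (hl.le.trans hj)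
      exact S.sch_of_solves hv.1 hF (hlim j hpos hj) (hv.2 j hpos hj).1 (hv.2 j hpos hj).2

theorem exists_next_term {n : ℕ} (hn : n < N) (hv : AreTerms T a b φ C₀ n v)
    (h : ∀ j, 1 ≤ j → j ≤ n + 1 → Orthogonality T a b φ v j ∧ LimitCondition T a b φ v j) :
    ∃ w, InGt0 T w ∧ SolvesTermEq T a b φ v (n + 1) w := by
  have hs := S.sch_terms hn.le hv fun j h1 hj => (h j h1 (by omega)).2
  have hF := S.sch_forcing (v := v) (j := n + 1) (by omega) hn fun l hl => hs l (by omega)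
  obtain ⟨ho, hl⟩ := h (n + 1) (by omega) le_rfl
  obtain ⟨w, hw, hw'⟩ := S.exists_firstIntegral_eq hF
    (fun t ht => integral_forcing_eq_zero hF hl ht) (fun t ht => by
      rw [← ho t ht]
      simp only [hv.1 t ht])
  exact ⟨w, hw.inGt0 S.pos, S.solvesTermEq_of_firstIntegral_eq hv.1 hF hw hw'⟩

end Setting

/-! ### Taylor remainder on a bounded interval -/

section Taylor

/-- Induction on `n`: the remainder of h has as derivative the remainder of h' one order lower, and
it vanishes at y, so the mean value inequality on the segment applies. The factor 1/n! is given up.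
-/
theorem taylor_remainder_bound (n : ℕ) {h : ℝ → ℝ} (hh : ContDiff ℝ ∞ h) {R C : ℝ}
    (hC : ∀ x, |x| ≤ R → |iteratedDeriv n h x| ≤ C) {x y : ℝ} (hx : |x| ≤ R) (hy : |y| ≤ R) :
    |h x - ∑ i ∈ Finset.range n, (x - y) ^ i / (i.factorial : ℝ) * iteratedDeriv i h y|
      ≤ C * |x - y| ^ n := by
  induction n generalizing h x with
  | zero => simpa using hC x hx
  | succ n ih =>
    have hd : ContDiff ℝ ∞ (deriv h) := (contDiff_infty_iff_deriv.1 hh).2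
    have hder : ∀ ξ, HasDerivAt (fun ξ => h ξ - ∑ i ∈ Finset.range (n + 1),
        (ξ - y) ^ i / (i.factorial : ℝ) * iteratedDeriv i h y)
        (deriv h ξ - ∑ i ∈ Finset.range n, (ξ - y) ^ i / (i.factorial : ℝ) *
          iteratedDeriv i (deriv h) y) ξ := by
      intro ξ
      have h1 := ((contDiff_infty_iff_deriv.1 hh).1 ξ).hasDerivAt
      refine h1.sub ?_
      have h2 : HasDerivAt (fun ξ => ∑ i ∈ Finset.range n,
          (ξ - y) ^ (i + 1) / ((i + 1).factorial : ℝ) * iteratedDeriv (i + 1) h y)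
          (∑ i ∈ Finset.range n, (ξ - y) ^ i / (i.factorial : ℝ) *
          iteratedDeriv i (deriv h) y) ξ := by
        refine HasDerivAt.fun_sum fun i _ => ?_
        have h3 := (((((hasDerivAt_id ξ).sub_const y).pow (i + 1)).div_const
          ((i + 1).factorial : ℝ)).mul_const (iteratedDeriv (i + 1) h y))
        convert! h3 using 1
        rw [iteratedDeriv_succ', Nat.factorial_succ]
        have : (i.factorial : ℝ) ≠ 0 := by positivity
        have : (i : ℝ) + 1 ≠ 0 := by positivity
        push_cast
        simp only [id]
        field_simp
      refine (h2.add_const (iteratedDeriv 0 h y)).congr_of_eventuallyEq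
        (Eventually.of_forall fun ξ => ?_)
      simp only [Finset.sum_range_succ', pow_zero, Nat.factorial_zero, Nat.cast_one, div_one,
        one_mul]
    have hmvt := Convex.norm_image_sub_le_of_norm_hasDerivWithin_le (s := uIcc y x)
      (C := C * |x - y| ^ n) (fun ξ _ => (hder ξ).hasDerivWithinAt) (fun ξ hξ => ?_)
      (convex_uIcc y x) left_mem_uIcc right_mem_uIcc
    · have h0 : h y - ∑ i ∈ Finset.range (n + 1), (y - y) ^ i / (i.factorial : ℝ) *
          iteratedDeriv i h y = 0 := by
        simp [Finset.sum_range_succ']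
      rw [h0, sub_zero, mul_assoc, ← Real.norm_eq_abs (x - y), ← pow_succ] at hmvt
      exact hmvt
    · have hξR : |ξ| ≤ R := by
        have : uIcc y x ⊆ Icc (-R) R := (ordConnected_Icc).uIcc_subset (abs_le.1 hy) (abs_le.1 hx)
        exact abs_le.2 (this hξ)
      have h1 := ih hd (fun z hz => by rw [← iteratedDeriv_succ']; exact hC z hz) hξR
      have hC0 : 0 ≤ C := (abs_nonneg _).trans (hC y hy)
      refine h1.trans ?_
      gcongr ?_ * ?_ ^ n
      exact abs_sub_left_of_mem_uIcc hξ

end Taylor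

/-! ### Formal expansion of the coefficients near the curve -/

section Expansion

variable {T : ℝ} {N : ℕ} {c : ℕ → ℝ → ℝ → ℝ} {cε : ℝ → ℝ → ℝ → ℝ} {φ : ℝ → ℝ}

/-- The expansion coefficients collect the Taylor polynomials of the `c k` of order `N - k`. -/
theorem sum_coeffExpansion (c : ℕ → ℝ → ℝ → ℝ) (φ : ℝ → ℝ) (N : ℕ) (ε t τ : ℝ) :
    ∑ m ∈ Finset.range (N + 1), ε ^ m * coeffExpansion c φ m t τ
      = ∑ k ∈ Finset.range (N + 1), ε ^ k * ∑ i ∈ Finset.range (N + 1 - k),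
        (ε * τ) ^ i / (i.factorial : ℝ) * iteratedDeriv i (fun x => c k x t) (φ t) := by
  simp only [coeffExpansion, Finset.mul_sum]
  rw [Finset.sum_sigma', Finset.sum_sigma']
  refine Finset.sum_bij' (fun p _ => ⟨p.2.1, p.2.2⟩) (fun p _ => ⟨p.1 + p.2, (p.1, p.2)⟩)
    ?_ ?_ ?_ ?_ ?_
  · rintro ⟨m, p⟩ h
    simp only [Finset.mem_sigma, Finset.mem_range, Finset.HasAntidiagonal.mem_antidiagonal] at h ⊢
    omega
  · rintro ⟨m, p⟩ h
    simp only [Finset.mem_sigma, Finset.mem_range, Finset.HasAntidiagonal.mem_antidiagonal] at h ⊢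
    exact ⟨by omega, trivial⟩
  · rintro ⟨m, p⟩ h
    simp only [Finset.mem_sigma, Finset.mem_range, Finset.HasAntidiagonal.mem_antidiagonal] at h
    obtain ⟨-, rfl⟩ := h
    rfl
  · rintro ⟨m, p⟩ h
    rfl
  · rintro ⟨m, p⟩ h
    simp only [Finset.mem_sigma, Finset.mem_range, Finset.HasAntidiagonal.mem_antidiagonal] at h
    obtain ⟨-, rfl⟩ := h
    simp only [pow_add, mul_pow]
    ring

theorem exists_radius {K : Set (ℝ × ℝ)} (hK : IsCompact K) (hφ : ContinuousOn φ (Icc 0 T)) :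
    ∃ R, 0 ≤ R ∧ (∀ z ∈ K, |z.1| ≤ R) ∧ ∀ t ∈ Icc 0 T, |φ t| ≤ R := by
  obtain ⟨R₁, h1⟩ := hK.exists_bound_of_continuousOn (f := Prod.fst) continuousOn_fst
  obtain ⟨R₂, h2⟩ := isCompact_Icc.exists_bound_of_continuousOn hφ
  exact ⟨max 0 (max R₁ R₂), le_max_left _ _,
    fun z hz => (h1 z hz).trans ((le_max_left _ _).trans (le_max_right _ _)),
    fun t ht => (h2 t ht).trans ((le_max_right _ _).trans (le_max_right _ _))⟩

theorem exists_bound_iteratedDeriv (hT : 0 < T)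
    (hc : ∀ k ≤ N, ContDiffOn ℝ ∞ (fun z : ℝ × ℝ => c k z.1 z.2) (strip T)) (i : ℕ → ℕ) (R : ℝ) :
    ∃ C, 0 ≤ C ∧ ∀ k ≤ N, ∀ t ∈ Icc 0 T, ∀ x, |x| ≤ R →
      |iteratedDeriv (i k) (fun x => c k x t) x| ≤ C := by
  have h : ∀ k, ∃ C, k ≤ N → ∀ t ∈ Icc 0 T, ∀ x, |x| ≤ R →
      |iteratedDeriv (i k) (fun x => c k x t) x| ≤ C := by
    intro k
    by_cases hk : k ≤ N
    · have hs := ((smooth_swap hT (hc k hk)).partialTTau hT 0 (i k) 0).1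
      obtain ⟨C, hC⟩ := ((isCompact_Icc (a := (0 : ℝ)) (b := T)).prod
        (isCompact_Icc (a := -R) (b := R))).exists_bound_of_continuousOn
          (hs.mono (prod_mono subset_rfl (subset_univ _)))
      refine ⟨C, fun _ t ht x hx => ?_⟩
      have := hC (t, x) ⟨ht, abs_le.1 hx⟩
      simpa only [partialTTau_zero_left, Real.norm_eq_abs] using this
    · exact ⟨0, fun h => absurd h hk⟩
  choose C hC using h
  refine ⟨∑ k ∈ Finset.range (N + 1), |C k|, Finset.sum_nonneg fun _ _ => abs_nonneg _,
    fun k hk t ht x hx => (hC k hk t ht x hx).trans ((le_abs_self _).trans ?_)⟩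
  exact Finset.single_le_sum (f := fun k => |C k|) (fun _ _ => abs_nonneg _)
    (Finset.mem_range.2 (by omega))

/-- A coefficient function differs from its formal expansion by `O(ε^(N+1))`, up to a power of
the fast variable. -/
theorem expansion_error (hT : 0 < T)
    (hc : ∀ k ≤ N, ContDiffOn ℝ ∞ (fun z : ℝ × ℝ => c k z.1 z.2) (strip T))
    (hcε : IsBigOEps T (N + 1)
      (fun x t ε => cε x t ε - ∑ k ∈ Finset.range (N + 1), ε ^ k * c k x t))
    (hφ : ContinuousOn φ (Icc 0 T)) {K : Set (ℝ × ℝ)} (hK : IsCompact K) (hKT : K ⊆ strip T) :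
    ∃ C, 0 ≤ C ∧ ∃ ε₀ > 0, ∀ ε ∈ Ioo 0 ε₀, ∀ z ∈ K,
      |cε z.1 z.2 ε - ∑ m ∈ Finset.range (N + 1),
        ε ^ m * coeffExpansion c φ m z.2 ((z.1 - φ z.2) / ε)|
        ≤ C * ε ^ (N + 1) * (1 + |(z.1 - φ z.2) / ε|) ^ (N + 1) := by
  obtain ⟨C, hC, ε₀, hε₀, hb⟩ := hcε K hK hKT
  obtain ⟨R, hR0, hRK, hRφ⟩ := exists_radius hK hφ
  -- `c k` is expanded up to order N - k, so its remainder (ε τ)^(N+1-k) and the prefactor ε^k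
  -- together give ε^(N+1).
  obtain ⟨D, hD0, hD⟩ := exists_bound_iteratedDeriv hT hc (fun k => N + 1 - k) R
  refine ⟨C + (N + 1) * D, by positivity, ε₀, hε₀, fun ε hε z hz => ?_⟩
  obtain ⟨x, t⟩ := z
  have ht : t ∈ Icc 0 T := (hKT hz).2
  have hε0 : 0 < ε := hε.1
  simp only
  set τ := (x - φ t) / ε
  have hτ : ε * τ = x - φ t := mul_div_cancel₀ _ hε0.ne'
  have h1 := hb ε hε (x, t) hz
  simp only at h1
  have hτ1 : 1 ≤ 1 + |τ| := by linarith [abs_nonneg τ]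
  have h2 : |∑ k ∈ Finset.range (N + 1), ε ^ k * c k x t - ∑ m ∈ Finset.range (N + 1),
        ε ^ m * coeffExpansion c φ m t τ| ≤ (N + 1) * (D * (ε ^ (N + 1) * (1 + |τ|) ^ (N + 1))) := by
    rw [sum_coeffExpansion, ← Finset.sum_sub_distrib]
    refine (Finset.abs_sum_le_sum_abs _ _).trans ?_
    refine (Finset.sum_le_card_nsmul _ _ (D * (ε ^ (N + 1) * (1 + |τ|) ^ (N + 1)))
      fun k hk => ?_).trans_eq (by simp)
    have hk' : k ≤ N := Nat.lt_succ_iff.1 (Finset.mem_range.1 hk)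
    rw [← mul_sub, abs_mul, abs_pow, abs_of_pos hε0, hτ]
    have h3 := taylor_remainder_bound (N + 1 - k) ((smooth_swap hT (hc k hk')).slice hT ht)
      (fun x hx => hD k hk' t ht x hx) (hRK _ hz) (hRφ t ht)
    simp only at h3
    calc ε ^ k * |c k x t - ∑ i ∈ Finset.range (N + 1 - k), (x - φ t) ^ i / (i.factorial : ℝ) *
          iteratedDeriv i (fun x => c k x t) (φ t)|
        ≤ ε ^ k * (D * |x - φ t| ^ (N + 1 - k)) := by gcongr
      _ = D * (ε ^ (k + (N + 1 - k)) * |τ| ^ (N + 1 - k)) := by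
          rw [← hτ, abs_mul, abs_of_pos hε0, mul_pow, pow_add]
          ring
      _ ≤ D * (ε ^ (k + (N + 1 - k)) * (1 + |τ|) ^ (N + 1)) := by
          gcongr ?_ * (?_ * ?_)
          calc |τ| ^ (N + 1 - k) ≤ (1 + |τ|) ^ (N + 1 - k) := by gcongr; linarith
            _ ≤ (1 + |τ|) ^ (N + 1) := pow_le_pow_right₀ hτ1 (by omega)
      _ = _ := by rw [Nat.add_sub_of_le (by omega : k ≤ N + 1)]
  have h3 := abs_sub_le (cε x t ε) (∑ k ∈ Finset.range (N + 1), ε ^ k * c k x t)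
    (∑ m ∈ Finset.range (N + 1), ε ^ m * coeffExpansion c φ m t τ)
  have h4 : C * ε ^ (N + 1) ≤ C * ε ^ (N + 1) * (1 + |τ|) ^ (N + 1) :=
    le_mul_of_one_le_right (by positivity) (one_le_pow₀ hτ1)
  linarith

/-- Used for large |τ|, where boundedness of the coefficients suffices because the phase sums
provide all the smallness. -/
theorem coefficient_bounded (hT : 0 < T)
    (hc : ∀ k ≤ N, ContDiffOn ℝ ∞ (fun z : ℝ × ℝ => c k z.1 z.2) (strip T))
    (hcε : IsBigOEps T (N + 1)
      (fun x t ε => cε x t ε - ∑ k ∈ Finset.range (N + 1), ε ^ k * c k x t))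
    {K : Set (ℝ × ℝ)} (hK : IsCompact K) (hKT : K ⊆ strip T) :
    ∃ C, 0 ≤ C ∧ ∃ ε₀ > 0, ∀ ε ∈ Ioo 0 ε₀, ∀ z ∈ K, |cε z.1 z.2 ε| ≤ C := by
  obtain ⟨C, hC, ε₀, hε₀, hb⟩ := hcε K hK hKT
  obtain ⟨R, hR⟩ := hK.exists_bound_of_continuousOn (f := Prod.fst) continuousOn_fst
  obtain ⟨D, hD0, hD⟩ := exists_bound_iteratedDeriv hT hc (fun _ => 0) R
  refine ⟨C + (N + 1) * D, by positivity, min ε₀ 1, by positivity, fun ε hε z hz => ?_⟩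
  have hε1 : ε ≤ 1 := hε.2.le.trans (min_le_right _ _)
  have hε0 : 0 < ε := hε.1
  have h1 := hb ε ⟨hε.1, hε.2.trans_le (min_le_left _ _)⟩ z hz
  have h2 : |∑ k ∈ Finset.range (N + 1), ε ^ k * c k z.1 z.2| ≤ (N + 1) * D := by
    refine (Finset.abs_sum_le_sum_abs _ _).trans
      ((Finset.sum_le_card_nsmul _ _ D fun k hk => ?_).trans_eq (by simp))
    have h3 := hD k (Nat.lt_succ_iff.1 (Finset.mem_range.1 hk)) z.2 (hKT hz).2 z.1 (hR z hz)
    rw [iteratedDeriv_zero] at h3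
    rw [abs_mul, abs_pow, abs_of_pos hε0]
    exact (mul_le_of_le_one_left (abs_nonneg _) (pow_le_one₀ hε0.le hε1)).trans h3
  have h3 : C * ε ^ (N + 1) ≤ C := mul_le_of_le_one_right hC.le (pow_le_one₀ hε0.le hε1)
  have h4 := abs_add_le (cε z.1 z.2 ε - ∑ k ∈ Finset.range (N + 1), ε ^ k * c k z.1 z.2)
    (∑ k ∈ Finset.range (N + 1), ε ^ k * c k z.1 z.2)
  rw [sub_add_cancel] at h4
  linarith

end Expansion

/-! ### Cauchy products -/

section Convolution

/-- The Cauchy product of two sequences. -/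
def conv (f g : ℕ → ℝ) (n : ℕ) : ℝ :=
  ∑ p ∈ Finset.HasAntidiagonal.antidiagonal n, f p.1 * g p.2

theorem conv_congr {f g f' g' : ℕ → ℝ} {n : ℕ} (hf : ∀ l ≤ n, f l = f' l)
    (hg : ∀ l ≤ n, g l = g' l) : conv f g n = conv f' g' n :=
  Finset.sum_congr rfl fun p hp => by
    have := Finset.HasAntidiagonal.mem_antidiagonal.1 hp
    rw [hf _ (by omega), hg _ (by omega)]

/-- The two extreme summands are singled out, as only they involve an entry of index n + 1. -/
theorem conv_succ_eq (f g : ℕ → ℝ) (n : ℕ) : conv f g (n + 1) =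
    ∑ k ∈ Finset.range n, f (k + 1) * g (n - k) + f 0 * g (n + 1) + f (n + 1) * g 0 := by
  rw [conv, Finset.Nat.sum_antidiagonal_eq_sum_range_succ_mk, Finset.sum_range_succ,
    Finset.sum_range_succ']
  simp only [Nat.add_sub_add_right, Nat.sub_zero, Nat.sub_self]

/-- The effect on the Cauchy product of changing the last entries of both sequences. -/
theorem conv_eq_add {f g f' g' : ℕ → ℝ} {n : ℕ} (hf : ∀ l ≤ n, f l = f' l)
    (hg : ∀ l ≤ n, g l = g' l) : conv f g (n + 1) = conv f' g' (n + 1)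
      + (f (n + 1) - f' (n + 1)) * g 0 + f 0 * (g (n + 1) - g' (n + 1)) := by
  have h : ∑ k ∈ Finset.range n, f (k + 1) * g (n - k)
      = ∑ k ∈ Finset.range n, f' (k + 1) * g' (n - k) :=
    Finset.sum_congr rfl fun k hk => by
      have := Finset.mem_range.1 hk
      rw [hf _ (by omega), hg _ (by omega)]
  rw [conv_succ_eq, conv_succ_eq, h, ← hf 0 (Nat.zero_le _), ← hg 0 (Nat.zero_le _)]
  ring

theorem conv_zero_index (f g : ℕ → ℝ) : conv f g 0 = f 0 * g 0 := by simp [conv]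

open Polynomial in
theorem coeff_mul_eq_conv {P Q : ℝ[X]} {f g : ℕ → ℝ} {N : ℕ} (hP : ∀ l ≤ N, P.coeff l = f l)
    (hQ : ∀ l ≤ N, Q.coeff l = g l) : ∀ l ≤ N, (P * Q).coeff l = conv f g l := fun l hl => by
  rw [Polynomial.coeff_mul]
  exact conv_congr (fun m hm => hP m (hm.trans hl)) fun m hm => hQ m (hm.trans hl)

end Convolution

/-! ### Vanishing of the coefficients of the expansion -/

section OrderCoefficients

variable {T : ℝ} {N : ℕ} {a b : ℕ → ℝ → ℝ → ℝ} {φ C₀ : ℝ → ℝ} {v : ℕ → ℝ → ℝ → ℝ}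

theorem orderCoeff_eq_conv (T : ℝ) (a b : ℕ → ℝ → ℝ → ℝ) (φ : ℝ → ℝ) (v : ℕ → ℝ → ℝ → ℝ)
    (n : ℕ) (t τ : ℝ) : orderCoeff T a b φ v n t τ =
      conv (fun m => coeffExpansion a φ m t τ) (fun l => partialTTau T 1 0 (v l) t τ) n
      - derivWithin φ (Icc 0 T) t *
        conv (fun m => coeffExpansion a φ m t τ) (fun l => partialTTau T 0 1 (v l) t τ) (n + 1)
      - partialTTau T 1 2 (v n) t τ
      + derivWithin φ (Icc 0 T) t * partialTTau T 0 3 (v (n + 1)) t τ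
      + conv (fun m => coeffExpansion b φ m t τ) (conv (fun l => v l t τ)
          (conv (fun l => v l t τ) (fun l => partialTTau T 0 1 (v l) t τ))) (n + 1)
      - 2 * conv (fun l => partialTTau T 0 1 (v l) t τ)
          (fun l => partialTTau T 0 2 (v l) t τ) (n + 1)
      - conv (fun l => v l t τ) (fun l => partialTTau T 0 3 (v l) t τ) (n + 1) := by
  simp only [orderCoeff, conv, Finset.mul_sum, mul_assoc]

theorem coeffExpansion_zero (c : ℕ → ℝ → ℝ → ℝ) (φ : ℝ → ℝ) (t τ : ℝ) :
    coeffExpansion c φ 0 t τ = c 0 (φ t) t := by simp [coeffExpansion]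

/-- The equation for a term says that the corresponding coefficient of the expansion vanishes. -/
theorem orderCoeff_eq_zero {n : ℕ} {t : ℝ} (ht : t ∈ Icc 0 T) (h0 : ContDiff ℝ ∞ (v 0 t))
    (h1 : ContDiff ℝ ∞ (v (n + 1) t)) (h : SolvesTermEq T a b φ v (n + 1) (v (n + 1))) (τ : ℝ) :
    orderCoeff T a b φ v n t τ = 0 := by
  have hs := h t ht τ
  obtain ⟨v', hdef⟩ : ∃ v' : ℕ → ℝ → ℝ → ℝ, v' = fun l => if l < n + 1 then v l else fun _ _ => 0 :=
    ⟨_, rfl⟩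
  rw [forcing, Nat.add_sub_cancel, ← hdef, orderCoeff_eq_conv] at hs
  rw [orderCoeff_eq_conv]
  have hv' : ∀ l ≤ n, v l = v' l := fun l hl => by
    simp only [hdef, if_pos (Nat.lt_succ_of_le hl)]
  have hvz : v' (n + 1) = fun _ _ => 0 := by simp only [hdef, lt_irrefl, if_false]
  have hpz : ∀ k, partialTTau T 0 k (v' (n + 1)) t τ = 0 := fun k => by
    rw [hvz, partialTTau_zero_left, iteratedDeriv_const]
    simp
  have eA : ∀ p q, ∀ l ≤ n, partialTTau T p q (v l) t τ = partialTTau T p q (v' l) t τ :=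
    fun p q l hl => by rw [hv' l hl]
  have eV : ∀ l ≤ n, v l t τ = v' l t τ := fun l hl => by rw [hv' l hl]
  have eIn : ∀ l ≤ n, conv (fun l => v l t τ) (fun l => partialTTau T 0 1 (v l) t τ) l
      = conv (fun l => v' l t τ) (fun l => partialTTau T 0 1 (v' l) t τ) l := fun l hl =>
    conv_congr (fun m hm => eV m (hm.trans hl)) fun m hm => eA 0 1 m (hm.trans hl)
  have eMid : ∀ l ≤ n, conv (fun l => v l t τ) (conv (fun l => v l t τ)
        (fun l => partialTTau T 0 1 (v l) t τ)) l
      = conv (fun l => v' l t τ) (conv (fun l => v' l t τ)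
        (fun l => partialTTau T 0 1 (v' l) t τ)) l := fun l hl =>
    conv_congr (fun m hm => eV m (hm.trans hl)) fun m hm => eIn m (hm.trans hl)
  -- `v` and its truncation `v'` agree up to index `n`, so they differ only where `v (n + 1)` is
  -- paired with entries of index 0. These contributions add up to the linear operator; in the cubic
  -- term three of them make ∂_τ(v₀² v_{n+1}).
  rw [conv_congr (f' := fun m => coeffExpansion a φ m t τ) (fun _ _ => rfl) (eA 1 0),
    conv_eq_add (f' := fun m => coeffExpansion a φ m t τ) (fun _ _ => rfl) (eA 0 1),
    eA 1 2 n le_rfl,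
    conv_eq_add (f' := fun m => coeffExpansion b φ m t τ) (fun _ _ => rfl) eMid,
    conv_eq_add eV eIn, conv_eq_add eV (eA 0 1), conv_eq_add (eA 0 1) (eA 0 2),
    conv_eq_add eV (eA 0 3)]
  simp only [hpz] at hs ⊢
  simp only [conv_zero_index, coeffExpansion_zero, hvz, partialTTau_zero_left] at hs ⊢
  have v0 := hasDerivAt_iteratedDeriv h0 0 τ
  have v1 := hasDerivAt_iteratedDeriv h0 1 τ
  have w0 := hasDerivAt_iteratedDeriv h1 0 τ
  have w1 := hasDerivAt_iteratedDeriv h1 1 τ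
  simp only [iteratedDeriv_zero, iteratedDeriv_one, zero_add, Nat.reduceAdd] at v0 v1 w0 w1
  have e1 : deriv (fun σ => v 0 t σ ^ 2 * v (n + 1) t σ) τ = _ := ((v0.pow 2).mul w0).deriv
  have e2 : deriv (fun σ => deriv (v 0 t) σ * deriv (v (n + 1) t) σ) τ = _ := (v1.mul w1).deriv
  rw [e1, e2] at hs
  simp only [iteratedDeriv_one, Pi.pow_apply, Nat.cast_ofNat] at hs ⊢
  linear_combination hs

/-- This is the travelling-wave equation of v₀. With a₀ = 4 α² and b₀ = 24 α² / c it becomes a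
rational identity in tanh. -/
theorem Setting.leadingCoeff_eq_zero (S : Setting T N a b φ C₀) {t : ℝ} (ht : t ∈ Icc 0 T)
    (τ : ℝ) :
    -(derivWithin φ (Icc 0 T) t * (a 0 (φ t) t * deriv (mainTerm (a 0) (b 0) φ C₀ t) τ))
      + derivWithin φ (Icc 0 T) t * iteratedDeriv 3 (mainTerm (a 0) (b 0) φ C₀ t) τ
      + b 0 (φ t) t * (mainTerm (a 0) (b 0) φ C₀ t τ * (mainTerm (a 0) (b 0) φ C₀ t τ *
        deriv (mainTerm (a 0) (b 0) φ C₀ t) τ))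
      - 2 * (deriv (mainTerm (a 0) (b 0) φ C₀ t) τ * iteratedDeriv 2 (mainTerm (a 0) (b 0) φ C₀ t) τ)
      - mainTerm (a 0) (b 0) φ C₀ t τ * iteratedDeriv 3 (mainTerm (a 0) (b 0) φ C₀ t) τ = 0 := by
  have h3 : iteratedDeriv 3 (mainTerm (a 0) (b 0) φ C₀ t) τ =
      2 * derivWithin φ (Icc 0 T) t * (Real.sqrt (a 0 (φ t) t) / 2) ^ 3 *
        secondDeriv (Real.sqrt (a 0 (φ t) t) / 2 * τ + C₀ t)
          (solA (Real.sqrt (a 0 (φ t) t) / 2 * τ + C₀ t))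
          (solA' (Real.sqrt (a 0 (φ t) t) / 2 * τ + C₀ t)) 0 := by
    have hA : HasDerivAt (fun τ => Real.sqrt (a 0 (φ t) t) / 2 * τ + C₀ t)
        (Real.sqrt (a 0 (φ t) t) / 2) τ := by
      simpa using! ((hasDerivAt_id τ).const_mul (Real.sqrt (a 0 (φ t) t) / 2)).add_const (C₀ t)
    rw [iteratedDeriv_succ, funext (S.iteratedDeriv_two_mainTerm ht)]
    refine HasDerivAt.deriv ?_
    convert! ((hasDerivAt_solA' _).comp τ hA).const_mul
      (2 * derivWithin φ (Icc 0 T) t * (Real.sqrt (a 0 (φ t) t) / 2) ^ 2) using 1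
    ring
  rw [h3, S.iteratedDeriv_two_mainTerm ht, S.deriv_mainTerm ht, S.mainTerm_eq ht]
  have hsq := S.width_sq ht
  have hbc := S.coeff_mul_speed ht
  have hc := S.phase_ne_zero ht
  simp only
  generalize Real.sqrt (a 0 (φ t) t) / 2 * τ + C₀ t = y
  generalize Real.sqrt (a 0 (φ t) t) / 2 = α at *
  generalize derivWithin φ (Icc 0 T) t = c at *
  have hA : a 0 (φ t) t = 4 * α ^ 2 := by linarith
  have hB : b 0 (φ t) t = 24 * α ^ 2 / c := by
    rw [eq_div_iff hc, hbc, hA]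
    ring
  have h2 : 2 - Real.tanh y ^ 2 ≠ 0 := by linarith [two_sub_tanh_sq_pos y]
  rw [hA, hB]
  simp only [secondDeriv, solA, solA']
  field_simp
  ring

end OrderCoefficients

/-! ### Polynomials in `ε` with coefficients depending on `t` and `τ` -/

section PolynomialFamilies

open Polynomial

variable {T : ℝ} {P Q R : (ℝ → ℝ → ℝ) → Prop} {p q : ℝ → ℝ → ℝ[X]}

/-- A family of polynomials of bounded degree whose coefficients satisfy `P`. -/
def PolyFamily (P : (ℝ → ℝ → ℝ) → Prop) (p : ℝ → ℝ → ℝ[X]) : Prop :=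
  (∃ d : ℕ, ∀ t τ, (p t τ).natDegree ≤ d) ∧ ∀ m, P fun t τ => (p t τ).coeff m

/-- The polynomial `∑_{m ≤ N} f m X^m`. -/
def truncPoly (N : ℕ) (f : ℕ → ℝ) : ℝ[X] := ∑ m ∈ Finset.range (N + 1), C (f m) * X ^ m

theorem coeff_truncPoly (N : ℕ) (f : ℕ → ℝ) (m : ℕ) :
    (truncPoly N f).coeff m = if m ≤ N then f m else 0 := by
  simp only [truncPoly, finsetSum_coeff, coeff_C_mul_X_pow, Finset.sum_ite_eq, Finset.mem_range,
    Nat.lt_succ_iff]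

theorem coeff_truncPoly_of_le {N : ℕ} (f : ℕ → ℝ) {m : ℕ} (h : m ≤ N) :
    (truncPoly N f).coeff m = f m := by rw [coeff_truncPoly, if_pos h]

theorem eval_truncPoly (N : ℕ) (f : ℕ → ℝ) (ε : ℝ) :
    (truncPoly N f).eval ε = ∑ m ∈ Finset.range (N + 1), ε ^ m * f m := by
  simp only [truncPoly, eval_finsetSum, eval_mul, eval_C, eval_pow, eval_X]
  exact Finset.sum_congr rfl fun m _ => mul_comm _ _

theorem natDegree_truncPoly_le (N : ℕ) (f : ℕ → ℝ) : (truncPoly N f).natDegree ≤ N := by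
  refine natDegree_le_iff_coeff_eq_zero.2 fun m hm => ?_
  rw [coeff_truncPoly, if_neg (by omega)]

theorem polyFamily_truncPoly {N : ℕ} {f : ℕ → ℝ → ℝ → ℝ} (h0 : P fun _ _ => 0)
    (hf : ∀ m ≤ N, P (f m)) : PolyFamily P fun t τ => truncPoly N fun m => f m t τ := by
  refine ⟨⟨N, fun t τ => natDegree_truncPoly_le _ _⟩, fun m => ?_⟩
  simp only [coeff_truncPoly]
  split_ifs with h
  · exact hf m h
  · exact h0

theorem PolyFamily.add (hP : ∀ f g, P f → P g → P (fun t y => f t y + g t y))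
    (hp : PolyFamily P p) (hq : PolyFamily P q) : PolyFamily P fun t τ => p t τ + q t τ := by
  obtain ⟨⟨d, hd⟩, h⟩ := hp
  obtain ⟨⟨e, he⟩, h'⟩ := hq
  refine ⟨⟨max d e, fun t τ => (natDegree_add_le _ _).trans (max_le_max (hd t τ) (he t τ))⟩,
    fun m => ?_⟩
  simp only [coeff_add]
  exact hP _ _ (h m) (h' m)

theorem PolyFamily.mul (h0 : R fun _ _ => 0)
    (hPQ : ∀ f g, P f → Q g → R (fun t y => f t y * g t y))
    (hR : ∀ f g, R f → R g → R (fun t y => f t y + g t y))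
    (hp : PolyFamily P p) (hq : PolyFamily Q q) : PolyFamily R fun t τ => p t τ * q t τ := by
  obtain ⟨⟨d, hd⟩, h⟩ := hp
  obtain ⟨⟨e, he⟩, h'⟩ := hq
  refine ⟨⟨d + e, fun t τ => natDegree_mul_le.trans (add_le_add (hd t τ) (he t τ))⟩, fun m => ?_⟩
  simp only [coeff_mul]
  induction Finset.HasAntidiagonal.antidiagonal m using Finset.induction_on with
  | empty => simpa using h0
  | insert i s hi ih =>
    simp only [Finset.sum_insert hi]
    exact hR _ _ (hPQ _ _ (h _) (h' _)) ih

theorem PolyFamily.mono (hPQ : ∀ f, P f → Q f) (hp : PolyFamily P p) : PolyFamily Q p :=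
  ⟨hp.1, fun m => hPQ _ (hp.2 m)⟩

theorem polyFamily_const {f : ℝ → ℝ → ℝ} (h0 : P fun _ _ => 0) (hf : P f) :
    PolyFamily P fun t τ => C (f t τ) := by
  refine ⟨⟨0, fun t τ => (natDegree_C _).le⟩, fun m => ?_⟩
  simp only [coeff_C]
  split_ifs
  exacts [hf, h0]

theorem polyFamily_X (h0 : P fun _ _ => 0) (h1 : P fun _ _ => 1) :
    PolyFamily P fun _ _ => (X : ℝ[X]) := by
  refine ⟨⟨1, fun t τ => natDegree_X.le⟩, fun m => ?_⟩
  simp only [coeff_X]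
  split_ifs
  exacts [h1, h0]

/-- A family with bounded coefficients divisible by `X^(N+1)` is `O(ε^(N+1))`. -/
theorem PolyFamily.eval_bound (hp : PolyFamily (Rapid T) p) (N : ℕ)
    (h : ∀ t ∈ Icc 0 T, ∀ τ, ∀ m ≤ N, (p t τ).coeff m = 0) :
    ∃ K, 0 ≤ K ∧ ∀ t ∈ Icc 0 T, ∀ τ, ∀ ε ∈ Ioo (0 : ℝ) 1, |(p t τ).eval ε| ≤ K * ε ^ (N + 1) := by
  obtain ⟨⟨d, hd⟩, hc⟩ := hp
  choose K hK0 hK using fun m => (hc m).bounded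
  refine ⟨∑ m ∈ Finset.range (d + 1), K m, Finset.sum_nonneg fun m _ => hK0 m,
    fun t ht τ ε hε => ?_⟩
  rw [eval_eq_sum_range' (Nat.lt_succ_of_le (hd t τ)), Finset.sum_mul]
  refine (Finset.abs_sum_le_sum_abs _ _).trans (Finset.sum_le_sum fun m _ => ?_)
  have hε0 := hε.1
  by_cases hm : m ≤ N
  · rw [h t ht τ m hm, zero_mul, abs_zero]
    have := hK0 m
    positivity
  · rw [abs_mul, abs_pow, abs_of_pos hε0]
    exact mul_le_mul (hK m t ht τ) (pow_le_pow_of_le_one hε0.le hε.2.le (by omega))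
      (by positivity) (hK0 m)

/-- The polynomial in `ε` obtained from `ε` times the left-hand side of the equation when all
functions are replaced by their truncated expansions. -/
def residualPoly (N : ℕ) (c : ℝ) (A B V D₁ D₂ D₃ E₀ E₂ : ℕ → ℝ) : ℝ[X] :=
  X * (truncPoly N A * truncPoly N E₀) + C (-c) * (truncPoly N A * truncPoly N D₁)
    + C (-1) * (X * truncPoly N E₂) + C c * truncPoly N D₃
    + truncPoly N B * (truncPoly N V * (truncPoly N V * truncPoly N D₁))
    + C (-2) * (truncPoly N D₁ * truncPoly N D₂) + C (-1) * (truncPoly N V * truncPoly N D₃)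

theorem coeff_residualPoly_zero (N : ℕ) (c : ℝ) (A B V D₁ D₂ D₃ E₀ E₂ : ℕ → ℝ) :
    (residualPoly N c A B V D₁ D₂ D₃ E₀ E₂).coeff 0 =
      -(c * (A 0 * D₁ 0)) + c * D₃ 0 + B 0 * (V 0 * (V 0 * D₁ 0)) - 2 * (D₁ 0 * D₂ 0)
        - V 0 * D₃ 0 := by
  have h : ∀ f, (truncPoly N f).coeff 0 = f 0 := fun f => coeff_truncPoly_of_le f (Nat.zero_le N)
  simp only [residualPoly, coeff_add, mul_coeff_zero, coeff_C_zero, coeff_X_zero, h]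
  ring

/-- Time derivatives at fixed τ carry no factor 1/ε; after multiplication by ε they bring the factor
`X`, hence the index n where the other terms have n + 1. The outcome matches `orderCoeff` of order
n. -/
theorem coeff_residualPoly_succ {N n : ℕ} (hn : n + 1 ≤ N) (c : ℝ)
    (A B V D₁ D₂ D₃ E₀ E₂ : ℕ → ℝ) :
    (residualPoly N c A B V D₁ D₂ D₃ E₀ E₂).coeff (n + 1) =
      conv A E₀ n - c * conv A D₁ (n + 1) - E₂ n + c * D₃ (n + 1)
        + conv B (conv V (conv V D₁)) (n + 1) - 2 * conv D₁ D₂ (n + 1) - conv V D₃ (n + 1) := by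
  have h : ∀ f, ∀ m ≤ N, (truncPoly N f).coeff m = f m := fun f m hm => coeff_truncPoly_of_le f hm
  simp only [residualPoly, coeff_add, coeff_C_mul, coeff_X_mul]
  rw [coeff_mul_eq_conv (h A) (h E₀) n (by omega), coeff_mul_eq_conv (h A) (h D₁) _ hn,
    h E₂ n (by omega), h D₃ _ hn, coeff_mul_eq_conv (h B)
      (coeff_mul_eq_conv (h V) (coeff_mul_eq_conv (h V) (h D₁))) _ hn,
    coeff_mul_eq_conv (h D₁) (h D₂) _ hn, coeff_mul_eq_conv (h V) (h D₃) _ hn]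
  ring

end PolynomialFamilies

/-! ### Sums of functions of the fast variable -/

section PhaseSum

variable {T : ℝ} {N : ℕ} {φ : ℝ → ℝ} {h ht' hy' : ℕ → ℝ → ℝ → ℝ}

/-- `∑_{j ≤ N} ε^j h_j(t, (x - φ(t)) / ε)`. -/
def phaseSum (φ : ℝ → ℝ) (N : ℕ) (h : ℕ → ℝ → ℝ → ℝ) (x t ε : ℝ) : ℝ :=
  ∑ j ∈ Finset.range (N + 1), ε ^ j * h j t ((x - φ t) / ε)

theorem hasDerivAt_phaseSum (hp : ∀ j ≤ N, HasPartials T (h j) (ht' j) (hy' j)) {t : ℝ}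
    (ht : t ∈ Icc 0 T) (x ε : ℝ) :
    HasDerivAt (fun y => phaseSum φ N h y t ε) (phaseSum φ N hy' x t ε / ε) x := by
  have hA : HasDerivAt (fun y => (y - φ t) / ε) (1 / ε) x :=
    ((hasDerivAt_id x).sub_const (φ t)).div_const ε
  have e : phaseSum φ N hy' x t ε / ε = ∑ j ∈ Finset.range (N + 1),
      ε ^ j * (hy' j t ((x - φ t) / ε) * (1 / ε)) := by
    rw [phaseSum, Finset.sum_div]
    exact Finset.sum_congr rfl fun j _ => by ring
  rw [e]
  refine HasDerivAt.fun_sum fun j hj => ?_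
  exact (((hp j (Nat.lt_succ_iff.1 (Finset.mem_range.1 hj)) t ht _).2).comp x hA).const_mul (ε ^ j)

theorem hasDerivWithinAt_phaseSum (hp : ∀ j ≤ N, HasPartials T (h j) (ht' j) (hy' j))
    (hct : ∀ j ≤ N, ContOn T (ht' j)) (hcy : ∀ j ≤ N, ContOn T (hy' j))
    (hφ : DifferentiableOn ℝ φ (Icc 0 T)) {t : ℝ} (ht : t ∈ Icc 0 T) (x ε : ℝ) :
    HasDerivWithinAt (fun s => phaseSum φ N h x s ε)
      (phaseSum φ N ht' x t ε - derivWithin φ (Icc 0 T) t / ε * phaseSum φ N hy' x t ε)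
      (Icc 0 T) t := by
  have hA : HasDerivWithinAt (fun s => (s, (x - φ s) / ε))
      ((1 : ℝ), -derivWithin φ (Icc 0 T) t / ε) (Icc 0 T) t :=
    (hasDerivWithinAt_id t _).prodMk (((hφ t ht).hasDerivWithinAt.const_sub x).div_const ε)
  have e : phaseSum φ N ht' x t ε - derivWithin φ (Icc 0 T) t / ε * phaseSum φ N hy' x t ε
      = ∑ j ∈ Finset.range (N + 1), ε ^ j * (ht' j t ((x - φ t) / ε)
        + hy' j t ((x - φ t) / ε) * (-derivWithin φ (Icc 0 T) t / ε)) := by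
    rw [phaseSum, phaseSum, Finset.mul_sum, ← Finset.sum_sub_distrib]
    exact Finset.sum_congr rfl fun j _ => by ring
  rw [e]
  refine HasDerivWithinAt.fun_sum fun j hj => ?_
  have hj' := Nat.lt_succ_iff.1 (Finset.mem_range.1 hj)
  have hF := (hp j hj').hasFDerivWithinAt (hct j hj') (hcy j hj') (z := (t, (x - φ t) / ε))
    ⟨ht, mem_univ _⟩
  have := (HasFDerivWithinAt.comp_hasDerivWithinAt t hF hA fun s hs =>
    mk_mem_prod hs (mem_univ _)).const_mul (ε ^ j)
  simpa using! this

theorem contDiffOn_phaseSum (hs : ∀ j ≤ N, Smooth T (h j)) (hT : 0 < T)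
    (hφ : ContDiffOn ℝ ∞ φ (Icc 0 T)) (ε : ℝ) :
    ContDiffOn ℝ ∞ (fun z : ℝ × ℝ => phaseSum φ N h z.1 z.2 ε) (strip T) := by
  refine ContDiffOn.sum fun j hj => contDiffOn_const.mul ?_
  have hφ' : ContDiffOn ℝ ∞ (fun z : ℝ × ℝ => φ z.2) (strip T) :=
    hφ.comp contDiffOn_snd fun z hz => hz.2
  exact ((hs j (Nat.lt_succ_iff.1 (Finset.mem_range.1 hj))).contDiffOn hT).comp
    (f := fun z : ℝ × ℝ => (z.2, (z.1 - φ z.2) / ε))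
    (contDiffOn_snd.prodMk ((contDiffOn_fst.sub hφ').div_const ε)) fun z hz => ⟨hz.2, mem_univ _⟩

theorem exists_phaseSum_bound (hr : ∀ j ≤ N, Rapid T (h j)) (n : ℕ) :
    ∃ C, 0 ≤ C ∧ ∀ ε ∈ Ioo (0 : ℝ) 1, ∀ t ∈ Icc 0 T, ∀ x,
      (1 + |(x - φ t) / ε|) ^ n * |phaseSum φ N h x t ε| ≤ C := by
  have hj : ∀ j, ∃ C, j ≤ N → ∀ t ∈ Icc 0 T, ∀ y, (1 + |y|) ^ n * |h j t y| ≤ C := by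
    intro j
    by_cases hj : j ≤ N
    · obtain ⟨C, hC⟩ := hr j hj n
      exact ⟨C, fun _ => hC⟩
    · exact ⟨0, fun h => absurd h hj⟩
  choose C hC using hj
  refine ⟨∑ j ∈ Finset.range (N + 1), |C j|, Finset.sum_nonneg fun _ _ => abs_nonneg _,
    fun ε hε t ht x => ?_⟩
  calc (1 + |(x - φ t) / ε|) ^ n * |phaseSum φ N h x t ε|
      ≤ (1 + |(x - φ t) / ε|) ^ n * ∑ j ∈ Finset.range (N + 1),
          |ε ^ j * h j t ((x - φ t) / ε)| := by
        gcongr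
        exact Finset.abs_sum_le_sum_abs _ _
    _ ≤ ∑ j ∈ Finset.range (N + 1), |C j| := by
        rw [Finset.mul_sum]
        refine Finset.sum_le_sum fun j hj => ?_
        refine le_trans ?_ ((hC j (Nat.lt_succ_iff.1 (Finset.mem_range.1 hj)) t ht
          ((x - φ t) / ε)).trans (le_abs_self _))
        rw [abs_mul, abs_pow, abs_of_pos hε.1]
        gcongr
        exact mul_le_of_le_one_left (abs_nonneg _) (pow_le_one₀ hε.1.le hε.2.le)

theorem exists_phaseSum_far_bound (hr : ∀ j ≤ N, Rapid T (h j)) {κ : ℝ} (hκ : 0 < κ) (M : ℕ) :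
    ∃ C, 0 ≤ C ∧ ∀ ε ∈ Ioo (0 : ℝ) 1, ∀ t ∈ Icc 0 T, ∀ x,
      ε ^ (-κ) ≤ |(x - φ t) / ε| → |phaseSum φ N h x t ε| ≤ C * ε ^ M := by
  -- With κ n ≥ M the weight (1 + |τ|)^n is at least ε^(-κ n) ≥ ε^(-M).
  obtain ⟨n, hn⟩ := exists_nat_ge (M / κ)
  rw [div_le_iff₀ hκ] at hn
  obtain ⟨C, hC0, hC⟩ := exists_phaseSum_bound (φ := φ) hr n
  refine ⟨C, hC0, fun ε hε t ht x hx => ?_⟩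
  have hε0 := hε.1
  have h1 : (ε ^ M)⁻¹ ≤ (1 + |(x - φ t) / ε|) ^ n := by
    calc (ε ^ M)⁻¹ = ε ^ (-(M : ℝ)) := by rw [Real.rpow_neg hε0.le, Real.rpow_natCast]
      _ ≤ ε ^ (-κ * n) := Real.rpow_le_rpow_of_exponent_ge hε0 hε.2.le (by linarith)
      _ = (ε ^ (-κ)) ^ n := by rw [Real.rpow_mul hε0.le, Real.rpow_natCast]
      _ ≤ (1 + |(x - φ t) / ε|) ^ n := by
        have : 0 ≤ ε ^ (-κ) := Real.rpow_nonneg hε0.le _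
        gcongr
        linarith
  have h2 : (ε ^ M)⁻¹ * |phaseSum φ N h x t ε| ≤ C :=
    (mul_le_mul_of_nonneg_right h1 (abs_nonneg _)).trans (hC ε hε t ht x)
  rwa [inv_mul_le_iff₀ (by positivity), mul_comm] at h2

end PhaseSum

/-! ### Accuracy of the approximation -/

section Residual

variable {T : ℝ} {N : ℕ} {a b : ℕ → ℝ → ℝ → ℝ} {φ C₀ : ℝ → ℝ} {v : ℕ → ℝ → ℝ → ℝ}
  {aε bε : ℝ → ℝ → ℝ → ℝ}

theorem iteratedDeriv_phaseSum (hT : 0 < T) (hv : ∀ j ≤ N, Sch T (v j)) (k : ℕ) {t : ℝ}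
    (ht : t ∈ Icc 0 T) (ε : ℝ) :
    iteratedDeriv k (fun y => phaseSum φ N v y t ε) =
      fun x => phaseSum φ N (fun j => partialTTau T 0 k (v j)) x t ε / ε ^ k := by
  induction k with
  | zero =>
    funext x
    simp only [iteratedDeriv_zero, pow_zero, div_one, phaseSum, partialTTau_zero_left]
  | succ k ih =>
    funext x
    rw [iteratedDeriv_succ, ih]
    have := (hasDerivAt_phaseSum (φ := φ) (fun j hj =>
      (hv j hj).smooth.hasPartials_partialTTau hT 0 k) ht x ε).div_const (ε ^ k)
    rw [this.deriv, div_div, ← pow_succ']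

/-- Each x-derivative costs 1/ε, and ∂_t acts as ∂_t - (φ'/ε) ∂_τ. Against the prefactors ε² at most
one power of 1/ε is left, which the factor ε on the left clears. -/
theorem residual_eq (hT : 0 < T) (hφ : ContDiffOn ℝ ∞ φ (Icc 0 T)) (hv : ∀ j ≤ N, Sch T (v j))
    {t : ℝ} (ht : t ∈ Icc 0 T) {ε : ℝ} (hε : 0 < ε) (x : ℝ) :
    ε * residual T aε bε (approx φ (prolong v) N) x t ε =
      aε x t ε * (ε * phaseSum φ N (fun j => partialTTau T 1 0 (v j)) x t ε
        - derivWithin φ (Icc 0 T) t * phaseSum φ N (fun j => partialTTau T 0 1 (v j)) x t ε)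
      - ε * phaseSum φ N (fun j => partialTTau T 1 2 (v j)) x t ε
      + derivWithin φ (Icc 0 T) t * phaseSum φ N (fun j => partialTTau T 0 3 (v j)) x t ε
      + bε x t ε * (phaseSum φ N v x t ε ^ 2 *
          phaseSum φ N (fun j => partialTTau T 0 1 (v j)) x t ε)
      - 2 * (phaseSum φ N (fun j => partialTTau T 0 1 (v j)) x t ε *
          phaseSum φ N (fun j => partialTTau T 0 2 (v j)) x t ε)
      - phaseSum φ N v x t ε * phaseSum φ N (fun j => partialTTau T 0 3 (v j)) x t ε := by
  have hφd : DifferentiableOn ℝ φ (Icc 0 T) := hφ.differentiableOn (by simp)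
  have hu := uniqueDiffOn_Icc hT t ht
  have hcont : ∀ p q, ∀ j ≤ N, ContOn T (partialTTau T p q (v j)) := fun p q j hj =>
    ((hv j hj).partialTTau hT p q).contOn
  have ht1 : derivWithin (fun s => phaseSum φ N v x s ε) (Icc 0 T) t = _ :=
    ((hasDerivWithinAt_phaseSum (h := fun j => partialTTau T 0 0 (v j)) (fun j hj =>
      (hv j hj).smooth.hasPartials_partialTTau hT 0 0) (hcont 1 0) (hcont 0 1) hφd ht x ε).congr
      (fun s _ => by simp only [phaseSum, partialTTau_zero_left, iteratedDeriv_zero])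
      (by simp only [phaseSum, partialTTau_zero_left, iteratedDeriv_zero])).derivWithin hu
  have ht2 : derivWithin (fun s => iteratedDeriv 2 (fun y => phaseSum φ N v y s ε) x)
      (Icc 0 T) t = _ :=
    (((hasDerivWithinAt_phaseSum (fun j hj =>
      (hv j hj).smooth.hasPartials_partialTTau hT 0 2) (hcont 1 2) (hcont 0 3) hφd ht x
      ε).div_const (ε ^ 2)).congr
      (fun s hs => by rw [iteratedDeriv_phaseSum hT hv 2 hs])
      (by rw [iteratedDeriv_phaseSum hT hv 2 ht])).derivWithin hu
  have hx1 : deriv (fun y => phaseSum φ N v y t ε) x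
      = phaseSum φ N (fun j => partialTTau T 0 1 (v j)) x t ε / ε := by
    rw [← iteratedDeriv_one, iteratedDeriv_phaseSum hT hv 1 ht, pow_one]
  change ε * residual T aε bε (phaseSum φ N v) x t ε = _
  rw [residual, ht1, ht2, hx1, iteratedDeriv_phaseSum hT hv 2 ht,
    iteratedDeriv_phaseSum hT hv 3 ht]
  field_simp
  ring

namespace Setting

variable (S : Setting T N a b φ C₀)
include S

theorem exists_residualPoly_bound (hv : AreTerms T a b φ C₀ N v) (hs : ∀ j ≤ N, Sch T (v j)) :
    ∃ K, 0 ≤ K ∧ ∀ t ∈ Icc 0 T, ∀ τ, ∀ ε ∈ Ioo (0 : ℝ) 1,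
      |(residualPoly N (derivWithin φ (Icc 0 T) t) (fun m => coeffExpansion a φ m t τ)
        (fun m => coeffExpansion b φ m t τ) (fun j => v j t τ)
        (fun j => partialTTau T 0 1 (v j) t τ) (fun j => partialTTau T 0 2 (v j) t τ)
        (fun j => partialTTau T 0 3 (v j) t τ) (fun j => partialTTau T 1 0 (v j) t τ)
        (fun j => partialTTau T 1 2 (v j) t τ)).eval ε| ≤ K * ε ^ (N + 1) := by
  have hA := polyFamily_truncPoly (P := Moderate T) (f := coeffExpansion a φ) (moderate_const 0)
    fun m hm => (temp_coeffExpansion S.pos S.smooth_a S.contDiffOn_phase hm).moderate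
  have hB := polyFamily_truncPoly (P := Moderate T) (f := coeffExpansion b φ) (moderate_const 0)
    fun m hm => (temp_coeffExpansion S.pos S.smooth_b S.contDiffOn_phase hm).moderate
  have hV := polyFamily_truncPoly (P := Rapid T) rapid_zero fun j hj => (hs j hj).rapid
  have hD := fun p q => polyFamily_truncPoly (P := Rapid T) rapid_zero fun j hj =>
    ((hs j hj).partialTTau S.pos p q).rapid
  have hc : Moderate T fun t _ => derivWithin φ (Icc 0 T) t :=
    moderate_of_contDiffOn S.contDiffOn_speed
  have hc' : Moderate T fun t _ => -derivWithin φ (Icc 0 T) t :=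
    moderate_of_contDiffOn S.contDiffOn_speed.neg
  have hmul : ∀ {p q : ℝ → ℝ → Polynomial ℝ}, PolyFamily (Moderate T) p → PolyFamily (Rapid T) q →
      PolyFamily (Rapid T) fun t τ => p t τ * q t τ := fun hp hq =>
    PolyFamily.mul rapid_zero (fun f g hf hg => (hg.mul hf).congr fun _ _ _ => mul_comm _ _)
      (fun _ _ => Rapid.add) hp hq
  have hmod : ∀ {p : ℝ → ℝ → Polynomial ℝ}, PolyFamily (Rapid T) p → PolyFamily (Moderate T) p :=
    fun hp => hp.mono fun _ => Rapid.moderate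
  have hadd : ∀ f g, Rapid T f → Rapid T g → Rapid T fun t y => f t y + g t y :=
    fun _ _ => Rapid.add
  have hX := polyFamily_X (P := Moderate T) (moderate_const 0) (moderate_const 1)
  have hC : ∀ r : ℝ, PolyFamily (Moderate T) fun _ _ => Polynomial.C r := fun r =>
    polyFamily_const (moderate_const 0) (moderate_const r)
  refine PolyFamily.eval_bound (T := T) ?_ N fun t ht τ m hm => ?_
  -- Each summand has a rapidly decaying factor; so the coefficients are bounded in τ even though
  -- those of the expansions of a and b grow.
  · exact (((((((hmul hX (hmul hA (hD 1 0))).add hadd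
      (hmul (polyFamily_const (moderate_const 0) hc') (hmul hA (hD 0 1)))).add hadd
      (hmul (hC (-1)) (hmul hX (hD 1 2)))).add hadd
      (hmul (polyFamily_const (moderate_const 0) hc) (hD 0 3))).add hadd
      (hmul hB (hmul (hmod hV) (hmul (hmod hV) (hD 0 1))))).add hadd
      (hmul (hC (-2)) (hmul (hmod (hD 0 1)) (hD 0 2)))).add hadd
      (hmul (hC (-1)) (hmul (hmod hV) (hD 0 3))))
  · rcases m with _ | n
    · rw [coeff_residualPoly_zero]
      have e : v 0 t = mainTerm (a 0) (b 0) φ C₀ t := funext (hv.1 t ht)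
      simp only [coeffExpansion_zero, partialTTau_zero_left, iteratedDeriv_one, e]
      exact S.leadingCoeff_eq_zero ht τ
    · rw [coeff_residualPoly_succ hm, ← orderCoeff_eq_conv]
      exact orderCoeff_eq_zero ht ((hs 0 (Nat.zero_le N)).smooth.slice S.pos ht)
        ((hs _ hm).smooth.slice S.pos ht) (hv.2 (n + 1) (by omega) hm).2 τ

theorem residual_isBigO (hv : AreTerms T a b φ C₀ N v) (hs : ∀ j ≤ N, Sch T (v j))
    (haε : IsBigOEps T (N + 1)
      (fun x t ε => aε x t ε - ∑ k ∈ Finset.range (N + 1), ε ^ k * a k x t))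
    (hbε : IsBigOEps T (N + 1)
      (fun x t ε => bε x t ε - ∑ k ∈ Finset.range (N + 1), ε ^ k * b k x t)) :
    IsBigOEps T N (residual T aε bε (approx φ (prolong v) N)) := by
  intro K hK hKT
  have hφc := S.contDiffOn_phase.continuousOn
  obtain ⟨Ca, hCa, εa, hεa, ha⟩ := expansion_error S.pos S.smooth_a haε hφc hK hKT
  obtain ⟨Cb, hCb, εb, hεb, hb⟩ := expansion_error S.pos S.smooth_b hbε hφc hK hKT
  obtain ⟨Q, hQ0, hQ⟩ := S.exists_residualPoly_bound hv hs
  obtain ⟨M, hM0, hM⟩ := bounded_of_contDiffOn S.contDiffOn_speed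
  obtain ⟨D, hD0, hD⟩ := exists_phaseSum_bound (φ := φ) (fun j hj => (hs j hj).rapid) 0
  -- The weight N + 1 matches the growth allowed in `expansion_error`.
  obtain ⟨D₁, hD₁0, hD₁⟩ := exists_phaseSum_bound (φ := φ)
    (fun j hj => ((hs j hj).partialTTau S.pos 0 1).rapid) (N + 1)
  obtain ⟨E, hE0, hE⟩ := exists_phaseSum_bound (φ := φ)
    (fun j hj => ((hs j hj).partialTTau S.pos 1 0).rapid) (N + 1)
  refine ⟨Ca * (E + M * D₁) + Cb * (D ^ 2 * D₁) + Q + 1, by positivity,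
    min (min εa εb) 1, by positivity, fun ε hε z hz => ?_⟩
  have hε0 : 0 < ε := hε.1
  have hε1 : ε ∈ Ioo (0 : ℝ) 1 := ⟨hε0, hε.2.trans_le (min_le_right _ _)⟩
  have ha' := ha ε ⟨hε0, hε.2.trans_le ((min_le_left _ _).trans (min_le_left _ _))⟩ z hz
  have hb' := hb ε ⟨hε0, hε.2.trans_le ((min_le_left _ _).trans (min_le_right _ _))⟩ z hz
  obtain ⟨x, t⟩ := z
  have ht : t ∈ Icc 0 T := (hKT hz).2
  have hQ' := hQ t ht ((x - φ t) / ε) ε hε1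
  have hM' := hM t ht
  have hD' := hD ε hε1 t ht x
  have hD₁' := hD₁ ε hε1 t ht x
  have hE' := hE ε hε1 t ht x
  have hres := residual_eq (aε := aε) (bε := bε) S.pos S.contDiffOn_phase hs ht hε0 x
  simp only [residualPoly, Polynomial.eval_add, Polynomial.eval_mul, Polynomial.eval_X,
    Polynomial.eval_C, eval_truncPoly] at hQ'
  simp only [pow_zero, one_mul] at hD'
  simp only at ha' hb' ⊢
  -- The evaluated truncations of the derivative sequences are, by definition, phase sums at τ = (x
  -- - φ(t))/ε.
  change |ε * (_ * phaseSum φ N (fun j => partialTTau T 1 0 (v j)) x t ε)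
    + -derivWithin φ (Icc 0 T) t * (_ * phaseSum φ N (fun j => partialTTau T 0 1 (v j)) x t ε)
    + -1 * (ε * phaseSum φ N (fun j => partialTTau T 1 2 (v j)) x t ε)
    + derivWithin φ (Icc 0 T) t * phaseSum φ N (fun j => partialTTau T 0 3 (v j)) x t ε
    + _ * (phaseSum φ N v x t ε * (phaseSum φ N v x t ε *
        phaseSum φ N (fun j => partialTTau T 0 1 (v j)) x t ε))
    + -2 * (phaseSum φ N (fun j => partialTTau T 0 1 (v j)) x t ε *
        phaseSum φ N (fun j => partialTTau T 0 2 (v j)) x t ε)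
    + -1 * (phaseSum φ N v x t ε * phaseSum φ N (fun j => partialTTau T 0 3 (v j)) x t ε)| ≤ _
    at hQ'
  generalize phaseSum φ N (fun j => partialTTau T 1 0 (v j)) x t ε = X10 at *
  generalize phaseSum φ N (fun j => partialTTau T 0 1 (v j)) x t ε = X01 at *
  generalize phaseSum φ N (fun j => partialTTau T 1 2 (v j)) x t ε = X12 at *
  generalize phaseSum φ N (fun j => partialTTau T 0 3 (v j)) x t ε = X03 at *
  generalize phaseSum φ N (fun j => partialTTau T 0 2 (v j)) x t ε = X02 at *
  generalize phaseSum φ N v x t ε = X00 at *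
  generalize ∑ m ∈ Finset.range (N + 1), ε ^ m * coeffExpansion a φ m t ((x - φ t) / ε) = A at *
  generalize ∑ m ∈ Finset.range (N + 1), ε ^ m * coeffExpansion b φ m t ((x - φ t) / ε) = B at *
  generalize residual T aε bε (approx φ (prolong v) N) x t ε = r at *
  generalize derivWithin φ (Icc 0 T) t = c at *
  generalize aε x t ε = α at *
  generalize bε x t ε = β at *
  have hw0 : 0 ≤ (1 + |(x - φ t) / ε|) ^ (N + 1) := by positivity
  generalize (1 + |(x - φ t) / ε|) ^ (N + 1) = w at *
  have e1 : |(α - A) * (ε * X10 - c * X01)| ≤ Ca * (E + M * D₁) * ε ^ (N + 1) := by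
    have h1 : |ε * X10 - c * X01| ≤ |X10| + M * |X01| := by
      refine (abs_sub _ _).trans ?_
      rw [abs_mul, abs_mul, abs_of_pos hε0]
      exact add_le_add (mul_le_of_le_one_left (abs_nonneg _) hε1.2.le) (by gcongr)
    rw [abs_mul]
    calc |α - A| * |ε * X10 - c * X01| ≤ (Ca * ε ^ (N + 1) * w) * (|X10| + M * |X01|) :=
          mul_le_mul ha' h1 (abs_nonneg _) ((abs_nonneg _).trans ha')
      _ = Ca * ε ^ (N + 1) * (w * |X10| + M * (w * |X01|)) := by ring
      _ ≤ Ca * ε ^ (N + 1) * (E + M * D₁) := by gcongr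
      _ = _ := by ring
  have e2 : |(β - B) * (X00 ^ 2 * X01)| ≤ Cb * (D ^ 2 * D₁) * ε ^ (N + 1) := by
    rw [abs_mul, abs_mul, abs_pow]
    calc |β - B| * (|X00| ^ 2 * |X01|) ≤ (Cb * ε ^ (N + 1) * w) * (|X00| ^ 2 * |X01|) := by gcongr
      _ = Cb * ε ^ (N + 1) * (|X00| ^ 2 * (w * |X01|)) := by ring
      _ ≤ Cb * ε ^ (N + 1) * (D ^ 2 * D₁) := by gcongr
      _ = _ := by ring
  -- ε times the residual is the polynomial part plus the errors from replacing the two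
  -- coefficients. Cancelling ε afterwards lowers the order from N + 1 to N.
  have e3 : |ε * r| ≤ (Ca * (E + M * D₁) + Cb * (D ^ 2 * D₁) + Q) * ε ^ (N + 1) := by
    rw [hres]
    calc _ = |(α - A) * (ε * X10 - c * X01) + (β - B) * (X00 ^ 2 * X01) + _| :=
          congrArg abs (by ring)
      _ ≤ _ := abs_add_three _ _ _
      _ ≤ _ := add_le_add (add_le_add e1 e2) hQ'
      _ = _ := by ring
  rw [abs_mul, abs_of_pos hε0, pow_succ' ε N, mul_left_comm] at e3
  have h1 := le_of_mul_le_mul_left e3 hε0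
  have h2 : 0 < ε ^ N := by positivity
  linarith

theorem residual_isBigO_atInfinity (hs : ∀ j ≤ N, Sch T (v j))
    (haε : IsBigOEps T (N + 1)
      (fun x t ε => aε x t ε - ∑ k ∈ Finset.range (N + 1), ε ^ k * a k x t))
    (hbε : IsBigOEps T (N + 1)
      (fun x t ε => bε x t ε - ∑ k ∈ Finset.range (N + 1), ε ^ k * b k x t)) :
    IsBigOEpsAtInfinity T φ (N + 1) (residual T aε bε (approx φ (prolong v) N)) := by
  intro κ hκ K hK hKT
  obtain ⟨Ca, hCa, εa, hεa, ha⟩ := coefficient_bounded S.pos S.smooth_a haε hK hKT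
  obtain ⟨Cb, hCb, εb, hεb, hb⟩ := coefficient_bounded S.pos S.smooth_b hbε hK hKT
  obtain ⟨M, hM0, hM⟩ := bounded_of_contDiffOn S.contDiffOn_speed
  -- Order N + 2 is requested because one power of ε is cancelled at the end.
  have hfar := fun p q => exists_phaseSum_far_bound (φ := φ)
    (fun j hj => ((hs j hj).partialTTau S.pos p q).rapid) hκ (N + 2)
  obtain ⟨D, hD0, hD⟩ := exists_phaseSum_far_bound (φ := φ) (fun j hj => (hs j hj).rapid) hκ (N + 2)
  obtain ⟨D₁, hD₁0, hD₁⟩ := hfar 0 1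
  obtain ⟨D₂, hD₂0, hD₂⟩ := hfar 0 2
  obtain ⟨D₃, hD₃0, hD₃⟩ := hfar 0 3
  obtain ⟨E, hE0, hE⟩ := hfar 1 0
  obtain ⟨E₂, hE₂0, hE₂⟩ := hfar 1 2
  set L := Ca * (E + M * D₁) + E₂ + M * D₃ + Cb * (D ^ 2 * D₁) + 2 * (D₁ * D₂) + D * D₃
  have hL : 0 ≤ L := by positivity
  refine ⟨L + 1, by positivity, min (min εa εb) 1, by positivity, fun ε hε z hz hκz => ?_⟩
  have hε0 : 0 < ε := hε.1
  have hε1 : ε ∈ Ioo (0 : ℝ) 1 := ⟨hε0, hε.2.trans_le (min_le_right _ _)⟩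
  have ha' := ha ε ⟨hε0, hε.2.trans_le ((min_le_left _ _).trans (min_le_left _ _))⟩ z hz
  have hb' := hb ε ⟨hε0, hε.2.trans_le ((min_le_left _ _).trans (min_le_right _ _))⟩ z hz
  obtain ⟨x, t⟩ := z
  have ht : t ∈ Icc 0 T := (hKT hz).2
  have hM' := hM t ht
  have hD' := hD ε hε1 t ht x hκz
  have hD₁' := hD₁ ε hε1 t ht x hκz
  have hD₂' := hD₂ ε hε1 t ht x hκz
  have hD₃' := hD₃ ε hε1 t ht x hκz
  have hE' := hE ε hε1 t ht x hκz
  have hE₂' := hE₂ ε hε1 t ht x hκz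
  have hres := residual_eq (aε := aε) (bε := bε) S.pos S.contDiffOn_phase hs ht hε0 x
  simp only at ha' hb' ⊢
  generalize phaseSum φ N (fun j => partialTTau T 1 0 (v j)) x t ε = X10 at *
  generalize phaseSum φ N (fun j => partialTTau T 0 1 (v j)) x t ε = X01 at *
  generalize phaseSum φ N (fun j => partialTTau T 1 2 (v j)) x t ε = X12 at *
  generalize phaseSum φ N (fun j => partialTTau T 0 3 (v j)) x t ε = X03 at *
  generalize phaseSum φ N (fun j => partialTTau T 0 2 (v j)) x t ε = X02 at *
  generalize phaseSum φ N v x t ε = X00 at *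
  generalize residual T aε bε (approx φ (prolong v) N) x t ε = r at *
  generalize derivWithin φ (Icc 0 T) t = c at *
  generalize aε x t ε = α at *
  generalize bε x t ε = β at *
  have hδ0 : 0 ≤ ε ^ (N + 2) := by positivity
  have hδ1 : ε ^ (N + 2) ≤ 1 := pow_le_one₀ hε0.le hε1.2.le
  have hsucc : ε ^ (N + 2) = ε * ε ^ (N + 1) := pow_succ' _ _
  generalize ε ^ (N + 2) = δ at *
  -- In a product of phase sums one factor supplies δ; the others need only be bounded.
  have small : ∀ {X Y : ℝ}, |X| ≤ Y * δ → 0 ≤ Y → |X| ≤ Y := fun h hY =>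
    h.trans (mul_le_of_le_one_right hY hδ1)
  have s0 := small hD' hD0
  have s1 := small hD₁' hD₁0
  have t1 : |α * (ε * X10 - c * X01)| ≤ Ca * (E + M * D₁) * δ := by
    rw [abs_mul, mul_assoc]
    refine mul_le_mul ha' ((abs_sub _ _).trans ?_) (abs_nonneg _) hCa
    rw [abs_mul, abs_mul, abs_of_pos hε0, add_mul, mul_assoc]
    exact add_le_add ((mul_le_of_le_one_left (abs_nonneg _) hε1.2.le).trans hE')
      (mul_le_mul hM' hD₁' (abs_nonneg _) hM0)
  have t2 : |ε * X12| ≤ E₂ * δ := by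
    rw [abs_mul, abs_of_pos hε0]
    exact (mul_le_of_le_one_left (abs_nonneg _) hε1.2.le).trans hE₂'
  have t3 : |c * X03| ≤ M * D₃ * δ := by
    rw [abs_mul, mul_assoc]
    exact mul_le_mul hM' hD₃' (abs_nonneg _) hM0
  have t4 : |β * (X00 ^ 2 * X01)| ≤ Cb * (D ^ 2 * D₁) * δ := by
    rw [abs_mul, abs_mul, abs_pow]
    calc |β| * (|X00| ^ 2 * |X01|) ≤ Cb * (D ^ 2 * (D₁ * δ)) := by gcongr
      _ = _ := by ring
  have t5 : |2 * (X01 * X02)| ≤ 2 * (D₁ * D₂) * δ := by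
    rw [abs_mul, abs_mul, abs_two]
    calc 2 * (|X01| * |X02|) ≤ 2 * (D₁ * (D₂ * δ)) := by gcongr
      _ = _ := by ring
  have t6 : |X00 * X03| ≤ D * D₃ * δ := by
    rw [abs_mul]
    calc |X00| * |X03| ≤ D * (D₃ * δ) := by gcongr
      _ = _ := by ring
  have hfin : |ε * r| ≤ L * δ := by
    rw [hres]
    have h5 := abs_sub (α * (ε * X10 - c * X01) - ε * X12 + c * X03 + β * (X00 ^ 2 * X01)
      - 2 * (X01 * X02)) (X00 * X03)
    have h4 := abs_sub (α * (ε * X10 - c * X01) - ε * X12 + c * X03 + β * (X00 ^ 2 * X01))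
      (2 * (X01 * X02))
    have h3 := abs_add_le (α * (ε * X10 - c * X01) - ε * X12 + c * X03) (β * (X00 ^ 2 * X01))
    have h2 := abs_add_le (α * (ε * X10 - c * X01) - ε * X12) (c * X03)
    have h1 := abs_sub (α * (ε * X10 - c * X01)) (ε * X12)
    simp only [L]
    linarith
  rw [abs_mul, abs_of_pos hε0, hsucc, mul_left_comm] at hfin
  have h1 : |r| ≤ L * ε ^ (N + 1) := le_of_mul_le_mul_left hfin hε0
  have h2 : 0 < ε ^ (N + 1) := by positivity
  linarith

theorem isSolitonLike (hv : AreTerms T a b φ C₀ N v) (hs : ∀ j ≤ N, Sch T (v j)) :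
    IsSolitonLike T N φ (fun _ _ _ => 0) (prolong v) (approx φ (prolong v) N) := by
  refine ⟨S.contDiffOn_phase, fun _ _ => contDiffOn_const,
    (hs 0 (Nat.zero_le N)).inG0 S.pos, ?_, fun j _ hj => ((hs j hj).inG0 S.pos).1, ?_⟩
  · have h0 : (0 : ℝ) ∈ Icc 0 T := ⟨le_rfl, S.pos.le⟩
    refine ⟨0, 0, h0, 0, ?_⟩
    rw [prolong, hv.1 0 h0, S.mainTerm_eq h0]
    exact mul_ne_zero (neg_ne_zero.2 (S.phase_ne_zero h0)) (one_sub_tanh_sq_pos _).ne'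
  · intro n hn K _ hKT
    -- The tail with ε^(n+1) factored out has N - n terms, while `phaseSum` with parameter N - n has
    -- one more; the surplus last term is set to zero, which also covers n = N.
    obtain ⟨C, hC0, hC⟩ := exists_phaseSum_bound (φ := φ) (N := N - n)
      (h := fun j => if n + 1 + j ≤ N then v (n + 1 + j) else fun _ _ => 0) (T := T)
      (fun j _ => by
        split_ifs with h
        · exact (hs _ h).rapid
        · exact rapid_zero) 0
    refine ⟨C + 1, by positivity, 1, one_pos, fun ε hε z hz => ?_⟩
    have h1 := hC ε hε z.2 (hKT hz).2 z.1
    have hε0 := hε.1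
    rw [pow_zero, one_mul] at h1
    have e : approx φ (prolong v) N z.1 z.2 ε
        - partialSum φ (fun _ _ _ => 0) (prolong v) n z.1 z.2 ε
        = ε ^ (n + 1) * phaseSum φ (N - n)
          (fun j => if n + 1 + j ≤ N then v (n + 1 + j) else fun _ _ => 0) z.1 z.2 ε := by
      obtain ⟨k, rfl⟩ := Nat.exists_eq_add_of_le hn
      simp only [approx, partialSum, prolong, zero_add, phaseSum, Nat.add_sub_cancel_left]
      rw [show n + k + 1 = n + 1 + k by ring, Finset.sum_range_add, add_sub_cancel_left,
        Finset.sum_range_succ, if_neg (by omega), mul_zero, add_zero, Finset.mul_sum]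
      refine Finset.sum_congr rfl fun j hj => ?_
      have := Finset.mem_range.1 hj
      rw [if_pos (by omega), pow_add]
      ring
    simp only
    rw [e, abs_mul, abs_pow, abs_of_pos hε0, mul_comm]
    gcongr
    linarith

end Setting

end Residual

end VcmCH

end

theorem theorem3 (T : ℝ) (hT : 0 < T) (N : ℕ)
    (a b : ℕ → ℝ → ℝ → ℝ) (aε bε : ℝ → ℝ → ℝ → ℝ)
    (haε : VcmCH.IsBigOEps T (N + 1)
      (fun x t ε => aε x t ε - ∑ k ∈ Finset.range (N + 1), ε ^ k * a k x t))
    (hbε : VcmCH.IsBigOEps T (N + 1)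
      (fun x t ε => bε x t ε - ∑ k ∈ Finset.range (N + 1), ε ^ k * b k x t))
    (ha : ∀ k ≤ N, ContDiffOn ℝ ∞ (fun z : ℝ × ℝ => a k z.1 z.2) (VcmCH.strip T))
    (hb : ∀ k ≤ N, ContDiffOn ℝ ∞ (fun z : ℝ × ℝ => b k z.1 z.2) (VcmCH.strip T))
    (hab : ∀ x : ℝ, ∀ t ∈ Icc 0 T, a 0 x t * b 0 x t ≠ 0)
    (φ : ℝ → ℝ) (hφ : VcmCH.IsPhase T (a 0) (b 0) φ)
    (hpos : ∀ t ∈ Icc 0 T, 0 < a 0 (φ t) t)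
    (C₀ : ℝ → ℝ) (hC₀ : ContDiffOn ℝ ∞ C₀ (Icc 0 T)) :
    -- the terms can be constructed one after the other
    (∀ n < N, ∀ v : ℕ → ℝ → ℝ → ℝ, VcmCH.AreTerms T a b φ C₀ n v →
      (∀ j, 1 ≤ j → j ≤ n + 1 →
        VcmCH.Orthogonality T a b φ v j ∧ VcmCH.LimitCondition T a b φ v j) →
      ∃ w : ℝ → ℝ → ℝ, VcmCH.InGt0 T w ∧ VcmCH.SolvesTermEq T a b φ v (n + 1) w) ∧
    -- and, however they are chosen, they give the approximation with the stated accuracy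
    (∀ v : ℕ → ℝ → ℝ → ℝ, VcmCH.AreTerms T a b φ C₀ N v →
      (∀ j, 1 ≤ j → j ≤ N →
        VcmCH.Orthogonality T a b φ v j ∧ VcmCH.LimitCondition T a b φ v j) →
      (∀ j ≤ N, VcmCH.InG0 T (VcmCH.prolong v j)) ∧
      (∀ ε > 0, ContDiffOn ℝ ∞
        (fun z : ℝ × ℝ => VcmCH.approx φ (VcmCH.prolong v) N z.1 z.2 ε) (VcmCH.strip T)) ∧
      VcmCH.IsSolitonLike T N φ (fun _ _ _ => 0) (VcmCH.prolong v)
        (VcmCH.approx φ (VcmCH.prolong v) N) ∧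
      VcmCH.IsBigOEps T N
        (VcmCH.residual T aε bε (VcmCH.approx φ (VcmCH.prolong v) N)) ∧
      VcmCH.IsBigOEpsAtInfinity T φ (N + 1)
        (VcmCH.residual T aε bε (VcmCH.approx φ (VcmCH.prolong v) N))) := by
  have S : VcmCH.Setting T N a b φ C₀ := ⟨hT, ha, hb, hab, hφ, hpos, hC₀⟩
  refine ⟨fun n hn v hv h => S.exists_next_term hn hv h, fun v hv h => ?_⟩
  have hs := S.sch_terms le_rfl hv fun j h1 hj => (h j h1 hj).2
  exact ⟨fun j hj => (hs j hj).inG0 hT,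
    fun ε _ => VcmCH.contDiffOn_phaseSum (fun j hj => (hs j hj).smooth) hT S.contDiffOn_phase ε,
    S.isSolitonLike hv hs, S.residual_isBigO hv hs haε hbε,
    S.residual_isBigO_atInfinity hs haε hbε⟩
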